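/- **Setting.** Let $\mathfrak A_0,\mathfrak A_1$ be complex Hilbert spaces, $\mathfrak A_1\ne\{0\}$, let $A_0$, $A_1$ be (possibly unbounded) self-adjoint operators in $\mathfrak A_0$, $\mathfrak A_1$, and let $B:\mathfrak A_1\to\mathfrak A_0$ be bounded. The spectrum of $A_0$ is absolutely continuous and equal to the closure of an open interval $\Delta_0=(\mu_0^{(1)},\mu_0^{(2)})$, $-\infty\le\mu_0^{(1)}<\mu_0^{(2)}\le\infty$, and $\sigma_1:=\operatorname{spec}(A_1)\subset\Delta_0$. Let $E_0$ be the spectral measure of $A_0$ and $K_B(\mu)=B^*E_0((-\infty,\mu))B$. Assume that $K_B$ is differentiable on $\Delta_0$ in the operator norm and that $K_B'$ continues analytically from $\Delta_0$ to a simply connected domain $D^-\subset\mathbb C^-$ whose boundary contains $\Delta_0$, and to its mirror image $D^+=\overline{D^-}$ (complex conjugation). If an end point $\mu_0^{(k)}$ is finite, assume $\|K_B'(\mu)\|\le C|\mu-\mu_0^{(k)}|^{\gamma}$ for $\mu\in D^\pm$ near $\mu_0^{(k)}$, with some $C>0$, $\gamma\in(-1,0]$. For $l=\pm1$ an *admissible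 contour* $\Gamma^l\subset D^l$ is a (locally) rectifiable Jordan curve obtained from $\Delta_0$ by a continuous deformation inside $D^l$ with fixed end points (finite or infinite), such that $\mathcal V_0(B,\Gamma^l)=\int_{\Gamma^l}|d\mu|\,\|K_B'(\mu)\|<\infty$. Put $d(\Gamma^l)=\operatorname{dist}(\sigma_1,\Gamma^l)$. Let $\Gamma^{+1},\Gamma^{-1}$ be admissible contours with $$\mathcal V_0(B,\Gamma^l)<\tfrac14 d(\Gamma^l)^2,\qquad l=\pm1.$$ If $\Delta_0$ is unbounded, assume moreover that either $\Gamma^{-1}=\overline{\Gamma^{+1}}$, or $\|K_B'(\mu)\|\le C|\mu|^{\gamma}$ for $\mu\in D^\pm$ with $|\mu|$ large, with some $C>0$, $\gamma<-1$. Let $X^{(l)}$ be the unique bounded operator on $\mathfrak A_1$ with $\|X^{(l)}\|<d(\Gamma^l)-\sqrt{\mathcal V_0(B,\Gamma^l)}$ and $$X^{(l)}=-\int_{\Gamma^l}d\mu\,K_B'(\mu)\,(A_1+X^{(l)}-\mu)^{-1},$$ put $Z^{(l)}=A_1+X^{(l)}$, and $$\Omega^{(l)}=\int_{\Gamma^l}d\mu\,(Z^{(-l)*}-\mu)^{-1}K_B'(\mu)(Z^{(l)}-\mu)^{-1},$$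 $$M_1(z,\Gamma^l)=A_1-z+\int_{\Gamma^l}d\mu\,K_B'(\mu)(\mu-z)^{-1}.$$ **Theorem.** For $l=\pm1$ the integral defining $\Omega^{(l)}$ converges absolutely and 1. $\displaystyle\|\Omega^{(l)}\|\le\frac{\mathcal V_0(B,\Gamma^l)}{\frac14d(\Gamma^l)^2}<1$, where the first inequality is strict if $B\neq0$; 2. $\Omega^{(-l)}=\Omega^{(l)*}$; 3. $I-\Omega^{(l)}$ has a bounded inverse and $(I-\Omega^{(l)})^{-1}Z^{(-l)*}=Z^{(l)}(I-\Omega^{(l)})^{-1}$, including equality of domains. 4. If $A_1$ is bounded and $\gamma$ is a rectifiable closed contour (a finite union of closed curves) lying in $\{z:\operatorname{dist}(z,\sigma_1)\le d(\Gamma^l)/2\}\setminus\operatorname{spec}(Z^{(l)})$ whose total winding number around each point of $\operatorname{spec}(Z^{(l)})$ is $1$, then $M_1(z,\Gamma^l)$ has a bounded inverse for every $z\in\gamma$, and $$-\frac1{2\pi i}\oint_\gamma M_1(z,\Gamma^l)^{-1}dz=(I-\Omega^{(l)})^{-1},$$ $$-\frac1{2\pi i}\oint_\gamma z\,M_1(z,\Gamma^l)^{-1}dz=(I-\Omega^{(l)})^{-1}Z^{(-l)*}=Z^{(l)}(I-\Omega^{(l)})^{-1}.$$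 In particular $Z^{(+1)}$ and $Z^{(-1)*}$ are similar. -/

import Mathlib

open Set Filter Topology MeasureTheory
open scoped ENNReal ComplexConjugate

noncomputable section

namespace Feshbach

/-! ### Unbounded operators in a Hilbert space -/

section Operators

variable {H : Type*} [NormedAddCommGroup H] [InnerProductSpace ℂ H]

/-- `R` is the everywhere defined bounded two-sided inverse of the (possibly unbounded)
operator `T`. -/
def IsBoundedInverse (T : H →ₗ.[ℂ] H) (R : H →L[ℂ] H) : Prop :=
  (∀ x : T.domain, R (T x) = x) ∧ ∀ y : H, ∃ h : R y ∈ T.domain, T ⟨R y, h⟩ = y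

open Classical in
/-- The bounded inverse of `T` (and `0` if `T` has no bounded inverse). -/
def boundedInverse (T : H →ₗ.[ℂ] H) : H →L[ℂ] H :=
  if h : ∃ R, IsBoundedInverse T R then h.choose else 0

/-- The operator `A + X` with domain `Dom A`, where `X` is bounded. -/
def addBounded (A : H →ₗ.[ℂ] H) (X : H →L[ℂ] H) : H →ₗ.[ℂ] H :=
  (X : H →ₗ[ℂ] H) +ᵥ A

/-- The operator `T - z` with domain `Dom T`. -/
def shift (T : H →ₗ.[ℂ] H) (z : ℂ) : H →ₗ.[ℂ] H :=
  addBounded T (-(z • (1 : H →L[ℂ] H)))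

/-- The spectrum of a possibly unbounded operator. -/
def spec (T : H →ₗ.[ℂ] H) : Set ℂ :=
  {z | ¬ ∃ R, IsBoundedInverse (shift T z) R}

/-- The resolvent `(T - z)⁻¹`. -/
def resolventOp (T : H →ₗ.[ℂ] H) (z : ℂ) : H →L[ℂ] H :=
  boundedInverse (shift T z)

/-- The product `T S` with `S` bounded, on its natural domain `{x | S x ∈ Dom T}`. -/
def mulBounded (T : H →ₗ.[ℂ] H) (S : H →L[ℂ] H) : H →ₗ.[ℂ] H where
  domain := T.domain.comap (S : H →ₗ[ℂ] H)
  toFun :=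
    { toFun := fun x => T ⟨S x, x.2⟩
      map_add' := fun x y => by
        rw [← T.map_add]; congr 1; ext; simp
      map_smul' := fun a x => by
        rw [RingHom.id_apply, ← T.map_smul]; congr 1; ext; simp }

/-- The product `S T` with `S` bounded, with domain `Dom T`. -/
def boundedMul (S : H →L[ℂ] H) (T : H →ₗ.[ℂ] H) : H →ₗ.[ℂ] H :=
  (S : H →ₗ[ℂ] H).compPMap T

/-- A bounded operator regarded as an operator with domain the whole space. -/
def everywhere (S : H →L[ℂ] H) : H →ₗ.[ℂ] H :=
  (S : H →ₗ[ℂ] H).toPMap ⊤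

/-- Similarity of two possibly unbounded operators: `T = V S V⁻¹`, domains included, with `V`
bounded and boundedly invertible. -/
def Similar (S T : H →ₗ.[ℂ] H) : Prop :=
  ∃ V : H ≃L[ℂ] H, ∀ x y : H, (x, y) ∈ S.graph ↔ (V x, V y) ∈ T.graph

end Operators

/-! ### Spectral measures -/

/-- A projection-valued measure on the Borel sets of the real line. -/
structure ProjectionMeasure (H : Type*) [NormedAddCommGroup H] [InnerProductSpace ℂ H]
    [CompleteSpace H] where
  /-- The projection attached to a set; only its values on Borel sets matter. -/
  proj : Set ℝ → H →L[ℂ] H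
  isStarProjection : ∀ s, MeasurableSet s → IsStarProjection (proj s)
  empty : proj ∅ = 0
  univ : proj Set.univ = 1
  hasSum : ∀ (s : ℕ → Set ℝ), (∀ i, MeasurableSet (s i)) → Pairwise (Function.onFun Disjoint s) →
    ∀ x, HasSum (fun i => proj (s i) x) (proj (⋃ i, s i) x)

section Spectral

variable {H : Type*} [NormedAddCommGroup H] [InnerProductSpace ℂ H] [CompleteSpace H]

theorem inner_starProjection {P : H →L[ℂ] H} (hP : IsStarProjection P) (x : H) :
    RCLike.re (inner ℂ x (P x)) = ‖P x‖ ^ 2 := by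
  have h1 : P (P x) = P x := by
    have := hP.isIdempotentElem
    exact DFunLike.congr_fun this x
  have h2 : ContinuousLinearMap.adjoint P = P := hP.isSelfAdjoint
  have h3 : inner ℂ x (P x) = inner ℂ (P x) (P x) := by
    conv_lhs => rw [← h1]
    rw [← ContinuousLinearMap.adjoint_inner_left, h2]
  rw [h3, inner_self_eq_norm_sq]

/-- The scalar measure `s ↦ ⟨E(s) x, x⟩ = ‖E(s) x‖²`. -/
def ProjectionMeasure.scalar (E : ProjectionMeasure H) (x : H) : Measure ℝ :=
  Measure.ofMeasurable (fun s _ => ENNReal.ofReal (‖E.proj s x‖ ^ 2))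
    (by simp [E.empty])
    (by
      intro f hf hd
      have h := E.hasSum f hf hd x
      have h2 : HasSum (fun i => ‖E.proj (f i) x‖ ^ 2) (‖E.proj (⋃ i, f i) x‖ ^ 2) := by
        have h3 := (RCLike.hasSum_re ℂ (h.mapL (innerSL ℂ x)))
        simp only [innerSL_apply_apply] at h3
        rw [inner_starProjection (E.isStarProjection _ (MeasurableSet.iUnion hf))] at h3
        have h4 : (fun i => RCLike.re (inner ℂ x (E.proj (f i) x))) =
            fun i => ‖E.proj (f i) x‖ ^ 2 :=
          funext fun i => inner_starProjection (E.isStarProjection _ (hf i)) x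
        rwa [h4] at h3
      rw [← h2.tsum_eq, ENNReal.ofReal_tsum_of_nonneg (fun i => by positivity) h2.summable])

/-- `E` is the spectral measure of the self-adjoint operator `A`, that is, `A = ∫ t dE(t)` with
the domain of all `x` such that `∫ t² d⟨E(t) x, x⟩ < ∞`. -/
structure IsSpectralMeasure (A : H →ₗ.[ℂ] H) (E : ProjectionMeasure H) : Prop where
  mem_domain : ∀ x : H, x ∈ A.domain ↔ ∫⁻ t, ENNReal.ofReal (t ^ 2) ∂(E.scalar x) < ∞
  inner_eq : ∀ x : A.domain, inner ℂ (x : H) (A x) = ((∫ t, t ∂(E.scalar (x : H)) : ℝ) : ℂ)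

end Spectral

/-! ### The setting -/

/-- The diagonal entries `A₀`, `A₁` and the coupling `B` of the block operator matrix
`L = [[A₀, B], [-B*, A₁]]`, together with the analytic continuation of `K_B'`. -/
structure Setting (H₀ H₁ : Type*) [NormedAddCommGroup H₀] [InnerProductSpace ℂ H₀]
    [CompleteSpace H₀] [NormedAddCommGroup H₁] [InnerProductSpace ℂ H₁] [CompleteSpace H₁] where
  A₀ : H₀ →ₗ.[ℂ] H₀
  A₁ : H₁ →ₗ.[ℂ] H₁
  B : H₁ →L[ℂ] H₀
  selfAdjoint₀ : IsSelfAdjoint A₀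
  selfAdjoint₁ : IsSelfAdjoint A₁
  /-- the spectral measure of `A₀` -/
  E₀ : ProjectionMeasure H₀
  isSpectralMeasure : IsSpectralMeasure A₀ E₀
  /-- the end points of the interval `Δ₀`, possibly infinite -/
  left : EReal
  right : EReal
  left_lt_right : left < right
  /-- all the spectrum of `A₀` is absolutely continuous -/
  absolutelyContinuous : ∀ x : H₀, E₀.scalar x ≪ volume
  /-- `σ₀` is the closure of `Δ₀` -/
  spec₀ : spec A₀ = closure ((fun t : ℝ => (t : ℂ)) '' {t : ℝ | left < t ∧ t < right})
  /-- `σ₁ ⊆ Δ₀` -/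
  spec₁ : spec A₁ ⊆ (fun t : ℝ => (t : ℂ)) '' {t : ℝ | left < t ∧ t < right}
  /-- the domain `D⁻` in the lower half-plane -/
  Dminus : Set ℂ
  isOpen_Dminus : IsOpen Dminus
  isSimplyConnected_Dminus : IsSimplyConnected Dminus
  Dminus_subset : ∀ z ∈ Dminus, z.im < 0
  subset_frontier :
    (fun t : ℝ => (t : ℂ)) '' {t : ℝ | left < t ∧ t < right} ⊆ frontier Dminus
  /-- the continued derivative `K_B'` on `D⁻ ∪ Δ₀ ∪ D⁺`, where `D⁺` is the mirror image of `D⁻` -/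
  K' : ℂ → H₁ →L[ℂ] H₁
  /-- `K_B(t) = B* E₀((-∞, t)) B` is differentiable on `Δ₀` in the operator norm, and `K'`
  extends its derivative -/
  hasDerivAt : ∀ t : ℝ, left < t → t < right →
    HasDerivAt (fun s : ℝ =>
      (ContinuousLinearMap.adjoint B) ∘L (E₀.proj (Set.Iio s)) ∘L B) (K' (t : ℂ)) t
  analytic : AnalyticOnNhd ℂ K' (Dminus ∪
    (fun t : ℝ => (t : ℂ)) '' {t : ℝ | left < t ∧ t < right} ∪ (fun z : ℂ => conj z) '' Dminus)
  /-- the bound near a finite end point of `Δ₀` -/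
  endpoint_bound : ∀ a : ℝ, ((a : EReal) = left ∨ (a : EReal) = right) →
    ∃ C > 0, ∃ γ : ℝ, -1 < γ ∧ γ ≤ 0 ∧ ∃ ε > 0,
      ∀ μ ∈ Dminus ∪ (fun z : ℂ => conj z) '' Dminus, ‖μ - a‖ < ε →
        ‖K' μ‖ ≤ C * ‖μ - a‖ ^ γ

namespace Setting

variable {H₀ H₁ : Type*} [NormedAddCommGroup H₀] [InnerProductSpace ℂ H₀] [CompleteSpace H₀]
  [NormedAddCommGroup H₁] [InnerProductSpace ℂ H₁] [CompleteSpace H₁] (S : Setting H₀ H₁)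

/-- The open interval `Δ₀`. -/
def Δ₀ : Set ℝ := {t : ℝ | S.left < t ∧ t < S.right}

/-- The domains `D^l`, `l = ±1`. -/
def D (l : ℤˣ) : Set ℂ := if l = -1 then S.Dminus else (fun z : ℂ => conj z) '' S.Dminus

/-- `σ₁`, the spectrum of `A₁`. -/
def σ₁ : Set ℂ := spec S.A₁

/-- The real parameter tends to the left (right) end point of `Δ₀` from inside. -/
def leftEnd : Filter ℝ := comap (fun t : ℝ => (t : EReal)) (𝓝[>] S.left)

/-- See `leftEnd`. -/
def rightEnd : Filter ℝ := comap (fun t : ℝ => (t : EReal)) (𝓝[<] S.right)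

/-- Complex neighbourhoods of an end point: the point itself if it is finite, infinity
otherwise. -/
def endPoint (e : EReal) : Filter ℂ :=
  if e = ⊤ ∨ e = ⊥ then Bornology.cobounded ℂ else 𝓝 (e.toReal : ℂ)

/-- A rectifiable Jordan curve in `D^l` that is a continuous deformation of `Δ₀` inside `D^l` with
the end points fixed. It is parametrized over `Δ₀` by a Lipschitz function (for instance, with
constant speed), so it has finite length if `Δ₀` is bounded, and locally finite length
otherwise. -/
structure IsContour (l : ℤˣ) (c : ℝ → ℂ) : Prop where
  lipschitz : ∃ k, LipschitzOnWith k c S.Δ₀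
  injOn : InjOn c S.Δ₀
  mapsTo : MapsTo c S.Δ₀ (S.D l)
  deformation : ∃ h : ℝ × ℝ → ℂ,
    ContinuousOn h (Icc 0 1 ×ˢ S.Δ₀) ∧
    (∀ t ∈ S.Δ₀, h (0, t) = t) ∧
    (∀ t ∈ S.Δ₀, h (1, t) = c t) ∧
    (∀ s ∈ Ioc (0 : ℝ) 1, ∀ t ∈ S.Δ₀, h (s, t) ∈ S.D l) ∧
    Tendsto h (𝓟 (Icc 0 1) ×ˢ S.leftEnd) (endPoint S.left) ∧
    Tendsto h (𝓟 (Icc 0 1) ×ˢ S.rightEnd) (endPoint S.right)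

/-- The variation `𝒱₀(B, Γ) = ∫_Γ |dμ| ‖K_B'(μ)‖`. -/
def variation (c : ℝ → ℂ) : ℝ := ∫ t in S.Δ₀, ‖deriv c t‖ * ‖S.K' (c t)‖

/-- Admissible contours: those of finite variation. -/
structure IsAdmissible (l : ℤˣ) (c : ℝ → ℂ) : Prop extends S.IsContour l c where
  finite_variation : IntegrableOn (fun t => ‖deriv c t‖ * ‖S.K' (c t)‖) S.Δ₀

/-- `d(Γ) = dist(σ₁, Γ)`. -/
def dist (c : ℝ → ℂ) : ℝ := ⨅ t : S.Δ₀, Metric.infDist (c t) S.σ₁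

/-- `W₁(z, Γ) = ∫_Γ dμ K_B'(μ) (μ - z)⁻¹`. -/
def W₁ (c : ℝ → ℂ) (z : ℂ) : H₁ →L[ℂ] H₁ :=
  ∫ t in S.Δ₀, (deriv c t * (c t - z)⁻¹) • S.K' (c t)

/-- The continued Schur complement `M₁(z, Γ) = A₁ - z + W₁(z, Γ)`. -/
def M₁ (c : ℝ → ℂ) (z : ℂ) : H₁ →ₗ.[ℂ] H₁ := addBounded (shift S.A₁ z) (S.W₁ c z)

/-- The transformator `W₁(Z, Γ) = -∫_Γ dμ K_B'(μ) (Z - μ)⁻¹`. -/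
def W₁op (c : ℝ → ℂ) (Z : H₁ →ₗ.[ℂ] H₁) : H₁ →L[ℂ] H₁ :=
  -∫ t in S.Δ₀, deriv c t • (S.K' (c t) ∘L resolventOp Z (c t))

/-- `X` is the solution of `X = W₁(A₁ + X, Γ)` with `‖X‖ < r_max(Γ) = d(Γ) - √𝒱₀(B, Γ)`; there is
exactly one if `𝒱₀(B, Γ) < d(Γ)² / 4`. -/
structure IsRootPart (c : ℝ → ℂ) (X : H₁ →L[ℂ] H₁) : Prop where
  norm_lt : ‖X‖ < S.dist c - √(S.variation c)
  equation : X = S.W₁op c (addBounded S.A₁ X)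

/-- `Z = A₁ + X`. -/
def Z (X : H₁ →L[ℂ] H₁) : H₁ →ₗ.[ℂ] H₁ := addBounded S.A₁ X

/-- The integrand of `Ω^(l)`, with `X = X^(l)` and `Y = X^(-l)`. -/
def omegaIntegrand (c : ℝ → ℂ) (X Y : H₁ →L[ℂ] H₁) (t : ℝ) : H₁ →L[ℂ] H₁ :=
  deriv c t •
    (resolventOp (S.Z Y).adjoint (c t) ∘L S.K' (c t) ∘L resolventOp (S.Z X) (c t))

/-- `Ω^(l) = ∫_{Γ^l} dμ (Z^(-l)* - μ)⁻¹ K_B'(μ) (Z^(l) - μ)⁻¹`. -/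
def Omega (Γ : ℤˣ → ℝ → ℂ) (X : ℤˣ → H₁ →L[ℂ] H₁) (l : ℤˣ) : H₁ →L[ℂ] H₁ :=
  ∫ t in S.Δ₀, S.omegaIntegrand (Γ l) (X l) (X (-l)) t

/-- Integrable power decay of `K_B'` at the infinite end points of `Δ₀` (no condition if `Δ₀` is bounded). -/
def DecayAtInfinity : Prop :=
  S.left = ⊥ ∨ S.right = ⊤ →
    ∃ C > 0, ∃ γ : ℝ, γ < -1 ∧ ∃ R > 0, ∀ l, ∀ μ ∈ S.D l, R < ‖μ‖ → ‖S.K' μ‖ ≤ C * ‖μ‖ ^ γ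

end Setting

/-! ### Closed contours -/

section Cycles

variable {F : Type*} [NormedAddCommGroup F] [NormedSpace ℂ F]

/-- A closed rectifiable contour: finitely many closed curves, each with a Lipschitz
parametrization. -/
structure ClosedContour where
  n : ℕ
  curve : Fin n → ℝ → ℂ
  lipschitz : ∀ i, ∃ k, LipschitzOnWith k (curve i) (Icc 0 1)
  closed : ∀ i, curve i 0 = curve i 1

/-- The points of the contour. -/
def ClosedContour.support (γ : ClosedContour) : Set ℂ := ⋃ i, γ.curve i '' Icc 0 1

/-- `∮_γ f(z) dz`. -/
def ClosedContour.integral (γ : ClosedContour) (f : ℂ → F) : F :=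
  ∑ i, ∫ t in (0 : ℝ)..1, deriv (γ.curve i) t • f (γ.curve i t)

/-- The integral of `f` along `γ` is absolutely convergent. -/
def ClosedContour.Integrable (γ : ClosedContour) (f : ℂ → F) : Prop :=
  ∀ i, IntervalIntegrable (fun t => deriv (γ.curve i) t • f (γ.curve i t)) volume 0 1

/-- `γ` goes around the set `K` once in the positive direction, inside the set `U`. -/
structure ClosedContour.GoesAround (γ : ClosedContour) (K U : Set ℂ) : Prop where
  inside : γ.support ⊆ U
  disjoint : Disjoint γ.support K
  winding : ∀ w ∈ K, (2 * Real.pi * Complex.I)⁻¹ * γ.integral (fun z => (z - w)⁻¹) = 1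

end Cycles

end Feshbach

end

/-! Fix `l`, put `X = X^(l)` and `Y = X^(-l)*`, and along `Γ^l` write `κ` for the density of
`K_B'(μ) dμ` and `r`, `q` for the resolvents of `A₁ + X`, `A₁ + Y` at the points of the contour.
Everything rests on two equations over the same contour, `X = -∫ κ r` and `Y = -∫ q κ`. If `R`, `Q`
are the resolvents of the two operators at a common regular point, the resolvent identity gives `Q
(q κ - κ r) R = Q q κ r - q κ r R` pointwise. Integrated, this is `Q (X - Y) R = Q Ω - Ω R`, whose
left side is `Q - R`. Hence `Q (1 - Ω) = (1 - Ω) R` (`ResolventKernel.resolvent_mul_one_sub_omega`),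
which contains the operator identity with its domains and the similarity. A quadratic inequality
forces `‖X‖` and `‖Y‖` below `d / 2`, so on the contour both resolvents are smaller than `2 / d`;
this bounds `Ω`.

The first equation defines `X`. The second one, and `Ω^(-l) = Ω^(l)*`, arise by taking adjoints,
which by the reflection symmetry of `K_B'` leads to integrals along the mirror image of a contour.
This mirror image has to be exchanged for the other given contour (`Setting.integral_density_eq`),
against two difficulties.

The resolvents are singular near `σ₁`, possibly also inside `D⁻`. Their argument is therefore
shifted by `w`. For large `Im w` the singularities lie in the upper half-plane and the contour can
be deformed; both integrals are holomorphic in `w` on a half-strip containing `0`, and the identity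
theorem leads back to `w = 0`.

The domain `D⁻` has no regularity along `Δ₀`, and the bounds at the end points hold only inside `D⁻`
and its mirror image, so contours cannot simply be closed up by small arcs. Each integral is instead
compared with increments of one primitive on `Δ₀`, along circular crosscuts around the end points.
That the arc from `Δ₀` to its first contact with the curve stays in `D⁻` is a winding argument
(`LowerDeformation.mem_of_arc_disjoint`): a point of the arc outside the simply connected `D⁻` would
yield a branch of the logarithm of a Möbius map that is continuous across the cut of the principal
branch. If both end points are infinite, the two ends of the curve are told apart by the Cauchy
kernel of a point outside `D⁻`; if there is no such point, `K_B'` is entire and vanishes by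
Liouville.

Strictness requires a positive variation. If the variation vanishes, so does `K_B'` on `Δ₀`, and
since the spectral measure of `A₀` lives on `Δ₀`, also `B = 0`.

For bounded `A₁` the transfer function factors as `M₁(z) = F(z) (A₁ + X - z)`, and `F(z) - (A₁ + Y -
z) G(z) = 1 - Ω` with `F`, `F⁻¹`, `G` holomorphic near `σ₁`. Consequently `M₁(z)⁻¹ = (A₁ + X - z)⁻¹
(1 - Ω)⁻¹` up to a function holomorphic near `σ₁`, and the contour integrals reduce to Riesz
integrals of the resolvent of `A₁ + X`. -/

noncomputable section

namespace Feshbach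

/-! ### Primitives, line integrals, holomorphic parameter integrals -/

section Primitive

variable {E : Type*} [NormedAddCommGroup E] [NormedSpace ℂ E]

/-- A copy of `E` with the discrete topology. -/
def DiscreteCopy (E : Type*) : Type _ := E

instance : TopologicalSpace (DiscreteCopy E) := ⊥

instance : DiscreteTopology (DiscreteCopy E) := ⟨rfl⟩

/-- Two primitives of the same function differ by a locally constant function. -/
theorem eventually_sub_eq_of_hasDerivAt {f φ ψ : ℂ → E} {V W : Set ℂ} (hV : IsOpen V)
    (hW : IsOpen W) (hφ : ∀ z ∈ V, HasDerivAt φ (f z) z) (hψ : ∀ z ∈ W, HasDerivAt ψ (f z) z)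
    {z : ℂ} (hz : z ∈ V ∩ W) : ∀ᶠ w in 𝓝 z, φ w - ψ w = φ z - ψ z := by
  obtain ⟨r, hr, hball⟩ := Metric.isOpen_iff.1 (hV.inter hW) z hz
  filter_upwards [Metric.ball_mem_nhds z hr] with w hw
  have key := (convex_ball z r).is_const_of_fderivWithin_eq_zero (𝕜 := ℂ)
    (f := fun w => φ w - ψ w) (fun y hy =>
      ((hφ y (hball hy).1).sub (hψ y (hball hy).2)).differentiableAt.differentiableWithinAt)
    (fun y hy => by
      have h := ((hφ y (hball hy).1).sub (hψ y (hball hy).2))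
      rw [sub_self] at h
      have h2 : HasFDerivAt (fun w => φ w - ψ w) (0 : ℂ →L[ℂ] E) y := by
        have := h.hasFDerivAt
        simpa using! this
      exact h2.hasFDerivWithinAt.fderivWithin (Metric.isOpen_ball.uniqueDiffWithinAt hy))
    hw (Metric.mem_ball_self hr)
  exact key

/-- The bundle of local primitives. -/
def primitiveCore {U : Set ℂ} {f : ℂ → E} (r : U → ℝ) (hr : ∀ x, 0 < r x) (φ : U → ℂ → E)
    (hφ : ∀ x : U, ∀ z ∈ Metric.ball (x : ℂ) (r x), HasDerivAt (φ x) (f z) z) :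
    FiberBundleCore U U (DiscreteCopy E) where
  baseSet x := {z : U | (z : ℂ) ∈ Metric.ball (x : ℂ) (r x)}
  isOpen_baseSet x := Metric.isOpen_ball.preimage continuous_subtype_val
  indexAt x := x
  mem_baseSet_at x := Metric.mem_ball_self (hr x)
  -- A coordinate `v` in the chart `i` stands for the germ `φ i + v`; in the chart `j` this germ has
  -- the coordinate `v + φ i - φ j`, a locally constant shift and hence continuous into the discrete
  -- fibre.
  coordChange i j z v := (show E from v) + (φ i z - φ j z)
  coordChange_self i z hz v := by
    change (show E from v) + (φ i z - φ i z) = v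
    rw [sub_self, add_zero]
  continuousOn_coordChange i j := by
    rintro ⟨z, v⟩ ⟨hz, -⟩
    refine ContinuousAt.continuousWithinAt ?_
    have h1 : ∀ᶠ w : U in 𝓝 z, φ i w - φ j w = φ i z - φ j z :=
      continuous_subtype_val.continuousAt.eventually
        (eventually_sub_eq_of_hasDerivAt Metric.isOpen_ball Metric.isOpen_ball (hφ i) (hφ j) hz)
    have hv : ({v} : Set (DiscreteCopy E)) ∈ 𝓝 v := by simp
    have h2 : ∀ᶠ p : U × DiscreteCopy E in 𝓝 (z, v), p.2 = v :=
      (continuous_snd.continuousAt (x := (z, v))).eventually_mem hv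
    have h3 : ∀ᶠ p : U × DiscreteCopy E in 𝓝 (z, v), φ i p.1 - φ j p.1 = φ i z - φ j z :=
      (continuous_fst.continuousAt (x := (z, v))).eventually h1
    let k : DiscreteCopy E := (show E from v) + (φ i z - φ j z)
    have hk : ContinuousAt (fun _ : U × DiscreteCopy E => k) (z, v) := continuousAt_const
    refine hk.congr ?_
    filter_upwards [h2, h3] with p hp hp'
    simp only [hp, hp']
    rfl
  coordChange_comp i j k z hz v := by
    change (show E from v) + (φ i z - φ j z) + (φ j z - φ k z) = (show E from v) + (φ i z - φ k z)
    abel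

/-- A holomorphic function on a simply connected open set has a primitive. -/
theorem exists_primitive [CompleteSpace E] {U : Set ℂ} (hU : IsOpen U) (hs : IsSimplyConnected U)
    {f : ℂ → E} (hf : DifferentiableOn ℂ f U) : ∃ G : ℂ → E, ∀ z ∈ U, HasDerivAt G (f z) z := by
  classical
  have h1 : ∀ x : U, ∃ r > 0, Metric.ball (x : ℂ) r ⊆ U := fun x => Metric.isOpen_iff.1 hU x x.2
  choose r hr hball using h1
  have h2 : ∀ x : U, ∃ φ : ℂ → E, ∀ z ∈ Metric.ball (x : ℂ) (r x), HasDerivAt φ (f z) z :=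
    fun x => (hf.mono (hball x)).isExactOn_ball
  choose φ hφ using h2
  let Z := primitiveCore r hr φ hφ
  -- Discrete fibres make the bundle a covering. As `U` is simply connected and locally path
  -- connected, the identity of `U` lifts to a global section, a coherent choice of local
  -- primitives.
  have cov : IsCoveringMap (Bundle.TotalSpace.proj : Z.TotalSpace → U) :=
    FiberBundle.isCoveringMap (F := DiscreteCopy E) (E := Z.Fiber)
  have := hs.simplyConnectedSpace
  have := hU.locallyPathConnectedSpace
  obtain ⟨x₀⟩ : Nonempty U := hs.nonempty.to_subtype
  obtain ⟨σ, ⟨-, hσ⟩, -⟩ := cov.existsUnique_continuousMap_lifts (ContinuousMap.id U) x₀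
    (⟨x₀, (0 : E)⟩ : Z.TotalSpace) rfl
  have hσ' : ∀ z : U, (σ z).proj = z := fun z => congrFun hσ z
  let G : ℂ → E := fun z => if h : z ∈ U then (show E from (σ ⟨z, h⟩).2) + φ ⟨z, h⟩ z else 0
  refine ⟨G, fun z hz => ?_⟩
  let x : U := ⟨z, hz⟩
  have hc : ContinuousAt (fun y : U => (Z.localTriv x (σ y)).2) x := by
    have h3 : ContinuousAt (Z.localTriv x) (σ x) := by
      refine (Z.localTriv x).continuousAt ?_
      rw [(Z.localTriv x).mem_source]
      change (σ x).proj ∈ _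
      rw [hσ']
      exact Z.mem_baseSet_at x
    exact (continuous_snd.continuousAt).comp (ContinuousAt.comp h3 σ.continuous.continuousAt)
  have hev : ∀ᶠ y : U in 𝓝 x, (Z.localTriv x (σ y)).2 = (Z.localTriv x (σ x)).2 :=
    hc.eventually (by
      have : ({(Z.localTriv x (σ x)).2} : Set (DiscreteCopy E)) ∈ 𝓝 (Z.localTriv x (σ x)).2 := by
        simp
      exact this)
  have hform : ∀ y : U, (show E from (Z.localTriv x (σ y)).2) =
      (show E from (σ y).2) + (φ y y - φ x y) := by
    intro y
    have : (Z.localTriv x (σ y)).2 = Z.coordChange (Z.indexAt (σ y).1) x (σ y).1 (σ y).2 := rfl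
    rw [this]
    change (show E from (σ y).2) + (φ (σ y).1 (σ y).1 - φ x (σ y).1) = _
    rw [hσ']
  have hG : ∀ᶠ w in 𝓝 z, G w = φ x w + (show E from (Z.localTriv x (σ x)).2) := by
    have h4 := (hU.nhdsWithin_eq hz) ▸ (eventually_nhds_subtype_iff U x
      (fun w => G w = φ x w + (show E from (Z.localTriv x (σ x)).2))).1 (by
        filter_upwards [hev] with y hy
        have h5 := hform y
        rw [hy] at h5
        have h6 : G y = (show E from (σ y).2) + φ y y := by
          simp only [G, y.2, dif_pos]
        rw [h6, h5]
        abel)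
    exact h4
  have h7 : HasDerivAt (fun w => φ x w + (show E from (Z.localTriv x (σ x)).2)) (f z) z :=
    (hφ x z (Metric.mem_ball_self (hr x))).add_const _
  exact h7.congr_of_eventuallyEq hG

end Primitive

section LineIntegral

/-- The derivative of a Lipschitz curve is essentially bounded. -/
theorem ae_norm_deriv_le_of_lipschitzOnWith {F : Type*} [NormedAddCommGroup F] [NormedSpace ℝ F]
    {c : ℝ → F} {a b : ℝ} {K : NNReal}
    (hc : LipschitzOnWith K c (Icc a b)) :
    ∀ᵐ t ∂(volume.restrict (Icc a b)), ‖deriv c t‖ ≤ K := by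
  rw [← restrict_Ioo_eq_restrict_Icc]
  filter_upwards [ae_restrict_mem measurableSet_Ioo] with t ht
  exact norm_deriv_le_of_lipschitzOn (Icc_mem_nhds ht.1 ht.2) hc

theorem integrableOn_deriv_smul {F : Type*} [NormedAddCommGroup F] [NormedSpace ℂ F]
    {c : ℝ → ℂ} {a b : ℝ} {K : NNReal}
    (hc : LipschitzOnWith K c (Icc a b)) {g : ℝ → F} (hg : ContinuousOn g (Icc a b)) :
    IntegrableOn (fun t => deriv c t • g t) (Icc a b) := by
  obtain ⟨M, hM⟩ := isCompact_Icc.exists_bound_of_continuousOn hg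
  refine Integrable.of_bound (C := K * M) ?_ ?_
  · exact ((measurable_deriv c).aestronglyMeasurable).smul
      (hg.aestronglyMeasurable measurableSet_Icc)
  · filter_upwards [ae_norm_deriv_le_of_lipschitzOnWith hc, ae_restrict_mem measurableSet_Icc]
      with t ht ht'
    rw [norm_smul]
    exact mul_le_mul ht (hM t ht') (norm_nonneg _) K.2

theorem intervalIntegrable_deriv_smul {F : Type*} [NormedAddCommGroup F] [NormedSpace ℂ F]
    {c : ℝ → ℂ} {a b : ℝ} (hab : a ≤ b) {K : NNReal}
    (hc : LipschitzOnWith K c (Icc a b)) {g : ℝ → F} (hg : ContinuousOn g (Icc a b)) :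
    IntervalIntegrable (fun t => deriv c t • g t) volume a b := by
  rw [intervalIntegrable_iff_integrableOn_Icc_of_le hab]
  exact integrableOn_deriv_smul hc hg

/-- Real and imaginary parts are Lipschitz, hence absolutely continuous, and the real fundamental
theorem applies to each. -/
theorem integral_deriv_eq_sub_of_lipschitzOnWith {u : ℝ → ℂ} {a b : ℝ} (hab : a ≤ b) {K : NNReal}
    (hu : LipschitzOnWith K u (Icc a b)) : ∫ t in a..b, deriv u t = u b - u a := by
  have hre : LipschitzOnWith (1 * K) (fun t => (u t).re) (Icc a b) :=
    (Complex.reCLM.lipschitz.weaken (by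
      rw [← NNReal.coe_le_coe]; simp)).comp_lipschitzOnWith hu
  have him : LipschitzOnWith (1 * K) (fun t => (u t).im) (Icc a b) :=
    (Complex.imCLM.lipschitz.weaken (by
      rw [← NNReal.coe_le_coe]; simp)).comp_lipschitzOnWith hu
  rw [← uIcc_of_le hab] at hre him
  have h1 := hre.absolutelyContinuousOnInterval.integral_deriv_eq_sub
  have h2 := him.absolutelyContinuousOnInterval.integral_deriv_eq_sub
  have hd1 := hre.absolutelyContinuousOnInterval.ae_differentiableAt
  have hd2 := him.absolutelyContinuousOnInterval.ae_differentiableAt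
  have hd : ∀ᵐ t, t ∈ uIcc a b → deriv u t = ((deriv (fun t => (u t).re) t : ℝ) : ℂ) +
      ((deriv (fun t => (u t).im) t : ℝ) : ℂ) * Complex.I := by
    filter_upwards [hd1, hd2] with t h1 h2 ht
    have h3 := (h1 ht).hasDerivAt.ofReal_comp
    have h4 := (h2 ht).hasDerivAt.ofReal_comp
    have h5 := h3.add (h4.mul_const Complex.I)
    have h6 : HasDerivAt u _ t := h5.congr_of_eventuallyEq
      (Eventually.of_forall fun s => (Complex.re_add_im (u s)).symm)
    exact h6.deriv
  have hi1 := hre.absolutelyContinuousOnInterval.intervalIntegrable_deriv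
  have hi2 := him.absolutelyContinuousOnInterval.intervalIntegrable_deriv
  rw [intervalIntegral.integral_congr_ae (g := fun t => ((deriv (fun t => (u t).re) t : ℝ) : ℂ) +
      ((deriv (fun t => (u t).im) t : ℝ) : ℂ) * Complex.I)
      (by filter_upwards [hd] with t ht h using ht (uIoc_subset_uIcc h)),
    intervalIntegral.integral_add, intervalIntegral.integral_mul_const,
    intervalIntegral.integral_ofReal, intervalIntegral.integral_ofReal, h1, h2]
  · push_cast
    conv_rhs => rw [← Complex.re_add_im (u b), ← Complex.re_add_im (u a)]
    ring
  · exact ⟨hi1.1.ofReal, hi1.2.ofReal⟩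
  · exact IntervalIntegrable.mul_const ⟨hi2.1.ofReal, hi2.2.ofReal⟩ _

/-- The fundamental theorem of calculus along a Lipschitz curve. -/
theorem integral_deriv_mul_comp {c : ℝ → ℂ} {a b : ℝ} (hab : a ≤ b) {K : NNReal}
    (hc : LipschitzOnWith K c (Icc a b)) {U : Set ℂ} {f G : ℂ → ℂ} (hU : IsOpen U)
    (hG : ∀ z ∈ U, HasDerivAt G (f z) z) (hcU : MapsTo c (Icc a b) U) :
    ∫ t in a..b, deriv c t * f (c t) = G (c b) - G (c a) := by
  have hGa : DifferentiableOn ℂ G U := fun z hz => (hG z hz).differentiableAt.differentiableWithinAt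
  -- `G` is Lipschitz on the compact image of the curve, so `G ∘ c` is again a Lipschitz curve.
  have hloc : LocallyLipschitzOn (c '' Icc a b) G := by
    rintro z ⟨t, ht, rfl⟩
    have hz : c t ∈ U := hcU ht
    have hC1 : ContDiffAt ℂ 1 G (c t) := (hGa.contDiffOn (n := 1) hU).contDiffAt (hU.mem_nhds hz)
    obtain ⟨K', s, hs, hl⟩ := (hC1.hasStrictDerivAt (by simp)).hasStrictFDerivAt.exists_lipschitzOnWith
    exact ⟨K', s ∩ c '' Icc a b, inter_mem (mem_nhdsWithin_of_mem_nhds hs) self_mem_nhdsWithin,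
      hl.mono inter_subset_left⟩
  obtain ⟨K', hK'⟩ := hloc.exists_lipschitzOnWith_of_compact (isCompact_Icc.image_of_continuousOn
    hc.continuousOn)
  have hu : LipschitzOnWith (K' * K) (fun t => G (c t)) (Icc a b) :=
    hK'.comp hc (mapsTo_image _ _)
  rw [← integral_deriv_eq_sub_of_lipschitzOnWith hab hu]
  have hre : LipschitzOnWith (1 * K) (fun t => (c t).re) (Icc a b) :=
    (Complex.reCLM.lipschitz.weaken (by
      rw [← NNReal.coe_le_coe]; simp)).comp_lipschitzOnWith hc
  have him : LipschitzOnWith (1 * K) (fun t => (c t).im) (Icc a b) :=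
    (Complex.imCLM.lipschitz.weaken (by
      rw [← NNReal.coe_le_coe]; simp)).comp_lipschitzOnWith hc
  rw [← uIcc_of_le hab] at hre him
  have hd1 := hre.absolutelyContinuousOnInterval.ae_differentiableAt
  have hd2 := him.absolutelyContinuousOnInterval.ae_differentiableAt
  refine intervalIntegral.integral_congr_ae ?_
  filter_upwards [hd1, hd2] with t h1 h2 ht
  have ht' := uIoc_subset_uIcc ht
  have h3 := (h1 ht').hasDerivAt.ofReal_comp
  have h4 := (h2 ht').hasDerivAt.ofReal_comp
  have h5 := h3.add (h4.mul_const Complex.I)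
  have h6 : HasDerivAt c _ t := h5.congr_of_eventuallyEq
    (Eventually.of_forall fun s => (Complex.re_add_im (c s)).symm)
  have h7 := (hG (c t) (hcU (uIcc_of_le hab ▸ ht'))).comp t h6.differentiableAt.hasDerivAt
  have h8 : deriv (fun t => G (c t)) t = f (c t) * deriv c t := h7.deriv
  rw [h8, mul_comm]

end LineIntegral

section Parameter

/-- An integral depending holomorphically on a parameter is holomorphic. -/
theorem differentiableOn_integral_of_bound {α E : Type*} [MeasurableSpace α]
    [NormedAddCommGroup E] [NormedSpace ℂ E] [CompleteSpace E] {μ : Measure α} {U : Set ℂ}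
    (hU : IsOpen U) {F : ℂ → α → E} {bound : α → ℝ}
    (hmeas : ∀ w ∈ U, AEStronglyMeasurable (F w) μ) (hint : Integrable bound μ)
    (hbound : ∀ᵐ t ∂μ, ∀ w ∈ U, ‖F w t‖ ≤ bound t)
    (hdiff : ∀ᵐ t ∂μ, DifferentiableOn ℂ (fun w => F w t) U) :
    DifferentiableOn ℂ (fun w => ∫ t, F w t ∂μ) U := by
  intro w hw
  obtain ⟨ε, hε, hball⟩ := Metric.isOpen_iff.1 hU w hw
  -- Cauchy's estimate on circles of radius `ε / 4` turns the bound on `F` into an integrable bound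
  -- on its derivative.
  have hder : ∀ᵐ t ∂μ, ∀ x ∈ Metric.ball w (ε / 2),
      ‖deriv (fun w => F w t) x‖ ≤ (4 / ε) * bound t := by
    filter_upwards [hbound, hdiff] with t hb hd x hx
    have hsub : Metric.closedBall x (ε / 4) ⊆ U := fun y hy => hball (by
      rw [Metric.mem_ball] at *
      rw [Metric.mem_closedBall] at hy
      linarith [dist_triangle y x w])
    have := Complex.norm_deriv_le_of_forall_mem_sphere_norm_le (c := x) (R := ε / 4)
      (C := bound t) (f := fun w => F w t) (by positivity)
      ((hd.mono hsub).diffContOnCl_ball (subset_refl _))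
      (fun z hz => hb z (hsub (Metric.sphere_subset_closedBall hz)))
    calc _ ≤ bound t / (ε / 4) := this
      _ = _ := by field_simp
  -- Along a sequence the difference quotients exhibit the derivative as an almost everywhere limit
  -- of measurable functions of `t`.
  obtain ⟨u, hu, hlim⟩ : ∃ u : ℕ → ℂ, (∀ n, u n ∈ U ∧ u n ≠ w) ∧ Tendsto u atTop (𝓝 w) := by
    refine ⟨fun n => w + (ε / 2 * (1 / ((n : ℝ) + 1)) : ℝ), fun n => ⟨hball ?_, ?_⟩, ?_⟩
    · have h0 : (0 : ℝ) < 1 / ((n : ℝ) + 1) := by positivity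
      have h1 : 1 / ((n : ℝ) + 1) ≤ 1 := by
        rw [div_le_one (by positivity)]; linarith [Nat.cast_nonneg (α := ℝ) n]
      rw [Metric.mem_ball, dist_eq_norm, add_sub_cancel_left, Complex.norm_real, Real.norm_eq_abs,
        abs_of_pos (by positivity)]
      nlinarith
    · have h0 : (0 : ℝ) < ε / 2 * (1 / ((n : ℝ) + 1)) := by positivity
      intro h
      have h' : ((ε / 2 * (1 / ((n : ℝ) + 1)) : ℝ) : ℂ) = 0 := by
        linear_combination h
      exact h0.ne' (by exact_mod_cast h')
    · have h2 : Tendsto (fun n : ℕ => ε / 2 * (1 / ((n : ℝ) + 1))) atTop (𝓝 (ε / 2 * 0)) :=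
        tendsto_one_div_add_atTop_nhds_zero_nat.const_mul _
      have h3 := ((Complex.continuous_ofReal.tendsto _).comp h2).const_add w
      simpa using! h3
  have hmeas' : AEStronglyMeasurable (fun t => deriv (fun w => F w t) w) μ := by
    refine aestronglyMeasurable_of_tendsto_ae atTop
      (f := fun n t => (u n - w)⁻¹ • (F (u n) t - F w t)) ?_ ?_
    · intro n
      exact ((hmeas _ (hu n).1).sub (hmeas _ hw)).const_smul _
    · filter_upwards [hdiff] with t hd
      have h1 := (hd.differentiableAt (hU.mem_nhds hw)).hasDerivAt
      rw [hasDerivAt_iff_tendsto_slope] at h1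
      have h2 : Tendsto u atTop (𝓝[≠] w) :=
        tendsto_nhdsWithin_iff.2 ⟨hlim, Eventually.of_forall fun n => (hu n).2⟩
      have := h1.comp h2
      refine this.congr fun n => ?_
      simp [slope]
  have hI : Integrable (F w) μ := hint.mono' (hmeas w hw) (by
    filter_upwards [hbound] with t hb using hb w hw)
  have := hasDerivAt_integral_of_dominated_loc_of_deriv_le (μ := μ) (F := F)
    (F' := fun w t => deriv (fun w => F w t) w) (x₀ := w) (s := Metric.ball w (ε / 2))
    (bound := fun t => (4 / ε) * bound t) (Metric.ball_mem_nhds w (by positivity))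
    (by
      filter_upwards [hU.mem_nhds hw] with x hx using hmeas x hx)
    hI hmeas' hder (hint.const_mul _) (by
      filter_upwards [hdiff] with t hd x hx
      exact (hd.differentiableAt (hU.mem_nhds (hball
        (Metric.ball_subset_ball (by linarith) hx)))).hasDerivAt)
  exact this.2.differentiableAt.differentiableWithinAt

end Parameter

/-! ### Deformations of a real interval into the lower half-plane -/

/-- With the discrete topology on the target, a locally constant map becomes continuous. -/
theorem eq_of_isPreconnected_of_eventually_eq {X Y : Type*} [TopologicalSpace X] {s : Set X}
    (hs : IsPreconnected s) {f : X → Y} (hf : ∀ x ∈ s, ∀ᶠ y in 𝓝[s] x, f y = f x) {x y : X}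
    (hx : x ∈ s) (hy : y ∈ s) : f x = f y := by
  let F : X → DiscreteCopy Y := f
  have hF : ContinuousOn F s := by
    intro x hx
    have hc : ContinuousWithinAt (fun _ : X => F x) s x := continuousWithinAt_const
    exact hc.congr_of_eventuallyEq (hf x hx) rfl
  exact hs.constant hF hx hy

/-- A continuous function with constant exponential is constant on preconnected sets. -/
theorem eq_of_isPreconnected_of_exp_eq {X : Type*} [TopologicalSpace X] {s : Set X}
    (hs : IsPreconnected s) {k : X → ℂ} (hk : ContinuousOn k s) {C : ℂ}
    (hexp : ∀ x ∈ s, Complex.exp (k x) = C) {x y : X} (hx : x ∈ s) (hy : y ∈ s) : k x = k y := by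
  refine eq_of_isPreconnected_of_eventually_eq hs (fun x hx => ?_) hx hy
  have h1 : ∀ᶠ y in 𝓝[s] x, ‖k y - k x‖ < 1 := by
    have := (hk x hx).eventually (Metric.ball_mem_nhds (k x) one_pos)
    filter_upwards [this] with y hy
    simpa [dist_eq_norm] using hy
  filter_upwards [h1, self_mem_nhdsWithin] with y hy hys
  have h2 : Complex.exp (k y - k x) = 1 := by
    rw [Complex.exp_sub, hexp y hys, hexp x hx, div_self]
    rw [← hexp x hx]; exact Complex.exp_ne_zero _
  obtain ⟨n, hn⟩ := Complex.exp_eq_one_iff.1 h2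
  have h3 : n = 0 := by
    by_contra hne
    have h4 : (1 : ℝ) ≤ |(n : ℝ)| := by exact_mod_cast Int.one_le_abs hne
    rw [hn] at hy
    simp only [norm_mul, Complex.norm_intCast, Complex.norm_ofNat, Complex.norm_real,
      Real.norm_eq_abs, Complex.norm_I, mul_one, abs_of_pos Real.pi_pos] at hy
    nlinarith [Real.pi_gt_three]
  rw [h3] at hn
  simpa [sub_eq_zero] using hn

/-- The real points of an open interval with possibly infinite end points. -/
abbrev realIoo (a b : EReal) : Set ℝ := {t : ℝ | a < t ∧ t < b}

theorem isOpen_realIoo (a b : EReal) : IsOpen (realIoo a b) :=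
  isOpen_Ioo.preimage continuous_coe_real_ereal

theorem ordConnected_realIoo (a b : EReal) : (realIoo a b).OrdConnected :=
  ⟨fun _ hx _ hy _ hz => ⟨hx.1.trans_le (EReal.coe_le_coe_iff.2 hz.1),
    (EReal.coe_le_coe_iff.2 hz.2).trans_lt hy.2⟩⟩

theorem convex_realIoo (a b : EReal) : Convex ℝ (realIoo a b) :=
  (ordConnected_realIoo a b).convex

theorem nonempty_realIoo {a b : EReal} (h : a < b) : (realIoo a b).Nonempty := by
  obtain ⟨t, h1, h2⟩ := EReal.lt_iff_exists_real_btwn.1 h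
  exact ⟨t, h1, h2⟩

/-- Real numbers tending to the left end point from the right. -/
abbrev leftFilter (a : EReal) : Filter ℝ := comap (fun t : ℝ => (t : EReal)) (𝓝[>] a)

/-- Real numbers tending to the right end point from the left. -/
abbrev rightFilter (b : EReal) : Filter ℝ := comap (fun t : ℝ => (t : EReal)) (𝓝[<] b)

theorem eventually_leftFilter {a b : EReal} (hab : a < b) {p : ℝ → Prop} :
    (∀ᶠ t in leftFilter a, p t) ↔ ∃ u ∈ realIoo a b, ∀ t ∈ realIoo a b, t ≤ u → p t := by
  constructor
  · intro h
    obtain ⟨V, hV, hVp⟩ := Filter.eventually_comap.1 h |>.exists_mem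
    obtain ⟨u, hu, huV⟩ := (mem_nhdsGT_iff_exists_Ioo_subset' hab).1 hV
    obtain ⟨r, hr1, hr2⟩ := EReal.lt_iff_exists_real_btwn.1 (lt_min (show a < u from hu) hab)
    exact ⟨r, ⟨hr1, hr2.trans_le (min_le_right _ _)⟩, fun t ht htr => hVp t
      (huV ⟨ht.1, (EReal.coe_le_coe_iff.2 htr).trans_lt (hr2.trans_le (min_le_left _ _))⟩) t rfl⟩
  · rintro ⟨u, hu, hp⟩
    refine Filter.eventually_comap.2 ?_
    filter_upwards [Ioo_mem_nhdsGT hu.1] with x hx t ht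
    subst ht
    exact hp t ⟨hx.1, hx.2.trans hu.2⟩ (EReal.coe_le_coe_iff.1 hx.2.le)

theorem eventually_rightFilter {a b : EReal} (hab : a < b) {p : ℝ → Prop} :
    (∀ᶠ t in rightFilter b, p t) ↔ ∃ u ∈ realIoo a b, ∀ t ∈ realIoo a b, u ≤ t → p t := by
  constructor
  · intro h
    obtain ⟨V, hV, hVp⟩ := Filter.eventually_comap.1 h |>.exists_mem
    obtain ⟨u, hu, huV⟩ := (mem_nhdsLT_iff_exists_Ioo_subset' hab).1 hV
    obtain ⟨r, hr1, hr2⟩ := EReal.lt_iff_exists_real_btwn.1 (max_lt (show u < b from hu) hab)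
    exact ⟨r, ⟨(le_max_right _ _).trans_lt hr1, hr2⟩, fun t ht htr => hVp t
      (huV ⟨((le_max_left _ _).trans_lt hr1).trans_le (EReal.coe_le_coe_iff.2 htr), ht.2⟩) t rfl⟩
  · rintro ⟨u, hu, hp⟩
    refine Filter.eventually_comap.2 ?_
    filter_upwards [Ioo_mem_nhdsLT hu.2] with x hx t ht
    subst ht
    exact hp t ⟨hu.1.trans hx.1, hx.2⟩ (EReal.coe_le_coe_iff.1 hx.1.le)

/-- A deformation `h` of a real interval inside a domain of the lower half-plane. -/
structure LowerDeformation (a b : EReal) (D : Set ℂ) (h : ℝ × ℝ → ℂ) : Prop where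
  lt : a < b
  isOpen : IsOpen D
  isSimplyConnected : IsSimplyConnected D
  im_neg : ∀ z ∈ D, z.im < 0
  continuousOn : ContinuousOn h (Icc 0 1 ×ˢ realIoo a b)
  zero : ∀ t ∈ realIoo a b, h (0, t) = t
  mem : ∀ s ∈ Ioc (0 : ℝ) 1, ∀ t ∈ realIoo a b, h (s, t) ∈ D
  left : Tendsto h (𝓟 (Icc 0 1) ×ˢ leftFilter a) (Setting.endPoint a)
  right : Tendsto h (𝓟 (Icc 0 1) ×ˢ rightFilter b) (Setting.endPoint b)

/-- A primitive of `f` on `D` whose composition with the deformation `h` extends continuously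
to the primitive `P` on the real interval. -/
structure DeformedPrimitive (a b : EReal) (D : Set ℂ) (h : ℝ × ℝ → ℂ) (f : ℂ → ℂ) (P : ℝ → ℂ)
    (G : ℂ → ℂ) (g : ℝ × ℝ → ℂ) : Prop where
  hasDerivAt_real : ∀ t ∈ realIoo a b, HasDerivAt P (f t) t
  hasDerivAt : ∀ z ∈ D, HasDerivAt G (f z) z
  continuousOn : ContinuousOn g (Icc 0 1 ×ˢ realIoo a b)
  zero : ∀ t ∈ realIoo a b, g (0, t) = P t
  pos : ∀ s ∈ Ioc (0 : ℝ) 1, ∀ t ∈ realIoo a b, g (s, t) = G (h (s, t))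

theorem exists_primitive_real {a b : EReal} (hab : a < b) {f : ℂ → ℂ}
    (hf : ∀ t ∈ realIoo a b, ContinuousAt f t) :
    ∃ P : ℝ → ℂ, ∀ t ∈ realIoo a b, HasDerivAt P (f t) t := by
  obtain ⟨t₀, ht₀⟩ := nonempty_realIoo hab
  have hc : ∀ t ∈ realIoo a b, ContinuousAt (fun t : ℝ => f t) t := fun t ht =>
    ContinuousAt.comp (g := f) (f := fun t : ℝ => (t : ℂ)) (hf t ht)
      Complex.continuous_ofReal.continuousAt
  have hco : ContinuousOn (fun t : ℝ => f t) (realIoo a b) := fun t ht => (hc t ht).continuousWithinAt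
  refine ⟨fun t => ∫ x in t₀..t, f x, fun t ht => ?_⟩
  refine intervalIntegral.integral_hasDerivAt_right ?_ ?_ (hc t ht)
  · exact (hco.mono ((ordConnected_realIoo a b).uIcc_subset ht₀ ht)).intervalIntegrable
  · exact hco.stronglyMeasurableAtFilter (isOpen_realIoo a b) t ht

namespace LowerDeformation

variable {a b : EReal} {D : Set ℂ} {h : ℝ × ℝ → ℂ}

/-- `D` may be wild along the interval: its trace on a small disc about `x` may be disconnected, and
a primitive on `D` need not extend to the real axis. The comparison takes place in the parameter
plane instead. For small `s > 0` and `t` near `x`, a connected set, `G ∘ h` differs from a local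
primitive `φ ∘ h` by a constant; this constant turns out to be the same for all `x` and can be
subtracted. -/
theorem exists_deformedPrimitive (hD : LowerDeformation a b D h) {f : ℂ → ℂ}
    (hfD : DifferentiableOn ℂ f D) (hfI : ∀ t ∈ realIoo a b, AnalyticAt ℂ f t) {P : ℝ → ℂ}
    (hP : ∀ t ∈ realIoo a b, HasDerivAt P (f t) t) :
    ∃ G g, DeformedPrimitive a b D h f P G g := by
  obtain ⟨G, hG⟩ := exists_primitive hD.isOpen hD.isSimplyConnected hfD
  have local_data : ∀ x ∈ realIoo a b, ∃ η > 0, ∃ k : ℂ, ∃ φ : ℂ → ℂ,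
      (∀ t, |t - x| < η → t ∈ realIoo a b ∧ P t = φ t) ∧
      (∀ s t, 0 ≤ s → s < η → |t - x| < η → s ≤ 1 ∧ ContinuousAt φ (h (s, t))) ∧
      (∀ s t, 0 < s → s < η → |t - x| < η → G (h (s, t)) = φ (h (s, t)) + k) := by
    intro x hx
    obtain ⟨ρ, hρ, hball⟩ := Metric.eventually_nhds_iff_ball.1 (hfI x hx).eventually_analyticAt
    have hdiff : DifferentiableOn ℂ f (Metric.ball (x : ℂ) ρ) := fun z hz =>
      (hball z hz).differentiableAt.differentiableWithinAt
    obtain ⟨φ, hφx, hφ⟩ := hdiff.isExactOn_ball.with_val_at (x : ℂ) (P x)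
    have hcx : ContinuousWithinAt h (Icc 0 1 ×ˢ realIoo a b) (0, x) :=
      hD.continuousOn _ ⟨by simp, hx⟩
    have hev : ∀ᶠ p in 𝓝[Icc 0 1 ×ˢ realIoo a b] ((0 : ℝ), x), h p ∈ Metric.ball (x : ℂ) ρ := by
      refine hcx.eventually_mem ?_
      rw [hD.zero x hx]
      exact Metric.ball_mem_nhds _ hρ
    rw [eventually_nhdsWithin_iff] at hev
    obtain ⟨η₁, hη₁, hsub⟩ := Metric.eventually_nhds_iff_ball.1 hev
    obtain ⟨η₂, hη₂, hsub₂⟩ := Metric.isOpen_iff.1 (isOpen_realIoo a b) x hx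
    set η := min (min η₁ η₂) (min ρ 1) with hη
    have hηpos : 0 < η := by positivity
    have e1 : η ≤ η₁ := (min_le_left _ _).trans (min_le_left _ _)
    have e2 : η ≤ η₂ := (min_le_left _ _).trans (min_le_right _ _)
    have e3 : η ≤ ρ := (min_le_right _ _).trans (min_le_left _ _)
    have e4 : η ≤ 1 := (min_le_right _ _).trans (min_le_right _ _)
    have hI : ∀ t, |t - x| < η → t ∈ realIoo a b := fun t ht =>
      hsub₂ (by rw [Metric.mem_ball, Real.dist_eq]; exact ht.trans_le e2)
    have hB : ∀ s t, 0 ≤ s → s < η → |t - x| < η → h (s, t) ∈ Metric.ball (x : ℂ) ρ := by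
      intro s t hs hs' ht
      refine hsub (s, t) ?_ ⟨⟨hs, (hs'.trans_le e4).le⟩, hI t ht⟩
      rw [Metric.mem_ball, Prod.dist_eq, max_lt_iff, Real.dist_eq, Real.dist_eq, sub_zero,
        abs_of_nonneg hs]
      exact ⟨hs'.trans_le e1, ht.trans_le e1⟩
    have hDm : ∀ s t, 0 < s → s < η → |t - x| < η → h (s, t) ∈ D := fun s t hs hs' ht =>
      hD.mem s ⟨hs, (hs'.trans_le e4).le⟩ t (hI t ht)
    have hxη : |x - x| < η := by simpa using hηpos
    refine ⟨η, hηpos, G (h (η / 2, x)) - φ (h (η / 2, x)), φ, fun t ht => ⟨hI t ht, ?_⟩,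
      fun s t hs hs' ht => ⟨(hs'.trans_le e4).le, (hφ _ (hB s t hs hs' ht)).continuousAt⟩,
      fun s t hs hs' ht => ?_⟩
    · have hmem : ∀ t ∈ Metric.ball x η, (t : ℂ) ∈ Metric.ball (x : ℂ) ρ := fun t ht => by
        rw [Metric.mem_ball, dist_eq_norm] at *
        rw [← Complex.ofReal_sub, Complex.norm_real]
        exact ht.trans_le e3
      have key : ∀ y ∈ Metric.ball x η, HasDerivAt (fun t : ℝ => P t - φ t) 0 y := fun y hy => by
        have h1 := (hP y (hI y (by rwa [Metric.mem_ball, Real.dist_eq] at hy))).sub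
          (hφ y (hmem y hy)).comp_ofReal
        rwa [sub_self] at h1
      have := (convex_ball x η).is_const_of_fderivWithin_eq_zero (𝕜 := ℝ)
        (f := fun t : ℝ => P t - φ t)
        (fun y hy => (key y hy).differentiableAt.differentiableWithinAt)
        (fun y hy => by
          have h2 : HasFDerivAt (fun t : ℝ => P t - φ t) (0 : ℝ →L[ℝ] ℂ) y := by
            have := (key y hy).hasFDerivAt
            simpa using! this
          exact h2.hasFDerivWithinAt.fderivWithin (Metric.isOpen_ball.uniqueDiffWithinAt hy))
        (show t ∈ Metric.ball x η by rwa [Metric.mem_ball, Real.dist_eq]) (Metric.mem_ball_self hηpos)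
      simpa [hφx, sub_eq_zero] using this
    · have hpre : IsPreconnected (Ioo (0 : ℝ) η ×ˢ Metric.ball x η) :=
        isPreconnected_Ioo.prod (convex_ball x η).isPreconnected
      have hmemW : ∀ p ∈ Ioo (0 : ℝ) η ×ˢ Metric.ball x η, h p ∈ D ∩ Metric.ball (x : ℂ) ρ := by
        rintro ⟨s, t⟩ ⟨hs, ht⟩
        rw [Metric.mem_ball, Real.dist_eq] at ht
        exact ⟨hDm s t hs.1 hs.2 ht, hB s t hs.1.le hs.2 ht⟩
      have key := eq_of_isPreconnected_of_eventually_eq (f := fun p => G (h p) - φ (h p)) hpre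
        (fun p hp => by
          have hcp : ContinuousWithinAt h (Ioo (0 : ℝ) η ×ˢ Metric.ball x η) p :=
            (hD.continuousOn.mono (prod_mono (fun s hs => ⟨hs.1.le, (hs.2.trans_le e4).le⟩)
              (fun t ht => hI t (by rwa [Metric.mem_ball, Real.dist_eq] at ht)))) p hp
          exact hcp.eventually (eventually_sub_eq_of_hasDerivAt hD.isOpen Metric.isOpen_ball hG hφ
            (hmemW p hp)))
        (show (s, t) ∈ _ from ⟨⟨hs, hs'⟩, by rwa [Metric.mem_ball, Real.dist_eq]⟩)
        (show (η / 2, x) ∈ _ from ⟨⟨by positivity, by linarith⟩, Metric.mem_ball_self hηpos⟩)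
      rw [← key]; ring
  choose! η hη k φ hPφ hφc hGφ using local_data
  -- All local primitives restrict to `P` on the real axis, so letting `s → 0` on a vertical segment
  -- seen by two neighbouring discs compares their constants.
  have hk : ∀ x ∈ realIoo a b, ∀ y ∈ realIoo a b, k x = k y := by
    intro x hx y hy
    refine eq_of_isPreconnected_of_eventually_eq (convex_realIoo a b).isPreconnected
      (fun x hx => ?_) hx hy
    filter_upwards [mem_nhdsWithin_of_mem_nhds (Metric.ball_mem_nhds x (hη x hx)),
      self_mem_nhdsWithin] with y hy hyI
    rw [Metric.mem_ball, Real.dist_eq] at hy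
    have hyy : |y - y| < η y := by simpa using hη y hyI
    have lim : ∀ z ∈ realIoo a b, |y - z| < η z →
        Tendsto (fun s : ℝ => φ z (h (s, y)) + k z) (𝓝[>] 0) (𝓝 (P y + k z)) := by
      intro z hz hyz
      refine Tendsto.add_const _ ?_
      rw [(hPφ z hz y hyz).2, ← hD.zero y hyI]
      refine (hφc z hz 0 y le_rfl (hη z hz) hyz).2.tendsto.comp ?_
      have h1 : ContinuousWithinAt (fun s : ℝ => h (s, y)) (Icc 0 1) 0 :=
        ContinuousWithinAt.comp (g := h) (f := fun s : ℝ => (s, y))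
          (hD.continuousOn (0, y) ⟨by simp, hyI⟩) (by fun_prop) (fun s hs => ⟨hs, hyI⟩)
      exact h1.tendsto.mono_left (nhdsWithin_le_of_mem (Icc_mem_nhdsGT one_pos))
    have hl1 := lim x hx hy
    have hl2 := lim y hyI hyy
    have heq : (fun s : ℝ => φ y (h (s, y)) + k y) =ᶠ[𝓝[>] 0] fun s => φ x (h (s, y)) + k x := by
      filter_upwards [Ioo_mem_nhdsGT (lt_min (hη x hx) (hη y hyI))] with s hs
      rw [← hGφ x hx s y hs.1 (hs.2.trans_le (min_le_left _ _)) hy,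
        ← hGφ y hyI s y hs.1 (hs.2.trans_le (min_le_right _ _)) hyy]
    have := tendsto_nhds_unique hl2 (hl1.congr' heq.symm)
    simpa using this
  obtain ⟨t₀, ht₀⟩ := nonempty_realIoo hD.lt
  refine ⟨fun z => G z - k t₀, fun p => if p.1 = 0 then P p.2 else G (h p) - k t₀, ⟨hP,
    fun z hz => (hG z hz).sub_const _, ?_, by simp, fun s hs t _ => by simp [hs.1.ne']⟩⟩
  rintro ⟨s, t⟩ ⟨hs, ht⟩
  rcases hs.1.eq_or_lt with rfl | hs0
  · have hc : ContinuousWithinAt (fun p => φ t (h p)) (Icc 0 1 ×ˢ realIoo a b) (0, t) :=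
      ContinuousAt.comp_continuousWithinAt
        (hφc t ht 0 t le_rfl (hη t ht) (by simpa using hη t ht)).2
        (hD.continuousOn _ ⟨hs, ht⟩)
    refine hc.congr_of_eventuallyEq ?_ ?_
    · filter_upwards [self_mem_nhdsWithin, mem_nhdsWithin_of_mem_nhds
        (Metric.ball_mem_nhds ((0 : ℝ), t) (hη t ht))] with p hp hpb
      rw [Metric.mem_ball, Prod.dist_eq, max_lt_iff, Real.dist_eq, Real.dist_eq, sub_zero,
        abs_of_nonneg hp.1.1] at hpb
      rcases hp.1.1.eq_or_lt with h0 | h0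
      · rw [if_pos h0.symm, (hPφ t ht p.2 hpb.2).2, ← hD.zero p.2 hp.2]
        congr 2
        exact Prod.ext h0 rfl
      · have e := hGφ t ht p.1 p.2 h0 hpb.1 hpb.2
        rw [if_neg h0.ne', hk t₀ ht₀ t ht, show h p = h (p.1, p.2) from rfl, e]
        ring
    · simp [(hPφ t ht t (by simpa using hη t ht)).2, hD.zero t ht]
  · have hc : ContinuousWithinAt (fun p => G (h p) - k t₀) (Icc 0 1 ×ˢ realIoo a b) (s, t) :=
      (ContinuousAt.comp_continuousWithinAt (hG _ (hD.mem s ⟨hs0, hs.2⟩ t ht)).continuousAt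
        (hD.continuousOn _ ⟨hs, ht⟩)).sub continuousWithinAt_const
    refine hc.congr_of_eventuallyEq ?_ (by simp [hs0.ne'])
    have h1 : ∀ᶠ p : ℝ × ℝ in 𝓝[Icc 0 1 ×ˢ realIoo a b] (s, t), 0 < p.1 :=
      mem_nhdsWithin_of_mem_nhds (continuous_fst.continuousAt.eventually_mem (Ioi_mem_nhds hs0))
    filter_upwards [h1] with p hp
    simp [hp.ne']

end LowerDeformation

/-! ### The Cauchy kernel of a pair of points and its logarithmic primitive -/

/-- The difference of the Cauchy kernels of two points. -/
def kernelPair (w w' : ℂ) (z : ℂ) : ℂ := (z - w)⁻¹ - (z - w')⁻¹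

/-- The kernel is the logarithmic derivative of the Möbius map with zero `w` and pole `w'`, so its
primitives are branches of the logarithm of that map, up to constants. -/
theorem hasDerivAt_mobius {κ w w' z : ℂ} (hw : z ≠ w) (hw' : z ≠ w') :
    HasDerivAt (fun z => κ * (z - w) / (z - w'))
      (κ * (z - w) / (z - w') * kernelPair w w' z) z := by
  have h1 : z - w ≠ 0 := sub_ne_zero.2 hw
  have h2 : z - w' ≠ 0 := sub_ne_zero.2 hw'
  have h3 : HasDerivAt (fun z => κ * (z - w) / (z - w')) _ z :=
    (((hasDerivAt_id z).sub_const w).const_mul κ).div ((hasDerivAt_id z).sub_const w') h2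
  refine h3.congr_deriv ?_
  simp only [kernelPair, id]
  field_simp

theorem im_kernelPair_neg {w w' : ℂ} (hw : w.im < 0) (hw' : 0 < w'.im) (t : ℝ) :
    (kernelPair w w' t).im < 0 := by
  have h1 : (t : ℂ) - w ≠ 0 := fun h => by
    have := congrArg Complex.im h; simp at this; linarith
  have h2 : (t : ℂ) - w' ≠ 0 := fun h => by
    have := congrArg Complex.im h; simp at this; linarith
  rw [kernelPair, Complex.sub_im, Complex.inv_im, Complex.inv_im]
  have e1 : (0 : ℝ) < Complex.normSq (t - w) := Complex.normSq_pos.2 h1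
  have e2 : (0 : ℝ) < Complex.normSq (t - w') := Complex.normSq_pos.2 h2
  simp only [Complex.sub_im, Complex.ofReal_im, zero_sub, neg_neg]
  have : w.im / Complex.normSq (t - w) < 0 := div_neg_of_neg_of_pos hw e1
  have : 0 < w'.im / Complex.normSq (t - w') := by positivity
  linarith

theorem differentiableAt_kernelPair {w w' z : ℂ} (hw : z ≠ w) (hw' : z ≠ w') :
    DifferentiableAt ℂ (kernelPair w w') z := by
  have h1 : z - w ≠ 0 := sub_ne_zero.2 hw
  have h2 : z - w' ≠ 0 := sub_ne_zero.2 hw'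
  unfold kernelPair
  fun_prop (disch := assumption)

theorem analyticAt_kernelPair {w w' z : ℂ} (hw : z ≠ w) (hw' : z ≠ w') :
    AnalyticAt ℂ (kernelPair w w') z := by
  have h1 : z - w ≠ 0 := sub_ne_zero.2 hw
  have h2 : z - w' ≠ 0 := sub_ne_zero.2 hw'
  unfold kernelPair
  fun_prop (disch := assumption)

/-- The part `Im P` of a primitive of the kernel along the real axis is strictly decreasing. -/
theorem strictAntiOn_im_primitive_kernelPair {a b : EReal} {w w' : ℂ} (hw : w.im < 0)
    (hw' : 0 < w'.im) {P : ℝ → ℂ} (hP : ∀ t ∈ realIoo a b, HasDerivAt P (kernelPair w w' t) t) :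
    StrictAntiOn (fun t => (P t).im) (realIoo a b) := by
  have h1 : ∀ t ∈ realIoo a b, HasDerivAt (fun t => (P t).im) (kernelPair w w' t).im t :=
    fun t ht => by
      have := Complex.imCLM.hasFDerivAt.comp_hasDerivAt t (hP t ht)
      simpa using! this
  refine strictAntiOn_of_deriv_neg (convex_realIoo a b)
    (fun t ht => (h1 t ht).continuousAt.continuousWithinAt) (fun t ht => ?_)
  rw [(h1 t (interior_subset ht)).deriv]
  exact im_kernelPair_neg hw hw' t

namespace LowerDeformation

variable {a b : EReal} {D : Set ℂ} {h : ℝ × ℝ → ℂ}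

theorem im_nonpos (hD : LowerDeformation a b D h) {s t : ℝ} (hs : s ∈ Icc (0 : ℝ) 1)
    (ht : t ∈ realIoo a b) : (h (s, t)).im ≤ 0 := by
  rcases hs.1.eq_or_lt with rfl | h0
  · simp [hD.zero t ht]
  · exact (hD.im_neg _ (hD.mem s ⟨h0, hs.2⟩ t ht)).le

theorem ne_of_im_pos (hD : LowerDeformation a b D h) {w : ℂ} (hwi : 0 < w.im)
    {s t : ℝ} (hs : s ∈ Icc (0 : ℝ) 1) (ht : t ∈ realIoo a b) : h (s, t) ≠ w := by
  rintro rfl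
  exact absurd (hD.im_nonpos hs ht) (not_le.2 hwi)

theorem exists_deformedPrimitive_kernelPair (hD : LowerDeformation a b D h) {w w' : ℂ}
    (hw : w ∉ D) (hwi : w.im < 0) (hwi' : 0 < w'.im) :
    ∃ P G g, DeformedPrimitive a b D h (kernelPair w w') P G g := by
  have hI : ∀ t ∈ realIoo a b, AnalyticAt ℂ (kernelPair w w') t := fun t _ =>
    analyticAt_kernelPair (fun e => by simp [← e] at hwi) (fun e => by simp [← e] at hwi')
  obtain ⟨P, hP⟩ := exists_primitive_real hD.lt (f := kernelPair w w')
    fun t ht => (hI t ht).continuousAt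
  obtain ⟨G, g, hG⟩ := hD.exists_deformedPrimitive (f := kernelPair w w') (fun z hz =>
    (differentiableAt_kernelPair (fun e => by rw [e] at hz; exact hw hz)
      (fun e => by
        have := hD.im_neg z hz
        rw [e] at this; linarith)).differentiableWithinAt) hI hP
  exact ⟨P, G, g, hG⟩

/-- The deformed primitive of the kernel is, up to a constant, a logarithm of the Möbius map. -/
theorem exists_exp_eq_mobius (hD : LowerDeformation a b D h) {w w' κ : ℂ} (hκ : κ ≠ 0)
    (hw : w ∉ D) (hwi' : 0 < w'.im) {P : ℝ → ℂ} {G : ℂ → ℂ} {g : ℝ × ℝ → ℂ}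
    (hG : DeformedPrimitive a b D h (kernelPair w w') P G g) :
    ∃ c₀ : ℂ, ∀ s ∈ Icc (0 : ℝ) 1, ∀ t ∈ realIoo a b,
      Complex.exp (g (s, t) + c₀) = κ * (h (s, t) - w) / (h (s, t) - w') := by
  set m : ℂ → ℂ := fun z => κ * (z - w) / (z - w') with hm
  have hne : ∀ z ∈ D, z ≠ w ∧ z ≠ w' := fun z hz => ⟨fun e => hw (e ▸ hz), fun e => by
    have := hD.im_neg z hz
    rw [e] at this; linarith⟩
  -- `exp (-G) * m` has derivative zero and is a nonzero constant on the connected set `D`; `c₀` is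
  -- a logarithm of it. The case `s = 0` follows by continuity.
  have hder : ∀ z ∈ D, HasDerivAt (fun z => Complex.exp (-G z) * m z) 0 z := fun z hz => by
    have h1 := ((hG.hasDerivAt z hz).neg.cexp).mul
      (hasDerivAt_mobius (κ := κ) (hne z hz).1 (hne z hz).2)
    refine h1.congr_deriv ?_
    ring
  obtain ⟨z₀, hz₀⟩ := hD.isSimplyConnected.nonempty
  have hconst : ∀ z ∈ D, Complex.exp (-G z) * m z = Complex.exp (-G z₀) * m z₀ := fun z hz =>
    hD.isOpen.is_const_of_deriv_eq_zero hD.isSimplyConnected.isPathConnected.isConnected.isPreconnected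
      (fun z hz => (hder z hz).differentiableAt.differentiableWithinAt)
      (fun z hz => (hder z hz).deriv) hz hz₀
  have hC : Complex.exp (-G z₀) * m z₀ ≠ 0 :=
    mul_ne_zero (Complex.exp_ne_zero _) (div_ne_zero (mul_ne_zero hκ (sub_ne_zero.2 (hne z₀ hz₀).1))
      (sub_ne_zero.2 (hne z₀ hz₀).2))
  refine ⟨Complex.log (Complex.exp (-G z₀) * m z₀), ?_⟩
  have hpos : ∀ s ∈ Ioc (0 : ℝ) 1, ∀ t ∈ realIoo a b,
      Complex.exp (g (s, t) + Complex.log (Complex.exp (-G z₀) * m z₀)) = m (h (s, t)) := by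
    intro s hs t ht
    rw [Complex.exp_add, Complex.exp_log hC, hG.pos s hs t ht, ← hconst _ (hD.mem s hs t ht),
      ← mul_assoc, ← Complex.exp_add, add_neg_cancel, Complex.exp_zero, one_mul]
  intro s hs t ht
  rcases hs.1.eq_or_lt with rfl | h0
  · have hcl : ∀ {E : Type} [TopologicalSpace E] (u : ℝ × ℝ → E),
        ContinuousOn u (Icc 0 1 ×ˢ realIoo a b) →
        Tendsto (fun s : ℝ => u (s, t)) (𝓝[>] 0) (𝓝 (u (0, t))) := by
      intro E _ u hu
      have h1 : ContinuousWithinAt (fun s : ℝ => u (s, t)) (Icc 0 1) 0 :=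
        ContinuousWithinAt.comp (g := u) (f := fun s : ℝ => (s, t))
          (hu (0, t) ⟨by simp, ht⟩) (by fun_prop) (fun s hs => ⟨hs, ht⟩)
      exact h1.tendsto.mono_left (nhdsWithin_le_of_mem (Icc_mem_nhdsGT one_pos))
    have l1 := hcl (fun p => Complex.exp (g p + Complex.log (Complex.exp (-G z₀) * m z₀)))
      (Complex.continuous_exp.comp_continuousOn (hG.continuousOn.add continuousOn_const))
    have l2 := hcl (fun p => m (h p)) (by
      refine ContinuousOn.div (continuousOn_const.mul
        (hD.continuousOn.sub continuousOn_const)) ?_ ?_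
      · exact hD.continuousOn.sub continuousOn_const
      · rintro ⟨s, t⟩ ⟨hs, ht⟩
        exact sub_ne_zero.2 (hD.ne_of_im_pos hwi' hs ht))
    refine tendsto_nhds_unique l1 (l2.congr' ?_)
    filter_upwards [Ioc_mem_nhdsGT one_pos] with s hs
    exact (hpos s hs t ht).symm
  · exact hpos s ⟨h0, hs.2⟩ t ht

/-- If the Möbius image of the path `s ↦ h (s, t)` avoids the cut of the logarithm, the increments
of the primitive and of the principal logarithm along it agree. -/
theorem sub_log_eq (hD : LowerDeformation a b D h) {w w' κ : ℂ}
    (hwi' : 0 < w'.im) {P : ℝ → ℂ} {G : ℂ → ℂ} {g : ℝ × ℝ → ℂ}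
    (hG : DeformedPrimitive a b D h (kernelPair w w') P G g) {c₀ : ℂ}
    (hc₀ : ∀ s ∈ Icc (0 : ℝ) 1, ∀ t ∈ realIoo a b,
      Complex.exp (g (s, t) + c₀) = κ * (h (s, t) - w) / (h (s, t) - w'))
    {S : Set (ℝ × ℝ)} (hS : IsPreconnected S) (hSI : S ⊆ Icc 0 1 ×ˢ realIoo a b)
    (hslit : ∀ p ∈ S, κ * (h p - w) / (h p - w') ∈ Complex.slitPlane) {p p' : ℝ × ℝ}
    (hp : p ∈ S) (hp' : p' ∈ S) :
    g p - Complex.log (κ * (h p - w) / (h p - w')) =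
      g p' - Complex.log (κ * (h p' - w) / (h p' - w')) := by
  refine eq_of_isPreconnected_of_exp_eq (C := Complex.exp (-c₀))
    (k := fun p => g p - Complex.log (κ * (h p - w) / (h p - w'))) hS ?_ ?_ hp hp'
  · refine (hG.continuousOn.mono hSI).sub (ContinuousOn.clog ?_ hslit)
    refine ContinuousOn.div (continuousOn_const.mul
      ((hD.continuousOn.mono hSI).sub continuousOn_const))
      ((hD.continuousOn.mono hSI).sub continuousOn_const) ?_
    rintro p hp
    exact sub_ne_zero.2 (hD.ne_of_im_pos hwi' (hSI hp).1 (hSI hp).2)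
  · rintro ⟨s, t⟩ hp
    have h1 := hc₀ s (hSI hp).1 t (hSI hp).2
    rw [Complex.exp_sub, Complex.exp_log (Complex.slitPlane_ne_zero (hslit _ hp)), ← h1,
      Complex.exp_add, Complex.exp_neg]
    field_simp [Complex.exp_ne_zero]

end LowerDeformation

/-! ### The Möbius map of a circular arc -/

section Arc

/-- The unimodular factor that rotates the Möbius image of a circular arc onto the negative axis:
if `w = p + ρ (α + i β)` with `α ^ 2 + β ^ 2 = 1` and `β < 0`, the arc from `w` through
`p + σ ρ` to `p + i ρ` is mapped to the negative real axis. -/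
theorem exists_rotation {p ρ σ : ℝ} (hσ : σ = 1 ∨ σ = -1) (hρ : 0 < ρ) {w : ℂ}
    (hw : ‖w - p‖ = ρ) (hwi : w.im < 0) :
    ∃ x s : ℝ, 0 < s ∧ -s < x ∧ x < s ∧ x ^ 2 + s ^ 2 = 1 ∧ w.re - p = ρ * (2 * σ * x * s) ∧
      w.im = ρ * (x ^ 2 - s ^ 2) := by
  have h1 : (w.re - p) ^ 2 + w.im ^ 2 = ρ ^ 2 := by
    rw [← hw, Complex.sq_norm, Complex.normSq_apply]; simp; ring
  have hσ : σ ^ 2 = 1 := by rcases hσ with rfl | rfl <;> norm_num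
  set β := w.im / ρ with hβ
  have hβ' : w.im = ρ * β := by rw [hβ]; field_simp
  set α := (w.re - p) / ρ with hα
  have hα' : w.re - p = ρ * α := by rw [hα]; field_simp
  rw [hα', hβ'] at h1
  have h2 : α ^ 2 + β ^ 2 = 1 := by
    have h0 : ρ ^ 2 * (α ^ 2 + β ^ 2 - 1) = 0 := by linarith
    rcases mul_eq_zero.1 h0 with h | h
    · exact absurd h (by positivity)
    · linarith
  have hβ0 : β < 0 := by rw [hβ]; exact div_neg_of_neg_of_pos hwi hρ
  have hs2 : 0 < (1 - β) / 2 := by linarith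
  -- Half-angle formulas: `x` and `s` are chosen such that `x ^ 2 - s ^ 2 = β` and `2 σ x s = α`.
  set s := √((1 - β) / 2) with hs
  have hspos : 0 < s := Real.sqrt_pos.2 hs2
  have hss : s ^ 2 = (1 - β) / 2 := Real.sq_sqrt hs2.le
  set x := σ * α / (2 * s) with hx
  have hxs : 2 * x * s = σ * α := by rw [hx]; field_simp
  have hx2 : x ^ 2 = (1 + β) / 2 := by
    have h3 : (2 * x * s) ^ 2 = α ^ 2 := by rw [hxs, mul_pow, hσ, one_mul]
    have h4 : (1 - β) * (2 * x ^ 2) = (1 - β) * (1 + β) := by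
      calc (1 - β) * (2 * x ^ 2) = (2 * x * s) ^ 2 := by rw [mul_pow, mul_pow, hss]; ring
        _ = (1 - β) * (1 + β) := by rw [h3]; linarith
    have h5 := mul_left_cancel₀ (by linarith : (1 - β) ≠ 0) h4
    linarith
  have hlt : x ^ 2 < s ^ 2 := by rw [hx2, hss]; linarith
  refine ⟨x, s, hspos, ?_, ?_, by rw [hx2, hss]; ring, ?_, ?_⟩
  · exact (abs_lt_of_sq_lt_sq' hlt hspos.le).1
  · exact (abs_lt_of_sq_lt_sq' hlt hspos.le).2
  · rw [hα', show 2 * σ * x * s = σ * (2 * x * s) by ring, hxs, ← mul_assoc σ, ← sq, hσ, one_mul]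
  · rw [hβ', hx2, hss]; ring

variable {p ρ σ x s : ℝ} {w z : ℂ}

/-- Points with nonpositive real Möbius image. -/
theorem of_mobius_notMem_slitPlane (hσ : σ = 1 ∨ σ = -1)
    (hxs : x ^ 2 + s ^ 2 = 1) (hre : w.re - p = ρ * (2 * σ * x * s))
    (him : w.im = ρ * (x ^ 2 - s ^ 2)) (hz : z ≠ p + ρ * Complex.I)
    (hm : (⟨x, σ * s⟩ : ℂ) * (z - w) / (z - (p + ρ * Complex.I)) ∉ Complex.slitPlane) :
    ∃ y, x ≤ y ∧ (z.re - p) * (y ^ 2 + s ^ 2) = ρ * (2 * σ * y * s) ∧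
      z.im * (y ^ 2 + s ^ 2) = ρ * (y ^ 2 - s ^ 2) := by
  rw [Complex.mem_slitPlane_iff, not_or, not_lt, not_not] at hm
  set v := (⟨x, σ * s⟩ : ℂ) * (z - w) / (z - (p + ρ * Complex.I)) with hv
  have hvr : v = ((v.re : ℝ) : ℂ) := Complex.ext rfl (by simp [hm.2])
  have h0 : z - (p + ρ * Complex.I) ≠ 0 := sub_ne_zero.2 hz
  have h1 : (⟨x, σ * s⟩ : ℂ) * (z - w) = (v.re : ℂ) * (z - (p + ρ * Complex.I)) := by
    rw [← hvr, hv]; field_simp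
  have e1 := congrArg Complex.re h1
  have e2 := congrArg Complex.im h1
  simp at e1 e2
  have hwr : w.re = p + ρ * (2 * σ * x * s) := by linarith
  rw [hwr, him] at e1 e2
  set r := -v.re with hr
  have hv' : v.re = -r := by rw [hr]; ring
  rw [hv'] at e1 e2
  -- The point with Möbius image `-r` has parameter `y = x + r` in the rational parametrization of
  -- the circle: `y = x` is `w`, `y = s` is `p + σ ρ`, and `y → ∞` is the pole `p + i ρ`.
  refine ⟨x + r, by linarith [hm.1], ?_, ?_⟩
  · rcases hσ with rfl | rfl
    · linear_combination (x + r) * e1 + s * e2 + ρ * s * (2 * x + r) * hxs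
    · linear_combination (x + r) * e1 - s * e2 - ρ * s * (2 * x + r) * hxs
  · rcases hσ with rfl | rfl
    · linear_combination (x + r) * e2 - s * e1 + ρ * (x * (x + r) - s ^ 2) * hxs
    · linear_combination (x + r) * e2 + s * e1 + ρ * (x * (x + r) - s ^ 2) * hxs

end Arc

section Arc

variable {p ρ σ x s : ℝ} {w z : ℂ}

/-- The cut pulls back to points of the circle with parameter `y ≥ x`. In the lower half-plane `|y|
< s`, and there the horizontal coordinate, proportional to `2 y s / (y ^ 2 + s ^ 2)`, increases with
`y`; so such a point would violate `hmiss`. -/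
theorem mobius_mem_slitPlane_of_im_neg (hσ : σ = 1 ∨ σ = -1) (hρ : 0 < ρ) (hs : 0 < s)
    (hx : -s < x) (hx' : x < s)
    (hxs : x ^ 2 + s ^ 2 = 1) (hre : w.re - p = ρ * (2 * σ * x * s))
    (him : w.im = ρ * (x ^ 2 - s ^ 2)) (hz : z.im < 0)
    (hmiss : ‖z - p‖ = ρ → σ * (z.re - p) < σ * (w.re - p)) :
    (⟨x, σ * s⟩ : ℂ) * (z - w) / (z - (p + ρ * Complex.I)) ∈ Complex.slitPlane := by
  by_contra hm
  have hzne : z ≠ p + ρ * Complex.I := by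
    rintro rfl
    simp at hz
    linarith
  obtain ⟨y, hxy, h1, h2⟩ := of_mobius_notMem_slitPlane hσ hxs hre him hzne hm
  have hN : 0 < y ^ 2 + s ^ 2 := by positivity
  have hys : y ^ 2 < s ^ 2 := by
    have : ρ * (y ^ 2 - s ^ 2) < 0 := by rw [← h2]; exact mul_neg_of_neg_of_pos hz hN
    nlinarith
  have hσ2 : σ ^ 2 = 1 := by rcases hσ with rfl | rfl <;> norm_num
  have hnorm : ‖z - p‖ = ρ := by
    have e : ‖z - p‖ ^ 2 = ρ ^ 2 := by
      have e0 : ‖z - p‖ ^ 2 = (z.re - p) ^ 2 + z.im ^ 2 := by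
        rw [Complex.sq_norm, Complex.normSq_apply]; simp; ring
      have e1 : (y ^ 2 + s ^ 2) ^ 2 * ((z.re - p) ^ 2 + z.im ^ 2 - ρ ^ 2) = 0 := by
        have : (y ^ 2 + s ^ 2) ^ 2 * ((z.re - p) ^ 2 + z.im ^ 2 - ρ ^ 2) =
          ((z.re - p) * (y ^ 2 + s ^ 2)) ^ 2 + (z.im * (y ^ 2 + s ^ 2)) ^ 2 -
            ρ ^ 2 * (y ^ 2 + s ^ 2) ^ 2 := by ring
        rw [this, h1, h2]
        linear_combination (ρ ^ 2 * 4 * y ^ 2 * s ^ 2) * hσ2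
      rcases mul_eq_zero.1 e1 with h | h
      · exact absurd h (by positivity)
      · rw [e0]; linarith
    exact (pow_left_inj₀ (norm_nonneg _) hρ.le two_ne_zero).1 e
  have hlt := hmiss hnorm
  have e2 : σ * (w.re - p) = 2 * ρ * x * s := by
    rw [hre]; linear_combination (2 * ρ * x * s) * hσ2
  have e3 : σ * (z.re - p) * (y ^ 2 + s ^ 2) = 2 * ρ * y * s := by
    rw [mul_assoc, h1]; linear_combination (2 * ρ * y * s) * hσ2
  have e4 : 2 * ρ * y * s < 2 * ρ * x * s * (y ^ 2 + s ^ 2) := by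
    rw [← e3, ← e2]; exact mul_lt_mul_of_pos_right hlt hN
  have hy1 := abs_lt_of_sq_lt_sq' hys hs.le
  have e5 : 0 ≤ (y - x) * (s ^ 2 - x * y) := by
    refine mul_nonneg (by linarith) ?_
    nlinarith [mul_pos (by linarith : 0 < s - x) (by linarith [hy1.1] : 0 < s + y),
      mul_pos (by linarith : 0 < s + x) (by linarith [hy1.2] : 0 < s - y)]
  have e6 : y - x * (y ^ 2 + s ^ 2) = (y - x) * (s ^ 2 - x * y) := by
    linear_combination (-y) * hxs
  have e7 : 0 ≤ 2 * ρ * s * (y - x * (y ^ 2 + s ^ 2)) := by rw [e6]; positivity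
  linarith

/-- Real points of the circle have parameter `s` or `-s`. The latter is below `x`, so the cut meets
the real axis only at `p + σ ρ`. -/
theorem mobius_mem_slitPlane_of_real (hσ : σ = 1 ∨ σ = -1) (hρ : 0 < ρ) (hs : 0 < s)
    (hx : -s < x)
    (hxs : x ^ 2 + s ^ 2 = 1) (hre : w.re - p = ρ * (2 * σ * x * s))
    (him : w.im = ρ * (x ^ 2 - s ^ 2)) {t : ℝ} (ht : t ≠ p + σ * ρ) :
    (⟨x, σ * s⟩ : ℂ) * (t - w) / (t - (p + ρ * Complex.I)) ∈ Complex.slitPlane := by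
  by_contra hm
  have hzne : (t : ℂ) ≠ p + ρ * Complex.I := fun e => by
    have := congrArg Complex.im e
    simp at this
    linarith
  obtain ⟨y, hxy, h1, h2⟩ := of_mobius_notMem_slitPlane hσ hxs hre him hzne hm
  simp only [Complex.ofReal_im, zero_mul, Complex.ofReal_re] at h1 h2
  have hys : y ^ 2 = s ^ 2 := by
    rcases mul_eq_zero.1 h2.symm with h | h
    · exact absurd h hρ.ne'
    · linarith
  have hy : y = s := by
    rcases sq_eq_sq_iff_eq_or_eq_neg.1 hys with h | h
    · exact h
    · linarith
  rw [hy] at h1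
  apply ht
  have e : (2 * s ^ 2) * (t - p - σ * ρ) = 0 := by linear_combination h1
  rcases mul_eq_zero.1 e with h | h
  · exact absurd h (by positivity)
  · linarith

/-- The value at `p + σ ρ` is computed to be `-(s - x) < 0`. -/
theorem mobius_notMem_slitPlane (hσ : σ = 1 ∨ σ = -1) (hρ : 0 < ρ)
    (hx' : x < s)
    (hxs : x ^ 2 + s ^ 2 = 1) (hre : w.re - p = ρ * (2 * σ * x * s))
    (him : w.im = ρ * (x ^ 2 - s ^ 2)) :
    (⟨x, σ * s⟩ : ℂ) * ((p + σ * ρ : ℝ) - w) / ((p + σ * ρ : ℝ) - (p + ρ * Complex.I)) ∉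
      Complex.slitPlane := by
  have hne : ((p + σ * ρ : ℝ) : ℂ) - (p + ρ * Complex.I) ≠ 0 := fun e => by
    have := congrArg Complex.im e
    simp at this
    linarith
  have hwr : w.re = p + ρ * (2 * σ * x * s) := by linarith
  have e : (⟨x, σ * s⟩ : ℂ) * ((p + σ * ρ : ℝ) - w) / ((p + σ * ρ : ℝ) - (p + ρ * Complex.I)) =
      ((-(s - x) : ℝ) : ℂ) := by
    rw [div_eq_iff hne]
    apply Complex.ext
    · simp [hwr, him]
      rcases hσ with rfl | rfl
      · linear_combination (-ρ * s) * hxs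
      · linear_combination (ρ * s) * hxs
    · simp [hwr, him]
      rcases hσ with rfl | rfl
      · linear_combination (-ρ * x) * hxs
      · linear_combination (-ρ * x) * hxs
  rw [e, Complex.ofReal_mem_slitPlane]
  linarith

end Arc

theorem endPoint_coe (e : ℝ) : Setting.endPoint (e : EReal) = 𝓝 (e : ℂ) := by
  simp [Setting.endPoint]

theorem endPoint_top : Setting.endPoint ⊤ = Bornology.cobounded ℂ := by simp [Setting.endPoint]

theorem endPoint_bot : Setting.endPoint ⊥ = Bornology.cobounded ℂ := by simp [Setting.endPoint]

theorem tendsto_mobius_cobounded (κ w w' : ℂ) :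
    Tendsto (fun z => κ * (z - w) / (z - w')) (Bornology.cobounded ℂ) (𝓝 κ) := by
  have h1 : Tendsto (fun z : ℂ => z - w') (Bornology.cobounded ℂ) (Bornology.cobounded ℂ) := by
    simp [sub_eq_add_neg]
  have h2 := (tendsto_inv₀_cobounded.comp h1).const_mul (κ * (w' - w))
  have h3 := h2.const_add κ
  rw [mul_zero, add_zero] at h3
  refine h3.congr' ?_
  have h4 : ∀ᶠ z : ℂ in Bornology.cobounded ℂ, z ≠ w' := by
    exact Bornology.isBounded_def.1 (Bornology.isBounded_singleton (x := w'))
  filter_upwards [h4] with z hz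
  have : z - w' ≠ 0 := sub_ne_zero.2 hz
  simp only [Function.comp]
  field_simp
  ring

/-- Near an end point of the interval the Möbius map avoids the cut of the logarithm. -/
theorem eventually_endPoint_mobius_mem {e : EReal} {m : ℂ → ℂ} {κ w w' : ℂ}
    (hm : m = fun z => κ * (z - w) / (z - w')) (hκ : κ ∈ Complex.slitPlane)
    (hwi' : 0 < w'.im) (hreal : ∀ t : ℝ, (t : EReal) = e → m t ∈ Complex.slitPlane) :
    ∀ᶠ z in Setting.endPoint e, m z ∈ Complex.slitPlane := by
  induction e with
  | bot =>
    rw [endPoint_bot, hm]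
    exact (tendsto_mobius_cobounded κ w w').eventually_mem (Complex.isOpen_slitPlane.mem_nhds hκ)
  | top =>
    rw [endPoint_top, hm]
    exact (tendsto_mobius_cobounded κ w w').eventually_mem (Complex.isOpen_slitPlane.mem_nhds hκ)
  | coe t =>
    rw [endPoint_coe]
    have hne : (t : ℂ) - w' ≠ 0 := fun e => by
      have := congrArg Complex.im e
      simp at this
      linarith
    have hc : ContinuousAt m t := by
      rw [hm]
      exact ContinuousAt.div (by fun_prop) (by fun_prop) hne
    exact hc.eventually_mem (Complex.isOpen_slitPlane.mem_nhds (hreal t rfl))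

namespace LowerDeformation

variable {a b : EReal} {D : Set ℂ} {h : ℝ × ℝ → ℂ}

theorem eventually_left (hD : LowerDeformation a b D h) {q : ℂ → Prop}
    (hq : ∀ᶠ z in Setting.endPoint a, q z) :
    ∀ᶠ t in leftFilter a, ∀ s ∈ Icc (0 : ℝ) 1, q (h (s, t)) := by
  obtain ⟨u, hu, v, hv, huv⟩ := Filter.mem_prod_iff.1 (hD.left.eventually hq)
  filter_upwards [hv] with t ht s hs
  exact huv (⟨mem_principal.1 hu hs, ht⟩ : (s, t) ∈ u ×ˢ v)

theorem eventually_right (hD : LowerDeformation a b D h) {q : ℂ → Prop}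
    (hq : ∀ᶠ z in Setting.endPoint b, q z) :
    ∀ᶠ t in rightFilter b, ∀ s ∈ Icc (0 : ℝ) 1, q (h (s, t)) := by
  obtain ⟨u, hu, v, hv, huv⟩ := Filter.mem_prod_iff.1 (hD.right.eventually hq)
  filter_upwards [hv] with t ht s hs
  exact huv (⟨mem_principal.1 hu hs, ht⟩ : (s, t) ∈ u ×ˢ v)

/-- A circular arc in the lower half-plane that starts at a point of the interval stays in the
domain as long as it does not meet the deformed curve. -/
theorem mem_of_arc_disjoint (hD : LowerDeformation a b D h) {p ρ σ : ℝ} (hσ : σ = 1 ∨ σ = -1)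
    (hρ : 0 < ρ) (hq : p + σ * ρ ∈ realIoo a b) {w : ℂ} (hw : ‖w - p‖ = ρ) (hwi : w.im < 0)
    (hmiss : ∀ t ∈ realIoo a b, ‖h (1, t) - p‖ = ρ →
      σ * ((h (1, t)).re - p) < σ * (w.re - p)) : w ∈ D := by
  by_contra hwD
  obtain ⟨x, s, hs, hx, hx', hxs, hre, him⟩ := exists_rotation hσ hρ hw hwi
  set q := p + σ * ρ with hqdef
  -- The principal logarithm of the Möbius map with zero `w` and pole `w'` is cut along the arc from
  -- `w` through `q` to `w'`. The deformed curve misses this arc, and the interval meets it only at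
  -- `q`.
  set w' : ℂ := p + ρ * Complex.I with hw'
  have hwi' : 0 < w'.im := by simp [hw', hρ]
  set κ : ℂ := ⟨x, σ * s⟩ with hκ
  have hσ0 : σ ≠ 0 := by rcases hσ with rfl | rfl <;> norm_num
  have hκs : κ ∈ Complex.slitPlane := by
    rw [Complex.mem_slitPlane_iff]
    exact Or.inr (mul_ne_zero hσ0 hs.ne')
  have hκ0 : κ ≠ 0 := Complex.slitPlane_ne_zero hκs
  obtain ⟨P, G, g, hG⟩ := hD.exists_deformedPrimitive_kernelPair hwD hwi hwi'
  obtain ⟨c₀, hc₀⟩ := hD.exists_exp_eq_mobius hκ0 hwD hwi' hG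
  set m : ℂ → ℂ := fun z => κ * (z - w) / (z - w') with hm
  have hreal : ∀ t : ℝ, t ≠ q → m t ∈ Complex.slitPlane := fun t ht =>
    mobius_mem_slitPlane_of_real hσ hρ hs hx hxs hre him ht
  have hcurve : ∀ t ∈ realIoo a b, m (h (1, t)) ∈ Complex.slitPlane := fun t ht =>
    mobius_mem_slitPlane_of_im_neg hσ hρ hs hx hx' hxs hre him
      (hD.im_neg _ (hD.mem 1 (by simp) t ht)) (hmiss t ht)
  obtain ⟨u, hu, hu'⟩ := (eventually_leftFilter hD.lt).1 (hD.eventually_left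
    (eventually_endPoint_mobius_mem hm hκs hwi' (fun t ht => hreal t (fun e => by
      rw [e] at ht; exact absurd hq.1 (by rw [ht]; exact lt_irrefl _)))))
  obtain ⟨v, hv, hv'⟩ := (eventually_rightFilter hD.lt).1 (hD.eventually_right
    (eventually_endPoint_mobius_mem hm hκs hwi' (fun t ht => hreal t (fun e => by
      rw [e] at ht; exact absurd hq.2 (by rw [ht]; exact lt_irrefl _)))))
  obtain ⟨u', hu1, hu2⟩ := EReal.lt_iff_exists_real_btwn.1 hq.1
  obtain ⟨v', hv1, hv2⟩ := EReal.lt_iff_exists_real_btwn.1 hq.2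
  have hu2' : u' < q := EReal.coe_lt_coe_iff.1 hu2
  have hv1' : q < v' := EReal.coe_lt_coe_iff.1 hv1
  have hu'I : u' ∈ realIoo a b := ⟨hu1, hu2.trans hq.2⟩
  have hv'I : v' ∈ realIoo a b := ⟨hq.1.trans hv1, hv2⟩
  have htL : min u u' ∈ realIoo a b := by
    rcases min_choice u u' with e | e <;> rw [e] <;> assumption
  have htR : max v v' ∈ realIoo a b := by
    rcases max_choice v v' with e | e <;> rw [e] <;> assumption
  have htLq : min u u' < q := (min_le_right _ _).trans_lt hu2'
  have htRq : q < max v v' := hv1'.trans_le (le_max_right _ _)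
  -- The boundary of the parameter rectangle is followed from the base left of `q`, up a vertical
  -- segment close to one end, along the curve, down near the other end, to the base right of `q`.
  -- The cut is never met, so `P - log m` has the same value `k` on both sides of `q`.
  have hvert : ∀ t ∈ realIoo a b, (∀ s ∈ Icc (0 : ℝ) 1, m (h (s, t)) ∈ Complex.slitPlane) →
      g (0, t) - Complex.log (m (h (0, t))) = g (1, t) - Complex.log (m (h (1, t))) :=
    fun t ht hts => hD.sub_log_eq hwi' hG hc₀ (S := Icc 0 1 ×ˢ {t})
      (isPreconnected_Icc.prod isPreconnected_singleton)
      (prod_mono subset_rfl (singleton_subset_iff.2 ht))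
      (by rintro ⟨s', t'⟩ ⟨hs', rfl⟩; exact hts s' hs')
      ⟨by simp, rfl⟩ ⟨by simp, rfl⟩
  have htop : ∀ t ∈ realIoo a b, ∀ t' ∈ realIoo a b,
      g (1, t) - Complex.log (m (h (1, t))) = g (1, t') - Complex.log (m (h (1, t'))) :=
    fun t ht t' ht' => hD.sub_log_eq hwi' hG hc₀ (S := {1} ×ˢ realIoo a b)
      (isPreconnected_singleton.prod (convex_realIoo a b).isPreconnected)
      (prod_mono (by simp) subset_rfl)
      (by rintro ⟨s', t'⟩ ⟨rfl, h'⟩; exact hcurve t' h') ⟨rfl, ht⟩ ⟨rfl, ht'⟩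
  set k := g (1, q) - Complex.log (m (h (1, q))) with hk
  have hbot : ∀ t ∈ realIoo a b, t ≠ q → P t - Complex.log (m t) = k := by
    have hbase : ∀ J : Set ℝ, Convex ℝ J → J ⊆ realIoo a b → q ∉ J → ∀ t ∈ J, ∀ t' ∈ J,
        g (0, t) - Complex.log (m (h (0, t))) = g (0, t') - Complex.log (m (h (0, t'))) :=
      fun J hJ hJI hqJ t ht t' ht' => hD.sub_log_eq hwi' hG hc₀ (S := {0} ×ˢ J)
        (isPreconnected_singleton.prod hJ.isPreconnected)
        (prod_mono (by simp) hJI)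
        (by
          rintro ⟨s', t'⟩ ⟨rfl, h'⟩
          rw [hD.zero t' (hJI h')]
          exact hreal t' (fun e => hqJ (e ▸ h'))) ⟨rfl, ht⟩ ⟨rfl, ht'⟩
    intro t ht htq
    rw [← hG.zero t ht, show (t : ℂ) = h (0, t) from (hD.zero t ht).symm]
    rcases lt_or_gt_of_ne htq with hlt | hgt
    · rw [hbase (realIoo a b ∩ Iio q) ((convex_realIoo a b).inter (convex_Iio q))
        inter_subset_left (by simp) t ⟨ht, hlt⟩ _ ⟨htL, htLq⟩,
        hvert _ htL (hu' _ htL (min_le_left _ _))]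
      exact htop _ htL _ hq
    · rw [hbase (realIoo a b ∩ Ioi q) ((convex_realIoo a b).inter (convex_Ioi q))
        inter_subset_left (by simp) t ⟨ht, hgt⟩ _ ⟨htR, htRq⟩,
        hvert _ htR (hv' _ htR (le_max_left _ _))]
      exact htop _ htR _ hq
  have him' : ∀ t ∈ realIoo a b, t ≠ q → (P t).im - k.im < Real.pi ∧ -Real.pi < (P t).im - k.im := by
    intro t ht htq
    have h1 : (P t).im - k.im = (m t).arg := by
      rw [← hbot t ht htq]; simp [Complex.log_im]
    rw [h1]
    exact ⟨(Complex.arg_le_pi _).lt_of_ne (Complex.mem_slitPlane_iff_arg.1 (hreal t htq)).1,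
      Complex.neg_pi_lt_arg _⟩
  -- As `Im P` is strictly decreasing, the bounds `±π` valid beside `q` hold strictly at `q` too.
  -- Thus `P q - k` is the principal logarithm of `m q` with argument below `π`, although `m q` lies
  -- on the cut.
  have hanti := strictAntiOn_im_primitive_kernelPair hwi hwi' hG.hasDerivAt_real
  have hq1 : (P q).im - k.im < Real.pi := by
    have := hanti hu'I hq hu2'
    linarith [(him' u' hu'I hu2'.ne).1]
  have hq2 : -Real.pi < (P q).im - k.im := by
    have := hanti hq hv'I hv1'
    linarith [(him' v' hv'I hv1'.ne').2]
  have hexpk : Complex.exp (P q - k) = m q := by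
    have e1 : Complex.exp (g (1, q)) = Complex.exp (-c₀) * m (h (1, q)) := by
      rw [show m (h (1, q)) = Complex.exp (g (1, q) + c₀) from (hc₀ 1 (by simp) q hq).symm,
        ← Complex.exp_add]
      congr 1; ring
    have e2 := hc₀ 0 (by simp) q hq
    rw [hD.zero q hq, hG.zero q hq] at e2
    rw [hk, ← sub_add, Complex.exp_add, Complex.exp_sub, e1,
      Complex.exp_log (Complex.slitPlane_ne_zero (hcurve q hq)), Complex.exp_neg,
      show m q = Complex.exp (P q + c₀) from e2.symm, Complex.exp_add]
    have := Complex.slitPlane_ne_zero (hcurve q hq)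
    field_simp [Complex.exp_ne_zero]
  have hlog := Complex.log_exp (x := P q - k) (by simpa using hq2) (by simpa using hq1.le)
  rw [hexpk] at hlog
  have harg : (m q).arg = (P q).im - k.im := by rw [← Complex.log_im, hlog]; simp
  exact mobius_notMem_slitPlane hσ hρ hx' hxs hre him (Complex.mem_slitPlane_iff_arg.2
    ⟨by change (m q).arg ≠ _; rw [harg]; exact hq1.ne, by
      change m q ≠ 0
      rw [← hexpk]; exact Complex.exp_ne_zero _⟩)

end LowerDeformation

/-! ### Circular crosscuts between the interval and the deformed curve -/

/-- A primitive varies by at most `π ρ M` along an arc of radius `ρ` on which `‖f‖ ≤ M`. -/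
theorem norm_sub_le_of_arc {D : Set ℂ} {p ρ σ r₀ M : ℝ} (hσ : σ = 1 ∨ σ = -1) (hρ : 0 < ρ)
    (harc : ∀ z : ℂ, ‖z - p‖ = ρ → z.im < 0 → r₀ ≤ σ * (z.re - p) → z ∈ D) {f G : ℂ → ℂ}
    (hG : ∀ z ∈ D, HasDerivAt G (f z) z) (hM : ∀ z ∈ D, ‖z - p‖ = ρ → ‖f z‖ ≤ M) {z₁ z₂ : ℂ}
    (h₁ : ‖z₁ - p‖ = ρ) (hi₁ : z₁.im < 0) (hr₁ : r₀ ≤ σ * (z₁.re - p))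
    (h₂ : ‖z₂ - p‖ = ρ) (hi₂ : z₂.im < 0) (hr₂ : r₀ ≤ σ * (z₂.re - p)) :
    ‖G z₁ - G z₂‖ ≤ Real.pi * ρ * M := by
  set α : ℝ → ℂ := fun θ => p + ρ * Complex.exp (-(θ * Complex.I)) with hα
  have hαre : ∀ θ, (α θ).re - p = ρ * Real.cos θ := fun θ => by
    simp [hα, Complex.exp_re]
  have hαim : ∀ θ, (α θ).im = -(ρ * Real.sin θ) := fun θ => by
    simp [hα, Complex.exp_im]
  have hαn : ∀ θ, ‖α θ - p‖ = ρ := fun θ => by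
    simp only [hα, add_sub_cancel_left, norm_mul, Complex.norm_real, Real.norm_eq_abs,
      abs_of_pos hρ]
    rw [← neg_mul, ← Complex.ofReal_neg, Complex.norm_exp_ofReal_mul_I, mul_one]
  have param : ∀ z : ℂ, ‖z - p‖ = ρ → z.im < 0 → ∃ θ ∈ Ioo 0 Real.pi, α θ = z := by
    intro z hz hzi
    have e0 : (z.re - p) ^ 2 + z.im ^ 2 = ρ ^ 2 := by
      rw [← hz, Complex.sq_norm, Complex.normSq_apply]; simp; ring
    have e1 : ((z.re - p) / ρ) ^ 2 < 1 ^ 2 := by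
      rw [div_pow, div_lt_iff₀ (by positivity)]
      nlinarith
    have e2 := abs_lt_of_sq_lt_sq' e1 zero_le_one
    refine ⟨Real.arccos ((z.re - p) / ρ), ⟨Real.arccos_pos.2 e2.2, ?_⟩, ?_⟩
    · refine lt_of_le_of_ne (Real.arccos_le_pi _) (fun e => ?_)
      rw [Real.arccos_eq_pi] at e
      linarith
    · have hcos := Real.cos_arccos e2.1.le e2.2.le
      apply Complex.ext
      · have := hαre (Real.arccos ((z.re - p) / ρ))
        rw [hcos, mul_div_cancel₀ _ hρ.ne'] at this
        linarith
      · rw [hαim, Real.sin_arccos]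
        have e3 : 1 - ((z.re - p) / ρ) ^ 2 = (-z.im / ρ) ^ 2 := by
          field_simp
          linarith
        rw [e3, Real.sqrt_sq (div_nonneg (by linarith) hρ.le)]
        field_simp
  obtain ⟨θ₁, hθ₁, rfl⟩ := param z₁ h₁ hi₁
  obtain ⟨θ₂, hθ₂, rfl⟩ := param z₂ h₂ hi₂
  rw [hαre] at hr₁ hr₂
  have hsub : ∀ θ ∈ uIcc θ₁ θ₂, α θ ∈ D := by
    intro θ hθ
    have hmem : θ ∈ Ioo 0 Real.pi := (ordConnected_Ioo.uIcc_subset hθ₁ hθ₂) hθ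
    refine harc _ (hαn θ) ?_ ?_
    · rw [hαim]
      have := Real.sin_pos_of_mem_Ioo hmem
      have := mul_pos hρ this
      linarith
    · rw [hαre]
      have hanti := Real.strictAntiOn_cos.antitoneOn
      have m0 : θ ∈ Icc 0 Real.pi := Ioo_subset_Icc_self hmem
      have m1 : θ₁ ∈ Icc 0 Real.pi := Ioo_subset_Icc_self hθ₁
      have m2 : θ₂ ∈ Icc 0 Real.pi := Ioo_subset_Icc_self hθ₂
      rcases hσ with rfl | rfl <;> rcases mem_uIcc.1 hθ with h | h
      · have := mul_le_mul_of_nonneg_left (hanti m0 m2 h.2) hρ.le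
        linarith
      · have := mul_le_mul_of_nonneg_left (hanti m0 m1 h.2) hρ.le
        linarith
      · have := mul_le_mul_of_nonneg_left (hanti m1 m0 h.1) hρ.le
        linarith
      · have := mul_le_mul_of_nonneg_left (hanti m2 m0 h.1) hρ.le
        linarith
  have hder : ∀ θ ∈ uIcc θ₁ θ₂, HasDerivWithinAt (fun θ => G (α θ))
      (f (α θ) * (ρ * (Complex.exp (-(θ * Complex.I)) * (-Complex.I)))) (uIcc θ₁ θ₂) θ := by
    intro θ hθ
    have hα' : HasDerivAt α (ρ * (Complex.exp (-(θ * Complex.I)) * (-Complex.I))) θ := by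
      have h1 : HasDerivAt (fun θ : ℝ => -((θ : ℂ) * Complex.I)) (-Complex.I) θ := by
        have := ((Complex.ofRealCLM.hasDerivAt (x := θ)).mul_const Complex.I).neg
        simpa using! this
      exact (h1.cexp.const_mul _).const_add _
    exact ((hG _ (hsub θ hθ)).comp θ hα').hasDerivWithinAt
  have hM0 : 0 ≤ M := (norm_nonneg _).trans (hM _ (hsub θ₁ left_mem_uIcc) (hαn _))
  have key := (convex_uIcc θ₁ θ₂).norm_image_sub_le_of_norm_hasDerivWithin_le (C := M * ρ) hder
    (fun θ hθ => by
      have hexp : ‖Complex.exp (-(θ * Complex.I))‖ = 1 := by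
        rw [← neg_mul, ← Complex.ofReal_neg, Complex.norm_exp_ofReal_mul_I]
      rw [norm_mul, norm_mul, norm_mul, hexp, norm_neg, Complex.norm_I, mul_one, mul_one,
        Complex.norm_real, Real.norm_eq_abs, abs_of_pos hρ]
      exact mul_le_mul_of_nonneg_right (hM _ (hsub θ hθ) (hαn θ)) hρ.le)
    right_mem_uIcc left_mem_uIcc
  refine key.trans ?_
  have hd : ‖θ₁ - θ₂‖ ≤ Real.pi := by
    rw [Real.norm_eq_abs, abs_le]
    constructor <;> linarith [hθ₁.1, hθ₁.2, hθ₂.1, hθ₂.2]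
  calc M * ρ * ‖θ₁ - θ₂‖ ≤ M * ρ * Real.pi := by gcongr
    _ = Real.pi * ρ * M := by ring

namespace LowerDeformation

variable {a b : EReal} {D : Set ℂ} {h : ℝ × ℝ → ℂ}

theorem continuousOn_slice (hD : LowerDeformation a b D h) {s : ℝ} (hs : s ∈ Icc (0 : ℝ) 1) :
    ContinuousOn (fun t => h (s, t)) (realIoo a b) :=
  hD.continuousOn.comp (by fun_prop) (fun t ht => ⟨hs, ht⟩)

/-- A circular crosscut from a point of the interval to the deformed curve. -/
theorem exists_crosscut (hD : LowerDeformation a b D h) {p ρ σ : ℝ} (hσ : σ = 1 ∨ σ = -1)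
    (hρ : 0 < ρ) (hq : p + σ * ρ ∈ realIoo a b) (hhit : ∃ t ∈ realIoo a b, ‖h (1, t) - p‖ = ρ)
    (hl : ∀ᶠ z : ℂ in Setting.endPoint a, ‖z - p‖ ≠ ρ)
    (hr : ∀ᶠ z : ℂ in Setting.endPoint b, ‖z - p‖ ≠ ρ) :
    ∃ T ∈ realIoo a b, ‖h (1, T) - p‖ = ρ ∧ ∀ {f : ℂ → ℂ} {P : ℝ → ℂ} {G : ℂ → ℂ}
      {g : ℝ × ℝ → ℂ}, DeformedPrimitive a b D h f P G g → ∀ M : ℝ,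
      (∀ z ∈ D, ‖z - p‖ = ρ → ‖f z‖ ≤ M) →
      ‖G (h (1, T)) - P (p + σ * ρ)‖ ≤ Real.pi * ρ * M := by
  have hσ2 : σ * σ = 1 := by rcases hσ with rfl | rfl <;> norm_num
  have h1 : (1 : ℝ) ∈ Icc (0 : ℝ) 1 := by simp
  have hc := hD.continuousOn_slice h1
  obtain ⟨u, hu, hu'⟩ := (eventually_leftFilter hD.lt).1 (hD.eventually_left hl)
  obtain ⟨v, hv, hv'⟩ := (eventually_rightFilter hD.lt).1 (hD.eventually_right hr)
  have hsub : Icc u v ⊆ realIoo a b := (ordConnected_realIoo a b).out hu hv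
  have hcuv := hc.mono hsub
  have hK : IsCompact (Icc u v ∩ (fun t => ‖h (1, t) - p‖) ⁻¹' {ρ}) :=
    isCompact_Icc.of_isClosed_subset
      ((hcuv.sub continuousOn_const).norm.preimage_isClosed_of_isClosed isClosed_Icc
        isClosed_singleton) inter_subset_left
  have hmemK : ∀ t ∈ realIoo a b, ‖h (1, t) - p‖ = ρ →
      t ∈ Icc u v ∩ (fun t => ‖h (1, t) - p‖) ⁻¹' {ρ} := by
    refine fun t ht htp => ⟨⟨?_, ?_⟩, htp⟩
    · by_contra hlt
      exact hu' t ht (not_le.1 hlt).le 1 h1 htp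
    · by_contra hlt
      exact hv' t ht (not_le.1 hlt).le 1 h1 htp
  obtain ⟨t₁, ht₁, ht₁'⟩ := hhit
  -- `T` is the contact of the curve with the circle that is closest to `p + σ ρ` along the lower
  -- arc, so the arc beyond it misses the curve. It is chosen before `f`, which lets one crosscut
  -- serve several functions.
  obtain ⟨T, hT, hmax⟩ := hK.exists_isMaxOn ⟨t₁, hmemK t₁ ht₁ ht₁'⟩
    (f := fun t => σ * ((h (1, t)).re - p))
    (ContinuousOn.mono (continuousOn_const.mul
      ((Complex.continuous_re.comp_continuousOn hcuv).sub continuousOn_const)) inter_subset_left)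
  have hTI : T ∈ realIoo a b := hsub hT.1
  have hTρ : ‖h (1, T) - p‖ = ρ := hT.2
  refine ⟨T, hTI, hTρ, ?_⟩
  intro f P G g hG M hM
  set r₀ := σ * ((h (1, T)).re - p) with hr₀
  have hTi := hD.im_neg _ (hD.mem 1 (by simp) T hTI)
  have harc : ∀ z : ℂ, ‖z - p‖ = ρ → z.im < 0 → r₀ ≤ σ * (z.re - p) → z ∈ D := by
    intro z hz hzi hzr
    rcases hzr.eq_or_lt with e | hlt
    · have e1 : (h (1, T)).re = z.re := by
        rcases hσ with rfl | rfl <;> linarith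
      have sq : ∀ y : ℂ, ‖y - p‖ = ρ → (y.re - p) ^ 2 + y.im ^ 2 = ρ ^ 2 := fun y hy => by
        rw [← hy, Complex.sq_norm, Complex.normSq_apply]; simp; ring
      have e2 : (h (1, T)).im = z.im := by
        have h3 := sq z hz
        have h4 := sq _ hTρ
        rw [e1] at h4
        have h5 : (h (1, T)).im ^ 2 = z.im ^ 2 := by linarith
        rcases sq_eq_sq_iff_eq_or_eq_neg.1 h5 with h6 | h6
        · exact h6
        · linarith
      rw [← Complex.ext e1 e2]
      exact hD.mem 1 (by simp) T hTI
    · exact hD.mem_of_arc_disjoint hσ hρ hq hz hzi fun t ht htρ =>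
        lt_of_le_of_lt (hmax (hmemK t ht htρ)) hlt
  have hr₀ρ : r₀ < ρ := by
    have h3 : (h (1, T)).im ^ 2 + ((h (1, T)).re - p) ^ 2 = ρ ^ 2 := by
      rw [← hTρ, Complex.sq_norm, Complex.normSq_apply]; simp; ring
    have h4 : r₀ ^ 2 = ((h (1, T)).re - p) ^ 2 := by
      rw [hr₀, mul_pow, sq σ, hσ2, one_mul]
    have h5 : r₀ ^ 2 < ρ ^ 2 := by nlinarith
    exact (abs_lt_of_sq_lt_sq' h5 hρ.le).2
  set q := p + σ * ρ with hqdef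
  -- The end `q` of the arc is not in `D`, so `G` is evaluated at a point `h (s, t)` of the same
  -- circle close to `q`. It exists by the intermediate value theorem: for small `s` the points over
  -- `q - σ η` and `q + σ η` are inside and outside the circle.
  refine le_of_forall_pos_le_add fun ε hε => ?_
  have hev : ∀ᶠ x in 𝓝[Icc 0 1 ×ˢ realIoo a b] ((0 : ℝ), q),
      ‖g x - P q‖ < ε ∧ |(h x).re - q| < ρ - r₀ := by
    have c1 := hG.continuousOn (0, q) ⟨by simp, hq⟩
    have c2 := hD.continuousOn (0, q) ⟨by simp, hq⟩
    have e1 := c1.eventually_mem (Metric.ball_mem_nhds _ hε)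
    have e2 := c2.eventually_mem (Metric.ball_mem_nhds _ (sub_pos.2 hr₀ρ))
    filter_upwards [e1, e2] with x hx1 hx2
    rw [hG.zero q hq, mem_ball_iff_norm] at hx1
    rw [hD.zero q hq, mem_ball_iff_norm] at hx2
    refine ⟨hx1, lt_of_le_of_lt ?_ hx2⟩
    simpa using Complex.abs_re_le_norm (h x - q)
  rw [eventually_nhdsWithin_iff] at hev
  obtain ⟨η₁, hη₁, hball⟩ := Metric.eventually_nhds_iff_ball.1 hev
  obtain ⟨η₂, hη₂, hballI⟩ := Metric.isOpen_iff.1 (isOpen_realIoo a b) q hq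
  set η := min (min η₁ η₂) ρ / 2 with hη
  have hηpos : 0 < η := by positivity
  have hη1 : η < η₁ := (half_lt_self (by positivity)).trans_le
    ((min_le_left _ _).trans (min_le_left _ _))
  have hη2 : η < η₂ := (half_lt_self (by positivity)).trans_le
    ((min_le_left _ _).trans (min_le_right _ _))
  have hηρ : η < ρ := (half_lt_self (by positivity)).trans_le (min_le_right _ _)
  have hηI : ∀ t, |t - q| ≤ η → t ∈ realIoo a b := fun t ht => hballI (by
    rw [Metric.mem_ball, Real.dist_eq]; exact ht.trans_lt hη2)
  have hσabs : |σ| = 1 := by rcases hσ with rfl | rfl <;> simp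
  have ht1 : |q - σ * η - q| ≤ η := by
    rw [sub_sub_cancel_left, abs_neg, abs_mul, hσabs, one_mul, abs_of_pos hηpos]
  have ht2 : |q + σ * η - q| ≤ η := by
    rw [add_sub_cancel_left, abs_mul, hσabs, one_mul, abs_of_pos hηpos]
  have lim : ∀ t ∈ realIoo a b, Tendsto (fun s : ℝ => ‖h (s, t) - p‖) (𝓝[>] 0)
      (𝓝 ‖((t : ℂ) - p)‖) := by
    intro t ht
    rw [← hD.zero t ht]
    have h1 : ContinuousWithinAt (fun s : ℝ => h (s, t)) (Icc 0 1) 0 :=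
      ContinuousWithinAt.comp (g := h) (f := fun s : ℝ => (s, t))
        (hD.continuousOn (0, t) ⟨by simp, ht⟩) (by fun_prop) (fun s hs => ⟨hs, ht⟩)
    exact ((h1.sub continuousWithinAt_const).norm).tendsto.mono_left
      (nhdsWithin_le_of_mem (Icc_mem_nhdsGT one_pos))
  have hlt1 : ‖((q - σ * η : ℝ) : ℂ) - p‖ < ρ := by
    rw [← Complex.ofReal_sub, Complex.norm_real, Real.norm_eq_abs, hqdef,
      show p + σ * ρ - σ * η - p = σ * (ρ - η) by ring, abs_mul, hσabs, one_mul,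
      abs_of_pos (by linarith)]
    linarith
  have hgt2 : ρ < ‖((q + σ * η : ℝ) : ℂ) - p‖ := by
    rw [← Complex.ofReal_sub, Complex.norm_real, Real.norm_eq_abs, hqdef,
      show p + σ * ρ + σ * η - p = σ * (ρ + η) by ring, abs_mul, hσabs, one_mul,
      abs_of_pos (by linarith)]
    linarith
  obtain ⟨s, ⟨⟨hs1, hs2⟩, hs3⟩⟩ := (((lim _ (hηI _ ht1)).eventually (gt_mem_nhds hlt1)).and
    ((lim _ (hηI _ ht2)).eventually (lt_mem_nhds hgt2))).and
    (Ioo_mem_nhdsGT (show (0 : ℝ) < min η₁ 1 by positivity)) |>.exists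
  have hsIoc : s ∈ Ioc (0 : ℝ) 1 := ⟨hs3.1, (hs3.2.trans_le (min_le_right _ _)).le⟩
  have hsIcc : s ∈ Icc (0 : ℝ) 1 := ⟨hs3.1.le, hsIoc.2⟩
  have huI : ∀ t ∈ uIcc (q - σ * η) (q + σ * η), |t - q| ≤ η := by
    intro t ht
    rw [abs_le]
    rcases hσ with rfl | rfl <;> rcases mem_uIcc.1 ht with h | h <;> constructor <;> linarith [h.1, h.2]
  obtain ⟨t, ht, htρ⟩ := intermediate_value_uIcc (f := fun t => ‖h (s, t) - p‖)
    (a := q - σ * η) (b := q + σ * η)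
    ((((hD.continuousOn_slice hsIcc).mono (fun t ht => hηI t (huI t ht))).sub
      continuousOn_const).norm) (mem_uIcc.2 (Or.inl ⟨hs1.le, hs2.le⟩))
  have htI := hηI t (huI t ht)
  obtain ⟨hb1, hb2⟩ := hball (s, t) (by
    rw [Metric.mem_ball, Prod.dist_eq, max_lt_iff, Real.dist_eq, Real.dist_eq, sub_zero,
      abs_of_pos hs3.1]
    exact ⟨hs3.2.trans_le (min_le_left _ _), (huI t ht).trans_lt hη1⟩) ⟨hsIcc, htI⟩
  have hzr : r₀ ≤ σ * ((h (s, t)).re - p) := by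
    have : σ * ((h (s, t)).re - p) = ρ + σ * ((h (s, t)).re - q) := by
      rw [hqdef]; linear_combination ρ * hσ2
    rw [this]
    have := abs_lt.1 hb2
    rcases hσ with rfl | rfl <;> linarith
  have hfin := norm_sub_le_of_arc hσ hρ harc hG.hasDerivAt hM hTρ hTi le_rfl htρ
    (hD.im_neg _ (hD.mem s hsIoc t htI)) hzr
  rw [hG.pos s hsIoc t htI] at hb1
  calc ‖G (h (1, T)) - P q‖ = ‖(G (h (1, T)) - G (h (s, t))) + (G (h (s, t)) - P q)‖ := by
        congr 1; ring
    _ ≤ _ := (norm_add_le _ _).trans (add_le_add hfin hb1.le)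

end LowerDeformation

/-! ### Limits of primitives at finite and infinite end points -/

/-- `e` is an end point of the interval `(a, b)`, and `L` the filter of its real neighbourhoods
from inside. -/
def IsEnd (a b e : EReal) (L : Filter ℝ) : Prop :=
  (e = a ∧ L = leftFilter a) ∨ (e = b ∧ L = rightFilter b)

/-- A power bound on `f` near the end point `e` that makes `f` integrable there. -/
def EndBound (D : Set ℂ) (f : ℂ → ℂ) (e : EReal) : Prop :=
  (∀ r : ℝ, (r : EReal) = e → ∃ C γ : ℝ, -1 < γ ∧ ∃ ε > 0, ∀ z ∈ D, ‖z - r‖ < ε →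
    ‖f z‖ ≤ C * ‖z - r‖ ^ γ) ∧
  (e = ⊤ ∨ e = ⊥ → ∃ C γ : ℝ, γ < -1 ∧ ∃ R > 0, ∀ z ∈ D, R < ‖z‖ → ‖f z‖ ≤ C * ‖z‖ ^ γ)

namespace LowerDeformation

variable {a b e : EReal} {L : Filter ℝ} {D : Set ℂ} {h : ℝ × ℝ → ℂ}

theorem eventually_end (hD : LowerDeformation a b D h) (he : IsEnd a b e L) {q : ℂ → Prop}
    (hq : ∀ᶠ z in Setting.endPoint e, q z) : ∀ᶠ t in L, ∀ s ∈ Icc (0 : ℝ) 1, q (h (s, t)) := by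
  rcases he with ⟨rfl, rfl⟩ | ⟨rfl, rfl⟩
  · exact hD.eventually_left hq
  · exact hD.eventually_right hq

theorem tendsto_slice (hD : LowerDeformation a b D h) (he : IsEnd a b e L) {s : ℝ}
    (hs : s ∈ Icc (0 : ℝ) 1) : Tendsto (fun t => h (s, t)) L (Setting.endPoint e) :=
  fun _ hq => (hD.eventually_end he hq).mono fun _ ht => ht s hs

end LowerDeformation

theorem IsEnd.neBot {a b e : EReal} {L : Filter ℝ} (hab : a < b) (he : IsEnd a b e L) :
    L.NeBot := by
  rw [neBot_iff]
  intro h0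
  have : ∀ᶠ _ in L, False := by simp [h0]
  rcases he with ⟨rfl, rfl⟩ | ⟨rfl, rfl⟩
  · obtain ⟨u, hu, h1⟩ := (eventually_leftFilter hab).1 this
    exact h1 u hu le_rfl
  · obtain ⟨u, hu, h1⟩ := (eventually_rightFilter hab).1 this
    exact h1 u hu le_rfl

theorem IsEnd.eventually_mem {a b e : EReal} {L : Filter ℝ} (hab : a < b) (he : IsEnd a b e L) :
    ∀ᶠ t in L, t ∈ realIoo a b := by
  obtain ⟨u, hu⟩ := nonempty_realIoo hab
  rcases he with ⟨rfl, rfl⟩ | ⟨rfl, rfl⟩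
  · exact (eventually_leftFilter hab).2 ⟨u, hu, fun t ht _ => ht⟩
  · exact (eventually_rightFilter hab).2 ⟨u, hu, fun t ht _ => ht⟩

/-- The circles with centre `p` and radius `ρ`, where `ρ` runs through the filter `R`, shrink to
the end point `e`. -/
structure EndCircles (a b e : EReal) (L : Filter ℝ) (p σ : ℝ) (R : Filter ℝ) : Prop where
  sign : σ = 1 ∨ σ = -1
  neBot : R.NeBot
  pos : ∀ᶠ ρ in R, 0 < ρ
  tendsto : Tendsto (fun ρ => p + σ * ρ) R L
  left : ∀ᶠ ρ in R, ∀ᶠ z : ℂ in Setting.endPoint a, ‖z - p‖ ≠ ρ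
  right : ∀ᶠ ρ in R, ∀ᶠ z : ℂ in Setting.endPoint b, ‖z - p‖ ≠ ρ
  endPoint : ∀ z : ℝ → ℂ, (∀ᶠ ρ in R, ‖z ρ - p‖ = ρ) → Tendsto z R (Setting.endPoint e)
  hit : ∀ D h, LowerDeformation a b D h → ∀ᶠ ρ in R, ∃ t ∈ realIoo a b, ‖h (1, t) - p‖ = ρ
  bound : ∀ D f, EndBound D f e → ∃ M : ℝ → ℝ,
    (∀ᶠ ρ in R, ∀ z ∈ D, ‖z - p‖ = ρ → ‖f z‖ ≤ M ρ) ∧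
      Tendsto (fun ρ => Real.pi * ρ * M ρ) R (𝓝 0)

theorem eventually_endPoint_norm_ne {e : EReal} {p ρ : ℝ}
    (h : ∀ r : ℝ, (r : EReal) = e → |r - p| ≠ ρ) :
    ∀ᶠ z : ℂ in Setting.endPoint e, ‖z - p‖ ≠ ρ := by
  have inf : ∀ᶠ z : ℂ in Bornology.cobounded ℂ, ‖z - p‖ ≠ ρ := by
    have h1 : Tendsto (fun z : ℂ => ‖z - p‖) (Bornology.cobounded ℂ) atTop := by
      refine tendsto_norm_cobounded_atTop.comp ?_
      simp [sub_eq_add_neg]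
    exact (h1.eventually_gt_atTop ρ).mono fun z hz => hz.ne'
  induction e with
  | bot => rwa [endPoint_bot]
  | top => rwa [endPoint_top]
  | coe r =>
    rw [endPoint_coe]
    have h1 : ContinuousAt (fun z : ℂ => ‖z - p‖) (r : ℂ) := by fun_prop
    refine h1.eventually_ne ?_
    rw [← Complex.ofReal_sub, Complex.norm_real]
    exact h r rfl

theorem exists_norm_sub_eq {a b : EReal} {D : Set ℂ} {h : ℝ × ℝ → ℂ}
    (hD : LowerDeformation a b D h) {p ρ u v : ℝ} (hu : u ∈ realIoo a b) (hv : v ∈ realIoo a b)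
    (hu' : ‖h (1, u) - p‖ ≤ ρ) (hv' : ρ ≤ ‖h (1, v) - p‖) :
    ∃ t ∈ realIoo a b, ‖h (1, t) - p‖ = ρ := by
  have h1 := (convex_realIoo a b).isPreconnected.intermediate_value hu hv
    (((hD.continuousOn_slice (s := 1) (by simp)).sub continuousOn_const).norm (f := fun t =>
      h (1, t) - p))
  obtain ⟨t, ht, e⟩ := h1 ⟨hu', hv'⟩
  exact ⟨t, ht, e⟩

theorem tendsto_mul_rpow_atTop {γ : ℝ} (hγ : γ < -1) (C : ℝ) :
    Tendsto (fun ρ : ℝ => Real.pi * ρ * (C * ρ ^ γ)) atTop (𝓝 0) := by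
  have h1 : Tendsto (fun ρ : ℝ => ρ ^ (γ + 1)) atTop (𝓝 0) := by
    have := tendsto_rpow_neg_atTop (y := -(γ + 1)) (by linarith)
    simpa using! this
  have h2 := h1.const_mul (Real.pi * C)
  rw [mul_zero] at h2
  refine h2.congr' ?_
  filter_upwards [eventually_gt_atTop 0] with ρ hρ
  rw [Real.rpow_add hρ, Real.rpow_one]; ring

theorem tendsto_mul_rpow_zero {γ : ℝ} (hγ : -1 < γ) (C : ℝ) :
    Tendsto (fun ρ : ℝ => Real.pi * ρ * (C * ρ ^ γ)) (𝓝[>] 0) (𝓝 0) := by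
  have h1 : Tendsto (fun ρ : ℝ => ρ ^ (γ + 1)) (𝓝[>] 0) (𝓝 0) := by
    have := (Real.continuousAt_rpow_const 0 (γ + 1) (Or.inr (by linarith))).tendsto
    rw [Real.zero_rpow (by linarith)] at this
    exact this.mono_left nhdsWithin_le_nhds
  have h2 := h1.const_mul (Real.pi * C)
  rw [mul_zero] at h2
  refine h2.congr' ?_
  filter_upwards [self_mem_nhdsWithin] with ρ hρ
  rw [Real.rpow_add hρ, Real.rpow_one]; ring

/-- Small circles about `p` are hit because the curve tends to `p` at this end and is away from `p`
elsewhere. The exponent `γ > -1` makes length times bound tend to zero. -/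
theorem endCircles_finite {a b : EReal} (hab : a < b) {p σ : ℝ} {L : Filter ℝ}
    (he : IsEnd a b p L) (hσ : σ = 1 ∨ σ = -1)
    (ht : Tendsto (fun ρ => p + σ * ρ) (𝓝[>] 0) L) :
    EndCircles a b p L p σ (𝓝[>] 0) := by
  have aux : ∀ e' : EReal, ∀ᶠ ρ in 𝓝[>] (0 : ℝ), ∀ r : ℝ, (r : EReal) = e' → |r - p| ≠ ρ := by
    intro e'
    induction e' with
    | bot => simp
    | top => simp
    | coe s =>
      by_cases hs : s = p
      · filter_upwards [self_mem_nhdsWithin] with ρ (hρ : 0 < ρ) r hr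
        rw [EReal.coe_eq_coe_iff] at hr
        subst hr hs
        simpa using hρ.ne
      · have : ∀ᶠ ρ in 𝓝[>] (0 : ℝ), ρ < |s - p| :=
          (eventually_lt_nhds (abs_pos.2 (sub_ne_zero.2 hs))).filter_mono nhdsWithin_le_nhds
        filter_upwards [this] with ρ hρ r hr
        rw [EReal.coe_eq_coe_iff] at hr
        subst hr
        exact hρ.ne'
  refine ⟨hσ, inferInstance, self_mem_nhdsWithin, ht, ?_, ?_, ?_, ?_, ?_⟩
  · exact (aux a).mono fun ρ hρ => eventually_endPoint_norm_ne hρ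
  · exact (aux b).mono fun ρ hρ => eventually_endPoint_norm_ne hρ
  · intro z hz
    rw [endPoint_coe, tendsto_iff_norm_sub_tendsto_zero]
    exact (tendsto_id.mono_left nhdsWithin_le_nhds).congr' (hz.mono fun ρ hρ => hρ.symm)
  · intro D h hD
    obtain ⟨v, hv⟩ := nonempty_realIoo hab
    have hv0 : 0 < ‖h (1, v) - p‖ := by
      refine norm_pos_iff.2 (sub_ne_zero.2 fun e => ?_)
      have := hD.im_neg _ (hD.mem 1 (by simp) v hv)
      simp [e] at this
    have h2 : ∀ᶠ ρ in 𝓝[>] (0 : ℝ), ρ < ‖h (1, v) - p‖ :=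
      (eventually_lt_nhds hv0).filter_mono nhdsWithin_le_nhds
    filter_upwards [h2, self_mem_nhdsWithin] with ρ h3 (h4 : 0 < ρ)
    have := he.neBot hab
    have h5 := (hD.tendsto_slice he (s := 1) (by simp)).eventually
      (show ∀ᶠ z : ℂ in Setting.endPoint p, ‖z - p‖ < ρ by
        rw [endPoint_coe]
        filter_upwards [Metric.ball_mem_nhds (p : ℂ) h4] with z hz
        rwa [← dist_eq_norm])
    obtain ⟨u, hu, hu'⟩ := (h5.and (he.eventually_mem hab)).exists
    exact exists_norm_sub_eq hD hu' hv hu.le h3.le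
  · intro D f hf
    obtain ⟨C, γ, hγ, ε, hε, hb⟩ := hf.1 p rfl
    refine ⟨fun ρ => C * ρ ^ γ, ?_, tendsto_mul_rpow_zero hγ C⟩
    filter_upwards [(eventually_lt_nhds hε).filter_mono nhdsWithin_le_nhds] with ρ hρ z hz e
    rw [← e]
    exact hb z hz (e ▸ hρ)

/-- Large circles about the origin play the same role, now with decay exponent `γ < -1`. -/
theorem endCircles_infinite {a b e : EReal} (hab : a < b) {σ : ℝ} {L : Filter ℝ}
    (he : IsEnd a b e L) (hinf : e = ⊤ ∨ e = ⊥) (hσ : σ = 1 ∨ σ = -1)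
    (ht : Tendsto (fun ρ => 0 + σ * ρ) atTop L) :
    EndCircles a b e L 0 σ atTop := by
  have hend : Setting.endPoint e = Bornology.cobounded ℂ := by simp [Setting.endPoint, hinf]
  have aux : ∀ e' : EReal, ∀ᶠ ρ in atTop, ∀ r : ℝ, (r : EReal) = e' → |r - 0| ≠ ρ := by
    intro e'
    induction e' with
    | bot => simp
    | top => simp
    | coe s =>
      filter_upwards [eventually_gt_atTop |s|] with ρ hρ r hr
      rw [EReal.coe_eq_coe_iff] at hr
      subst hr
      simpa using hρ.ne
  refine ⟨hσ, inferInstance, eventually_gt_atTop 0, ht, ?_, ?_, ?_, ?_, ?_⟩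
  · exact (aux a).mono fun ρ hρ => eventually_endPoint_norm_ne hρ
  · exact (aux b).mono fun ρ hρ => eventually_endPoint_norm_ne hρ
  · intro z hz
    rw [hend, ← tendsto_norm_atTop_iff_cobounded]
    refine tendsto_id.congr' (hz.mono fun ρ hρ => ?_)
    simpa using hρ.symm
  · intro D h hD
    obtain ⟨u, hu⟩ := nonempty_realIoo hab
    filter_upwards [eventually_ge_atTop ‖h (1, u) - (0 : ℝ)‖] with ρ h3
    have := he.neBot hab
    have h5 := (hD.tendsto_slice he (s := 1) (by simp)).eventually
      (show ∀ᶠ z : ℂ in Setting.endPoint e, ρ < ‖z‖ by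
        rw [hend]
        exact tendsto_norm_cobounded_atTop.eventually_gt_atTop ρ)
    obtain ⟨v, hv, hv'⟩ := (h5.and (he.eventually_mem hab)).exists
    exact exists_norm_sub_eq hD hu hv' h3 (by simpa using hv.le)
  · intro D f hf
    obtain ⟨C, γ, hγ, R, hR, hb⟩ := hf.2 hinf
    refine ⟨fun ρ => C * ρ ^ γ, ?_, tendsto_mul_rpow_atTop hγ C⟩
    filter_upwards [eventually_gt_atTop R] with ρ hρ z hz e
    simp only [Complex.ofReal_zero, sub_zero] at e
    rw [← e]
    exact hb z hz (e ▸ hρ)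

theorem exists_endCircles {a b e : EReal} (hab : a < b) {L : Filter ℝ} (he : IsEnd a b e L) :
    ∃ p σ R, EndCircles a b e L p σ R := by
  have he' := he
  rcases he with ⟨rfl, rfl⟩ | ⟨rfl, rfl⟩
  · induction e with
    | top => simp at hab
    | bot =>
      refine ⟨0, -1, atTop, endCircles_infinite hab he' (by simp) (by simp) ?_⟩
      intro s hs
      obtain ⟨u, hu, h1⟩ := (eventually_leftFilter hab).1 hs
      rw [mem_map]
      filter_upwards [eventually_ge_atTop (-u)] with ρ hρ
      have h2 : 0 + -1 * ρ ≤ u := by linarith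
      exact h1 _ ⟨EReal.bot_lt_coe _, lt_of_le_of_lt (by exact_mod_cast h2) hu.2⟩ h2
    | coe p =>
      refine ⟨p, 1, _, endCircles_finite hab he' (by simp) ?_⟩
      intro s hs
      obtain ⟨u, hu, h1⟩ := (eventually_leftFilter hab).1 hs
      have hpu : 0 < u - p := sub_pos.2 (by exact_mod_cast hu.1)
      rw [mem_map]
      filter_upwards [self_mem_nhdsWithin,
        (eventually_lt_nhds hpu).filter_mono nhdsWithin_le_nhds] with ρ (hρ : 0 < ρ) hρ'
      have h2 : p + 1 * ρ ≤ u := by linarith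
      have h3 : p < p + 1 * ρ := by linarith
      exact h1 _ ⟨by exact_mod_cast h3, lt_of_le_of_lt (by exact_mod_cast h2) hu.2⟩ h2
  · induction e with
    | bot => simp at hab
    | top =>
      refine ⟨0, 1, atTop, endCircles_infinite hab he' (by simp) (by simp) ?_⟩
      intro s hs
      obtain ⟨u, hu, h1⟩ := (eventually_rightFilter hab).1 hs
      rw [mem_map]
      filter_upwards [eventually_ge_atTop u] with ρ hρ
      have h2 : u ≤ 0 + 1 * ρ := by linarith
      exact h1 _ ⟨lt_of_lt_of_le hu.1 (by exact_mod_cast h2), EReal.coe_lt_top _⟩ h2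
    | coe p =>
      refine ⟨p, -1, _, endCircles_finite hab he' (by simp) ?_⟩
      intro s hs
      obtain ⟨u, hu, h1⟩ := (eventually_rightFilter hab).1 hs
      have hpu : 0 < p - u := sub_pos.2 (by exact_mod_cast hu.2)
      rw [mem_map]
      filter_upwards [self_mem_nhdsWithin,
        (eventually_lt_nhds hpu).filter_mono nhdsWithin_le_nhds] with ρ (hρ : 0 < ρ) hρ'
      have h2 : u ≤ p + -1 * ρ := by linarith
      have h3 : p + -1 * ρ < p := by linarith
      exact h1 _ ⟨lt_of_lt_of_le hu.1 (by exact_mod_cast h2), by exact_mod_cast h3⟩ h2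

/-- Near an infinite end point the primitive of the kernel along the curve and the one along the
real axis are asymptotically equal. -/
theorem tendsto_kernel_primitive_sub {a b e : EReal} {L : Filter ℝ} {D : Set ℂ} {h : ℝ × ℝ → ℂ}
    (hD : LowerDeformation a b D h) (he : IsEnd a b e L) (hinf : e = ⊤ ∨ e = ⊥) {w w' : ℂ}
    (hw : w ∉ D) (hwi' : 0 < w'.im) {P : ℝ → ℂ} {G : ℂ → ℂ} {g : ℝ × ℝ → ℂ}
    (hG : DeformedPrimitive a b D h (kernelPair w w') P G g) :
    Tendsto (fun t => G (h (1, t)) - P t) L (𝓝 0) := by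
  have hend : Setting.endPoint e = Bornology.cobounded ℂ := by simp [Setting.endPoint, hinf]
  obtain ⟨c₀, hc₀⟩ := hD.exists_exp_eq_mobius one_ne_zero hw hwi' hG
  set m : ℂ → ℂ := fun z => 1 * (z - w) / (z - w') with hm
  -- The Möbius map tends to `1` at infinity, so its principal logarithm tends to `0` both on the
  -- curve and on the axis. Near the end the whole vertical segment avoids the cut, so `g` and the
  -- logarithm have equal increments along it.
  have h1 : ∀ s ∈ Icc (0 : ℝ) 1, Tendsto (fun t => Complex.log (m (h (s, t)))) L (𝓝 0) := by
    intro s hs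
    have h2 := (tendsto_mobius_cobounded 1 w w').comp (hend ▸ hD.tendsto_slice he hs)
    have h3 := (continuousAt_clog (x := 1) (by simp)).tendsto.comp h2
    rwa [Complex.log_one] at h3
  have h4 := (h1 1 (by simp)).sub (h1 0 (by simp))
  rw [sub_zero] at h4
  refine h4.congr' ?_
  have h5 : ∀ᶠ z in Setting.endPoint e, m z ∈ Complex.slitPlane := by
    rw [hend]
    exact (tendsto_mobius_cobounded 1 w w').eventually_mem
      (Complex.isOpen_slitPlane.mem_nhds (by simp))
  filter_upwards [hD.eventually_end he h5, he.eventually_mem hD.lt] with t ht htI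
  have h6 := hD.sub_log_eq hwi' hG hc₀ (S := Icc (0 : ℝ) 1 ×ˢ {t}) (p := (1, t)) (p' := (0, t))
    (isPreconnected_Icc.prod isPreconnected_singleton)
    (by rintro ⟨s, t'⟩ ⟨hs, rfl⟩; exact ⟨hs, htI⟩)
    (by rintro ⟨s, t'⟩ ⟨hs, rfl⟩; exact ht s hs) (by simp) (by simp)
  rw [hG.zero t htI, hG.pos 1 (by simp) t htI] at h6
  simp only [hm]
  linear_combination -h6

/-- The difference of two Cauchy kernels is of order `|z| ^ (-2)`. -/
theorem endBound_kernelPair {D : Set ℂ} (w w' : ℂ) {e : EReal} (hinf : e = ⊤ ∨ e = ⊥) :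
    EndBound D (kernelPair w w') e := by
  refine ⟨fun r hr => by rcases hinf with rfl | rfl <;> simp at hr, fun _ => ?_⟩
  refine ⟨4 * ‖w - w'‖, -2, by norm_num, 2 * (‖w‖ + ‖w'‖) + 1, by positivity, fun z _ hz => ?_⟩
  have hw : ‖z‖ / 2 ≤ ‖z - w‖ := by
    have := norm_sub_norm_le z w
    linarith [norm_nonneg w, norm_nonneg w', norm_nonneg z]
  have hw' : ‖z‖ / 2 ≤ ‖z - w'‖ := by
    have := norm_sub_norm_le z w'
    linarith [norm_nonneg w, norm_nonneg w', norm_nonneg z]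
  have hz0 : 0 < ‖z‖ := by linarith [norm_nonneg w, norm_nonneg w']
  have h1 : z - w ≠ 0 := norm_pos_iff.1 (by linarith)
  have h2 : z - w' ≠ 0 := norm_pos_iff.1 (by linarith)
  have e : kernelPair w w' z = (w - w') / ((z - w) * (z - w')) := by
    rw [kernelPair]; field_simp; ring
  rw [e, norm_div, norm_mul, div_le_iff₀ (by positivity), Real.rpow_neg hz0.le]
  have h3 : ‖z‖ / 2 * (‖z‖ / 2) ≤ ‖z - w‖ * ‖z - w'‖ := by gcongr
  have h4 : (‖z‖ ^ (2 : ℝ))⁻¹ * (‖z‖ / 2 * (‖z‖ / 2)) = 1 / 4 := by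
    rw [Real.rpow_two]; field_simp; norm_num
  calc ‖w - w'‖ = 4 * ‖w - w'‖ * ((‖z‖ ^ (2 : ℝ))⁻¹ * (‖z‖ / 2 * (‖z‖ / 2))) := by
        rw [h4]; ring
    _ ≤ 4 * ‖w - w'‖ * ((‖z‖ ^ (2 : ℝ))⁻¹ * (‖z - w‖ * ‖z - w'‖)) := by gcongr
    _ = _ := by ring

section

variable {a b e : EReal} {L : Filter ℝ} {D : Set ℂ} {h : ℝ × ℝ → ℂ}

/-- Compactness of the extended real line gives the ultrafilter a limit in the closed interval. -/
theorem leftFilter_or_rightFilter_of_ultrafilter (hab : a < b) (V : Ultrafilter ℝ)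
    (hV : ∀ᶠ t in V, t ∈ realIoo a b) :
    (∃ x ∈ realIoo a b, (V : Filter ℝ) ≤ 𝓝 x) ∨ (V : Filter ℝ) ≤ leftFilter a ∨
      (V : Filter ℝ) ≤ rightFilter b := by
  obtain ⟨x, -, hx⟩ := isCompact_univ (X := EReal) |>.ultrafilter_le_nhds
    (V.map (fun t : ℝ => (t : EReal))) (by simp)
  have hx' : Tendsto (fun t : ℝ => (t : EReal)) V (𝓝 x) := hx
  have hax : a ≤ x := ge_of_tendsto hx' (hV.mono fun t ht => ht.1.le)
  have hxb : x ≤ b := le_of_tendsto hx' (hV.mono fun t ht => ht.2.le)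
  rcases hax.eq_or_lt with rfl | hax
  · refine Or.inr (Or.inl ?_)
    refine tendsto_iff_comap.1 (tendsto_nhdsWithin_iff.2 ⟨hx', hV.mono fun t ht => ht.1⟩)
  rcases hxb.eq_or_lt with rfl | hxb
  · refine Or.inr (Or.inr ?_)
    refine tendsto_iff_comap.1 (tendsto_nhdsWithin_iff.2 ⟨hx', hV.mono fun t ht => ht.2⟩)
  refine Or.inl ?_
  lift x to ℝ using ⟨(hxb.trans_le le_top).ne, (lt_of_le_of_lt bot_le hax).ne'⟩
  exact ⟨x, ⟨hax, hxb⟩, EReal.tendsto_coe.1 hx'⟩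

namespace LowerDeformation

/-- The end points of a deformed curve are separated unless both are infinite. -/
theorem disjoint_endPoint (hab : a < b) (hinf : ¬ (a = ⊥ ∧ b = ⊤)) :
    Disjoint (Setting.endPoint a) (Setting.endPoint b) := by
  have h1 : ∀ x : ℂ, Disjoint (𝓝 x) (Bornology.cobounded ℂ) := fun x =>
    Metric.disjoint_nhds_cobounded x
  induction a with
  | top => simp at hab
  | bot =>
    induction b with
    | top => simp at hinf
    | bot => simp at hab
    | coe r => rw [endPoint_bot, endPoint_coe]; exact (h1 _).symm
  | coe s =>
    induction b with
    | top => rw [endPoint_top, endPoint_coe]; exact h1 _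
    | bot => simp at hab
    | coe r =>
      rw [endPoint_coe, endPoint_coe, disjoint_nhds_nhds]
      have : s < r := by exact_mod_cast hab
      exact fun e => this.ne (by exact_mod_cast e)

/-- Over interior points the curve lies in the open lower half-plane, whereas end points are real or
infinite. -/
theorem not_tendsto_endPoint (hD : LowerDeformation a b D h) (he : IsEnd a b e L) {x : ℝ}
    (hx : x ∈ realIoo a b) (F : Filter ℝ) [F.NeBot] (hF : F ≤ 𝓝 x)
    (hFe : Tendsto (fun t => h (1, t)) F (Setting.endPoint e)) : False := by
  have h1 : Tendsto (fun t => h (1, t)) F (𝓝 (h (1, x))) :=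
    (((hD.continuousOn_slice (s := 1) (by simp)).continuousAt
      ((isOpen_realIoo a b).mem_nhds hx)).tendsto).mono_left hF
  have h2 := hD.im_neg _ (hD.mem 1 (by simp) x hx)
  induction e with
  | bot =>
    rw [endPoint_bot] at hFe
    exact (h1.norm.not_tendsto (disjoint_nhds_atTop _)) (tendsto_norm_cobounded_atTop.comp hFe)
  | top =>
    rw [endPoint_top] at hFe
    exact (h1.norm.not_tendsto (disjoint_nhds_atTop _)) (tendsto_norm_cobounded_atTop.comp hFe)
  | coe r =>
    rw [endPoint_coe] at hFe
    have := tendsto_nhds_unique h1 hFe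
    rw [this] at h2
    simp at h2

end LowerDeformation

/-- A strictly decreasing function has no common limit at the two ends of an interval. -/
theorem false_of_tendsto_sub {u : ℝ → ℝ} (hab : a < b) (hu : StrictAntiOn u (realIoo a b))
    {ι : Type*} {F : Filter ι} [F.NeBot] {x y : ι → ℝ} (hx : Tendsto x F (leftFilter a))
    (hy : Tendsto y F (rightFilter b)) (h0 : Tendsto (fun i => u (x i) - u (y i)) F (𝓝 0)) :
    False := by
  obtain ⟨t, ht⟩ := nonempty_realIoo hab
  obtain ⟨r, hr1, hr2⟩ := EReal.lt_iff_exists_real_btwn.1 ht.2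
  have hr : r ∈ realIoo a b := ⟨ht.1.trans hr1, hr2⟩
  have htr : t < r := by exact_mod_cast hr1
  have h1 : ∀ᶠ s in leftFilter a, u t ≤ u s := (eventually_leftFilter hab).2
    ⟨t, ht, fun s hs hst => hu.antitoneOn hs ht hst⟩
  have h2 : ∀ᶠ s in rightFilter b, u s ≤ u r := (eventually_rightFilter hab).2
    ⟨r, hr, fun s hs hst => hu.antitoneOn hr hs hst⟩
  have h3 : u t - u r ≤ 0 := by
    refine ge_of_tendsto h0 ?_
    filter_upwards [hx.eventually h1, hy.eventually h2] with i hi hi'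
    linarith
  linarith [hu ht hr htr]

/-- The primitive on the real interval and the primitive along the deformed curve have the same
limit at the end point. -/
theorem EndCircles.tendsto_primitive {p σ : ℝ} {R : Filter ℝ} (hR : EndCircles a b e L p σ R)
    (he : IsEnd a b e L) (hD : LowerDeformation a b D h)
    (hw : a = ⊥ → b = ⊤ → ∃ w : ℂ, w.im < 0 ∧ w ∉ D) {f : ℂ → ℂ} {P : ℝ → ℂ} {G : ℂ → ℂ}
    {g : ℝ × ℝ → ℂ} (hG : DeformedPrimitive a b D h f P G g) (hf : EndBound D f e) {ℓ : ℂ}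
    (hℓ : Tendsto (fun t => G (h (1, t))) L (𝓝 ℓ)) :
    Tendsto (fun ρ => P (p + σ * ρ)) R (𝓝 ℓ) := by
  have hRne := hR.neBot
  have hex : ∀ᶠ ρ in R, ∃ T ∈ realIoo a b, ‖h (1, T) - p‖ = ρ ∧ ∀ {f : ℂ → ℂ} {P : ℝ → ℂ}
      {G : ℂ → ℂ} {g : ℝ × ℝ → ℂ}, DeformedPrimitive a b D h f P G g → ∀ M : ℝ,
      (∀ z ∈ D, ‖z - p‖ = ρ → ‖f z‖ ≤ M) →
      ‖G (h (1, T)) - P (p + σ * ρ)‖ ≤ Real.pi * ρ * M := by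
    filter_upwards [hR.pos, hR.tendsto.eventually (he.eventually_mem hD.lt), hR.left, hR.right,
      hR.hit D h hD] with ρ h1 h2 h3 h4 h5
    exact hD.exists_crosscut hR.sign h1 h2 h5 h3 h4
  obtain ⟨T, hT⟩ := hex.choice
  -- The parameters `T ρ` do not depend on `f`; below, the same ones are used for a Cauchy kernel.
  have key : ∀ {f : ℂ → ℂ} {P : ℝ → ℂ} {G : ℂ → ℂ} {g : ℝ × ℝ → ℂ},
      DeformedPrimitive a b D h f P G g → EndBound D f e →
      Tendsto (fun ρ => G (h (1, T ρ)) - P (p + σ * ρ)) R (𝓝 0) := by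
    intro f P G g hG hf
    obtain ⟨M, hM, hM0⟩ := hR.bound D f hf
    refine squeeze_zero_norm' ?_ hM0
    filter_upwards [hT, hM] with ρ h1 h2
    exact h1.2.2 hG _ h2
  have hTend : Tendsto (fun ρ => h (1, T ρ)) R (Setting.endPoint e) :=
    hR.endPoint _ (hT.mono fun ρ hρ => hρ.2.1)
  -- The points `h (1, T ρ)` tend to the end point, but the parameters `T ρ` might still run to the
  -- opposite end of the interval. This is a danger only if both end points are infinite, since then
  -- they coincide in the complex plane.
  have hTL : Tendsto T R L := by
    refine tendsto_iff_ultrafilter _ _ _ |>.2 fun U hU => ?_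
    have hV : ∀ᶠ t in U.map T, t ∈ realIoo a b :=
      (hT.filter_mono hU).mono fun ρ hρ => hρ.1
    have hVe : Tendsto (fun t => h (1, t)) (U.map T) (Setting.endPoint e) :=
      tendsto_map'_iff.2 (hTend.mono_left hU)
    have opposite : ∀ {e' : EReal} {L' : Filter ℝ}, IsEnd a b e' L' →
        (a = ⊥ → b = ⊤ → ∀ u : ℝ → ℝ, StrictAntiOn u (realIoo a b) →
          Tendsto T U L' → Tendsto (fun ρ => p + σ * ρ) U L →
          ¬ Tendsto (fun ρ => u (T ρ) - u (p + σ * ρ)) U (𝓝 0)) →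
        Disjoint (Setting.endPoint e') (Setting.endPoint e) ∨ (a = ⊥ ∧ b = ⊤) →
        ¬ ((U.map T : Ultrafilter ℝ) : Filter ℝ) ≤ L' := by
      intro e' L' he' hu hdis hle
      rcases hdis with hdis | ⟨h1, h2⟩
      · exact (((hD.tendsto_slice he' (s := 1) (by simp)).mono_left hle).not_tendsto hdis) hVe
      -- For the kernel of `w ∉ D`, curve and axis primitives agree asymptotically at the opposite
      -- end, and the crosscut links the curve primitive with the axis primitive near `L`. So the
      -- increments of `Im P'` between the two ends would tend to zero, against strict monotonicity.
      · obtain ⟨w, hwi, hwD⟩ := hw h1 h2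
        have hinf : ∀ {e : EReal} {L}, IsEnd a b e L → e = ⊤ ∨ e = ⊥ := fun he => by
          rcases he with ⟨rfl, -⟩ | ⟨rfl, -⟩ <;> simp [h1, h2]
        have hwi' : 0 < Complex.I.im := by simp
        obtain ⟨P', G', g', hG'⟩ := hD.exists_deformedPrimitive_kernelPair hwD hwi hwi'
        have h3 := (tendsto_kernel_primitive_sub hD he' (hinf he') hwD hwi' hG').comp
          (show Tendsto T U L' from hle)
        have h4 := (key hG' (endBound_kernelPair _ _ (hinf he))).mono_left hU
        have h5 := h4.sub h3
        rw [sub_zero] at h5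
        have h6 := (Complex.continuous_im.tendsto 0).comp h5
        refine hu h1 h2 _ (strictAntiOn_im_primitive_kernelPair hwi hwi' hG'.hasDerivAt_real) hle
          (hR.tendsto.mono_left hU) (h6.congr fun ρ => ?_)
        simp
    rcases leftFilter_or_rightFilter_of_ultrafilter hD.lt (U.map T) hV with ⟨x, hx, hVx⟩ | hVl
    · exact (hD.not_tendsto_endPoint he hx _ hVx hVe).elim
    · rcases he with ⟨rfl, rfl⟩ | ⟨rfl, rfl⟩
      · refine hVl.resolve_right (opposite (Or.inr ⟨rfl, rfl⟩) ?_ ?_)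
        · intro _ _ u hu h1 h2 h3
          refine false_of_tendsto_sub hD.lt hu h2 h1 (h3.neg.congr' ?_ |>.trans (by simp))
          exact Eventually.of_forall fun ρ => by simp
        · by_cases hinf : e = ⊥ ∧ b = ⊤
          · exact Or.inr hinf
          · exact Or.inl (LowerDeformation.disjoint_endPoint hD.lt hinf).symm
      · refine hVl.resolve_left (opposite (Or.inl ⟨rfl, rfl⟩) ?_ ?_)
        · intro _ _ u hu h1 h2 h3
          exact false_of_tendsto_sub hD.lt hu h1 h2 h3
        · by_cases hinf : a = ⊥ ∧ e = ⊤
          · exact Or.inr hinf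
          · exact Or.inl (LowerDeformation.disjoint_endPoint hD.lt hinf)
  have h1 := (hℓ.comp hTL).sub (key hG hf)
  rw [sub_zero] at h1
  exact h1.congr fun ρ => by simp

end

/-! ### Line integrals over the whole curve and independence of the deformation -/

section Integral

variable {a b : EReal}

theorem leftFilter_isCountablyGenerated (a : EReal) : (leftFilter a).IsCountablyGenerated := by
  unfold leftFilter; infer_instance

theorem rightFilter_isCountablyGenerated (b : EReal) : (rightFilter b).IsCountablyGenerated := by
  unfold rightFilter; infer_instance

theorem tendsto_setIntegral_of_eventually {φ : ℝ → ℂ} {s : Set ℝ}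
    (hφ : IntegrableOn φ s) {F : Filter ℝ} [F.IsCountablyGenerated] {A : ℝ → Set ℝ}
    (hsm : MeasurableSet s) (hA : ∀ t, MeasurableSet (A t))
    (hs : ∀ᶠ t in F, A t ⊆ s) (hx : ∀ x ∈ s, ∀ᶠ t in F, x ∈ A t) :
    Tendsto (fun t => ∫ x in A t, φ x) F (𝓝 (∫ x in s, φ x)) := by
  have h1 : Tendsto (fun t => ∫ x, (A t).indicator (s.indicator φ) x) F
      (𝓝 (∫ x, s.indicator φ x)) := by
    refine tendsto_integral_filter_of_dominated_convergence (fun x => ‖s.indicator φ x‖) ?_ ?_ ?_ ?_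
    · exact Eventually.of_forall fun t =>
        ((integrable_indicator_iff hsm).2 hφ).aestronglyMeasurable.indicator (hA t)
    · exact Eventually.of_forall fun t => Eventually.of_forall fun x =>
        norm_indicator_le_norm_self _ _
    · exact ((integrable_indicator_iff hsm).2 hφ).norm
    · refine Eventually.of_forall fun x => ?_
      by_cases hxs : x ∈ s
      · refine tendsto_const_nhds.congr' ?_
        filter_upwards [hx x hxs] with t ht
        rw [indicator_of_mem ht]
      · refine tendsto_const_nhds.congr fun t => ?_
        by_cases ht : x ∈ A t
        · rw [indicator_of_mem ht]
        · rw [indicator_of_notMem ht, indicator_of_notMem hxs]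
  rw [integral_indicator hsm] at h1
  refine h1.congr' ?_
  filter_upwards [hs] with t ht
  rw [integral_indicator (hA t), setIntegral_congr_fun (hA t)]
  exact fun x hx => indicator_of_mem (ht hx) φ

/-- The integral along a curve is the difference of the limits of a primitive. -/
theorem exists_tendsto_primitive_curve {D : Set ℂ} (hab : a < b) (hD : IsOpen D) {c : ℝ → ℂ}
    {k : NNReal} (hc : LipschitzOnWith k c (realIoo a b)) (hcD : MapsTo c (realIoo a b) D)
    {f G : ℂ → ℂ} (hG : ∀ z ∈ D, HasDerivAt G (f z) z)
    (hint : IntegrableOn (fun t => deriv c t * f (c t)) (realIoo a b)) :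
    ∃ ℓ ℓ' : ℂ, Tendsto (fun t => G (c t)) (leftFilter a) (𝓝 ℓ) ∧
      Tendsto (fun t => G (c t)) (rightFilter b) (𝓝 ℓ') ∧
      ∫ t in realIoo a b, deriv c t * f (c t) = ℓ' - ℓ := by
  obtain ⟨t₀, ht₀⟩ := nonempty_realIoo hab
  have hm : MeasurableSet (realIoo a b) := (isOpen_realIoo a b).measurableSet
  have ftc : ∀ u ∈ realIoo a b, ∀ v ∈ realIoo a b, u ≤ v →
      ∫ t in Ioc u v, deriv c t * f (c t) = G (c v) - G (c u) := by
    intro u hu v hv huv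
    have hsub : Icc u v ⊆ realIoo a b := (ordConnected_realIoo a b).out hu hv
    rw [← intervalIntegral.integral_of_le huv]
    exact integral_deriv_mul_comp huv (hc.mono hsub) hD hG (hcD.mono_left hsub)
  have := leftFilter_isCountablyGenerated a
  have := rightFilter_isCountablyGenerated b
  have h1 := tendsto_setIntegral_of_eventually (F := leftFilter a) (A := fun t => Ioc t t₀)
    (hint.mono_set (inter_subset_left (t := Iic t₀))) (hm.inter measurableSet_Iic)
    (fun t => measurableSet_Ioc)
    ((eventually_leftFilter hab).2 ⟨t₀, ht₀, fun t ht _ x hx =>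
      ⟨(ordConnected_realIoo a b).out ht ht₀ ⟨hx.1.le, hx.2⟩, hx.2⟩⟩)
    (fun x hx => by
      obtain ⟨r, hr1, hr2⟩ := EReal.lt_iff_exists_real_btwn.1 hx.1.1
      exact (eventually_leftFilter hab).2 ⟨r, ⟨hr1, hr2.trans hx.1.2⟩, fun t _ ht =>
        ⟨lt_of_le_of_lt ht (by exact_mod_cast hr2), hx.2⟩⟩)
  have h2 := tendsto_setIntegral_of_eventually (F := rightFilter b) (A := fun t => Ioc t₀ t)
    (hint.mono_set (inter_subset_left (t := Ioi t₀))) (hm.inter measurableSet_Ioi)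
    (fun t => measurableSet_Ioc)
    ((eventually_rightFilter hab).2 ⟨t₀, ht₀, fun t ht _ x hx =>
      ⟨(ordConnected_realIoo a b).out ht₀ ht ⟨hx.1.le, hx.2⟩, hx.1⟩⟩)
    (fun x hx => (eventually_rightFilter hab).2 ⟨x, hx.1, fun t _ ht => ⟨hx.2, ht⟩⟩)
  refine ⟨_, _, (tendsto_const_nhds (x := G (c t₀)).sub h1).congr' ?_,
    (tendsto_const_nhds (x := G (c t₀)).add h2).congr' ?_, ?_⟩
  · refine (eventually_leftFilter hab).2 ⟨t₀, ht₀, fun t ht htt => ?_⟩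
    simp only [ftc t ht t₀ ht₀ htt]; ring
  · refine (eventually_rightFilter hab).2 ⟨t₀, ht₀, fun t ht htt => ?_⟩
    simp only [ftc t₀ ht₀ t ht htt]; ring
  · have h3 := setIntegral_union (f := fun t => deriv c t * f (c t)) (μ := volume)
      (s := realIoo a b ∩ Iic t₀) (t := realIoo a b ∩ Ioi t₀)
      (disjoint_left.2 fun x hx hx' => not_le.2 (show t₀ < x from hx'.2) hx.2)
      (hm.inter measurableSet_Ioi) (hint.mono_set inter_subset_left)
      (hint.mono_set inter_subset_left)
    rw [← inter_union_distrib_left, Iic_union_Ioi, inter_univ] at h3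
    rw [h3]; ring

/-- The integral of `f` is the same along two deformations of the interval. -/
theorem integral_eq_of_lowerDeformation {D : Set ℂ} {h h' : ℝ × ℝ → ℂ}
    (hD : LowerDeformation a b D h) (hD' : LowerDeformation a b D h')
    (hw : a = ⊥ → b = ⊤ → ∃ w : ℂ, w.im < 0 ∧ w ∉ D) {f : ℂ → ℂ} (hfD : DifferentiableOn ℂ f D)
    (hfI : ∀ t ∈ realIoo a b, AnalyticAt ℂ f t) (hfa : EndBound D f a) (hfb : EndBound D f b)
    {c c' : ℝ → ℂ} {k k' : NNReal} (hc : LipschitzOnWith k c (realIoo a b))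
    (hc' : LipschitzOnWith k' c' (realIoo a b)) (hhc : ∀ t ∈ realIoo a b, h (1, t) = c t)
    (hhc' : ∀ t ∈ realIoo a b, h' (1, t) = c' t)
    (hint : IntegrableOn (fun t => deriv c t * f (c t)) (realIoo a b))
    (hint' : IntegrableOn (fun t => deriv c' t * f (c' t)) (realIoo a b)) :
    ∫ t in realIoo a b, deriv c t * f (c t) = ∫ t in realIoo a b, deriv c' t * f (c' t) := by
  obtain ⟨P, hP⟩ := exists_primitive_real hD.lt (f := f) fun t ht => (hfI t ht).continuousAt
  have hl : IsEnd a b a (leftFilter a) := Or.inl ⟨rfl, rfl⟩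
  have hr : IsEnd a b b (rightFilter b) := Or.inr ⟨rfl, rfl⟩
  obtain ⟨p, σ, R, hR⟩ := exists_endCircles hD.lt hl
  obtain ⟨p', σ', R', hR'⟩ := exists_endCircles hD.lt hr
  -- The curves are not compared with each other: each integral is the limit of the increments of
  -- one and the same real primitive `P` between points that tend to the end points.
  have main : ∀ {h : ℝ × ℝ → ℂ} {c : ℝ → ℂ} {k : NNReal}, LowerDeformation a b D h →
      LipschitzOnWith k c (realIoo a b) → (∀ t ∈ realIoo a b, h (1, t) = c t) →
      IntegrableOn (fun t => deriv c t * f (c t)) (realIoo a b) →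
      Tendsto (fun q : ℝ × ℝ => P (p' + σ' * q.2) - P (p + σ * q.1)) (R ×ˢ R')
        (𝓝 (∫ t in realIoo a b, deriv c t * f (c t))) := by
    intro h c k hD hc hhc hint
    obtain ⟨G, g, hG⟩ := hD.exists_deformedPrimitive hfD hfI hP
    have hcD : MapsTo c (realIoo a b) D := fun t ht => by
      rw [← hhc t ht]; exact hD.mem 1 (by simp) t ht
    obtain ⟨ℓ, ℓ', h1, h2, h3⟩ := exists_tendsto_primitive_curve hD.lt hD.isOpen hc hcD
      hG.hasDerivAt hint
    rw [h3]
    have h4 := hR.tendsto_primitive hl hD hw hG hfa (h1.congr'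
      ((hl.eventually_mem hD.lt).mono fun t ht => by simp only [hhc t ht]))
    have h5 := hR'.tendsto_primitive hr hD hw hG hfb (h2.congr'
      ((hr.eventually_mem hD.lt).mono fun t ht => by simp only [hhc t ht]))
    exact (h5.comp tendsto_snd).sub (h4.comp tendsto_fst)
  have := hR.neBot
  have := hR'.neBot
  exact tendsto_nhds_unique (main hD hc hhc hint) (main hD' hc' hhc' hint')

end Integral

/-! ### Resolvents of self-adjoint operators under bounded perturbation -/

section Operators

variable {H : Type*} [NormedAddCommGroup H] [InnerProductSpace ℂ H]

theorem addBounded_apply (T : H →ₗ.[ℂ] H) (X : H →L[ℂ] H) (x : (addBounded T X).domain) :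
    addBounded T X x = X x + T ⟨x, x.2⟩ := rfl

theorem addBounded_addBounded (T : H →ₗ.[ℂ] H) (X Y : H →L[ℂ] H) :
    addBounded (addBounded T X) Y = addBounded T (Y + X) := by
  unfold addBounded
  rw [← add_vadd]
  rfl

theorem addBounded_zero (T : H →ₗ.[ℂ] H) : addBounded T 0 = T := by
  unfold addBounded
  exact zero_vadd _ T

theorem shift_addBounded (T : H →ₗ.[ℂ] H) (X : H →L[ℂ] H) (z : ℂ) :
    shift (addBounded T X) z = addBounded T (X - z • 1) := by
  rw [shift, addBounded_addBounded]
  congr 1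
  abel

theorem shift_shift (T : H →ₗ.[ℂ] H) (z w : ℂ) :
    shift T w = addBounded (shift T z) ((z - w) • 1) := by
  rw [shift, shift, addBounded_addBounded]
  congr 1
  module

theorem addBounded_mono {S T : H →ₗ.[ℂ] H} (h : S ≤ T) (X : H →L[ℂ] H) :
    addBounded S X ≤ addBounded T X := by
  refine ⟨h.1, fun x y hxy => ?_⟩
  exact congrArg₂ (· + ·) (congrArg X hxy) (h.2 hxy)

theorem IsBoundedInverse.unique {T : H →ₗ.[ℂ] H} {R R' : H →L[ℂ] H} (h : IsBoundedInverse T R)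
    (h' : IsBoundedInverse T R') : R = R' := by
  ext y
  obtain ⟨hy, e⟩ := h'.2 y
  conv_lhs => rw [← e]
  exact h.1 ⟨R' y, hy⟩

theorem IsBoundedInverse.boundedInverse_eq {T : H →ₗ.[ℂ] H} {R : H →L[ℂ] H}
    (h : IsBoundedInverse T R) : boundedInverse T = R := by
  have h0 : ∃ R, IsBoundedInverse T R := ⟨R, h⟩
  rw [boundedInverse, dif_pos h0]
  exact h0.choose_spec.unique h

theorem isBoundedInverse_boundedInverse {T : H →ₗ.[ℂ] H} (h : ∃ R, IsBoundedInverse T R) :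
    IsBoundedInverse T (boundedInverse T) := by
  rw [boundedInverse, dif_pos h]
  exact h.choose_spec

theorem isBoundedInverse_resolventOp {T : H →ₗ.[ℂ] H} {z : ℂ} (h : z ∉ spec T) :
    IsBoundedInverse (shift T z) (resolventOp T z) :=
  isBoundedInverse_boundedInverse (not_not.1 h)

/-- Perturbation of an invertible operator by a bounded one. -/
theorem IsBoundedInverse.addBounded {T : H →ₗ.[ℂ] H} {R X : H →L[ℂ] H} (h : IsBoundedInverse T R)
    (hU : IsUnit (1 + X * R)) :
    IsBoundedInverse (addBounded T X) (R * Ring.inverse (1 + X * R)) := by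
  have e1 := Ring.inverse_mul_cancel _ hU
  have e2 := Ring.mul_inverse_cancel _ hU
  set V := Ring.inverse (1 + X * R) with hV
  refine ⟨fun x => ?_, fun y => ?_⟩
  · have h1 := h.1 ⟨x, x.2⟩
    set w := T ⟨x, x.2⟩ with hw
    rw [addBounded_apply, ← hw]
    have h2 : X x + w = (1 + X * R) w := by simp [h1, add_comm]
    have h3 : V ((1 + X * R) w) = w := DFunLike.congr_fun e1 w
    rw [h2, mul_apply_eq_comp, h3, h1]
  · obtain ⟨hy, e⟩ := h.2 (V y)
    refine ⟨hy, ?_⟩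
    rw [addBounded_apply]
    have h3 : (1 + X * R) (V y) = y := DFunLike.congr_fun e2 y
    calc X ((R * V) y) + T ⟨R (V y), hy⟩ = (1 + X * R) (V y) := by
          rw [e]; simp [add_comm]
      _ = y := h3

/-- The second resolvent identity. -/
theorem IsBoundedInverse.sub_eq {T : H →ₗ.[ℂ] H} {X Y R R' : H →L[ℂ] H}
    (h : IsBoundedInverse (Feshbach.addBounded T X) R)
    (h' : IsBoundedInverse (Feshbach.addBounded T Y) R') : R - R' = R * (Y - X) * R' := by
  ext y
  obtain ⟨hy, e⟩ := h'.2 y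
  have h1 := h.1 ⟨R' y, hy⟩
  rw [addBounded_apply] at h1 e
  simp only [mul_apply_eq_comp, sub_apply, map_sub]
  have e' := congrArg R e
  simp only [map_add] at h1 e'
  linear_combination (norm := module) h1 - e'

theorem resolvent_sub {T : H →ₗ.[ℂ] H} {X Y R R' : H →L[ℂ] H} {z w : ℂ}
    (h : IsBoundedInverse (shift (addBounded T X) z) R)
    (h' : IsBoundedInverse (shift (addBounded T Y) w) R') :
    R - R' = R * (Y - X + (z - w) • 1) * R' := by
  rw [shift_addBounded] at h h'
  rw [h.sub_eq h']
  congr 2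
  module

theorem resolvent_sub_of_shift {T : H →ₗ.[ℂ] H} {R R' : H →L[ℂ] H} {z w : ℂ}
    (h : IsBoundedInverse (shift T z) R) (h' : IsBoundedInverse (shift T w) R') :
    R - R' = (z - w) • (R * R') := by
  rw [← addBounded_zero T] at h h'
  rw [resolvent_sub h h']
  simp

theorem resolvent_commute {T : H →ₗ.[ℂ] H} {R R' : H →L[ℂ] H} {z w : ℂ}
    (h : IsBoundedInverse (shift T z) R) (h' : IsBoundedInverse (shift T w) R') :
    Commute R R' := by
  rcases eq_or_ne z w with rfl | hzw
  · rw [h.unique h']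
  · have h1 := resolvent_sub_of_shift h h'
    have h2 := resolvent_sub_of_shift h' h
    have h3 : (z - w) • (R * R') = (z - w) • (R' * R) := by
      rw [← h1, ← neg_sub, h2, ← neg_smul, neg_sub]
    exact smul_right_injective _ (sub_ne_zero.2 hzw) h3

theorem eventually_isBoundedInverse_shift [CompleteSpace H] {T : H →ₗ.[ℂ] H} {R : H →L[ℂ] H} {z : ℂ}
    (h : IsBoundedInverse (shift T z) R) :
    ∀ᶠ w in 𝓝 z, IsBoundedInverse (shift T w) (R * Ring.inverse (1 + ((z - w) • 1) * R)) := by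
  have hc : ContinuousAt (fun w : ℂ => 1 + ((z - w) • (1 : H →L[ℂ] H)) * R) z := by fun_prop
  have h1 : ∀ᶠ w in 𝓝 z, IsUnit (1 + ((z - w) • (1 : H →L[ℂ] H)) * R) :=
    hc.eventually_mem (Units.isOpen.mem_nhds (by simp))
  filter_upwards [h1] with w hw
  rw [shift_shift T z w]
  exact h.addBounded hw

theorem differentiableAt_resolventOp [CompleteSpace H] {T : H →ₗ.[ℂ] H} {z : ℂ} (hz : z ∉ spec T) :
    DifferentiableAt ℂ (resolventOp T) z := by
  have h1 := eventually_isBoundedInverse_shift (isBoundedInverse_resolventOp hz)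
  have h2 : DifferentiableAt ℂ (fun w => resolventOp T z *
      Ring.inverse (1 + ((z - w) • (1 : H →L[ℂ] H)) * resolventOp T z)) z := by
    refine (differentiableAt_const _).mul ?_
    have hu : IsUnit (1 + ((z - z) • (1 : H →L[ℂ] H)) * resolventOp T z) := by simp
    exact DifferentiableAt.comp z (g := Ring.inverse)
      (f := fun w : ℂ => 1 + ((z - w) • (1 : H →L[ℂ] H)) * resolventOp T z)
      (differentiableAt_inverse (𝕜 := ℂ) hu) (by fun_prop)
  exact h2.congr_of_eventuallyEq (h1.mono fun w hw => hw.boundedInverse_eq)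

section Adjoint

variable [CompleteSpace H]

theorem IsBoundedInverse.adjoint {T : H →ₗ.[ℂ] H} {R : H →L[ℂ] H} (hT : Dense (T.domain : Set H))
    (h : IsBoundedInverse T R) :
    IsBoundedInverse T.adjoint (ContinuousLinearMap.adjoint R) := by
  refine ⟨fun x => ?_, fun y => ?_⟩
  · refine ext_inner_right ℂ fun y => ?_
    obtain ⟨hy, e⟩ := h.2 y
    rw [ContinuousLinearMap.adjoint_inner_left, T.adjoint_isFormalAdjoint hT x ⟨R y, hy⟩, e]
  · have h1 : ∀ x : T.domain, inner ℂ y (x : H) =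
        inner ℂ (ContinuousLinearMap.adjoint R y) (T x) := fun x => by
      rw [ContinuousLinearMap.adjoint_inner_left, h.1 x]
    refine ⟨T.mem_adjoint_domain_of_exists _ ⟨y, h1⟩, ?_⟩
    exact T.adjoint_apply_eq hT _ h1

theorem addBounded_adjoint_le {T : H →ₗ.[ℂ] H} (hT : Dense (T.domain : Set H)) (X : H →L[ℂ] H) :
    addBounded T.adjoint (ContinuousLinearMap.adjoint X) ≤ (addBounded T X).adjoint := by
  refine LinearPMap.IsFormalAdjoint.le_adjoint hT fun x y => ?_
  rw [addBounded_apply, addBounded_apply, inner_add_left, inner_add_right,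
    ← ContinuousLinearMap.adjoint_inner_right]
  exact congrArg _ ((T.adjoint_isFormalAdjoint hT).symm _ _)

/-- The missing inclusion is the known one for the perturbed operator and `-X`, after adding the
adjoint of `X` back. -/
theorem adjoint_addBounded {T : H →ₗ.[ℂ] H} (hT : Dense (T.domain : Set H)) (X : H →L[ℂ] H) :
    (addBounded T X).adjoint = addBounded T.adjoint (ContinuousLinearMap.adjoint X) := by
  refine le_antisymm ?_ (addBounded_adjoint_le hT X)
  have h1 := addBounded_adjoint_le (T := addBounded T X) hT (-X)
  rw [addBounded_addBounded, neg_add_cancel, addBounded_zero, map_neg] at h1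
  have h2 := addBounded_mono h1 (ContinuousLinearMap.adjoint X)
  rwa [addBounded_addBounded, add_neg_cancel, addBounded_zero] at h2

theorem adjoint_shift {T : H →ₗ.[ℂ] H} (hT : Dense (T.domain : Set H)) (z : ℂ) :
    (shift T z).adjoint = shift T.adjoint (conj z) := by
  rw [shift, adjoint_addBounded hT, shift]
  congr 1
  rw [map_neg, ContinuousLinearMap.adjoint.map_smulₛₗ]
  congr 2
  exact ContinuousLinearMap.adjoint_id

theorem IsBoundedInverse.shift_adjoint {T : H →ₗ.[ℂ] H} {R : H →L[ℂ] H} {z : ℂ}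
    (hT : Dense (T.domain : Set H)) (h : IsBoundedInverse (shift T z) R) :
    IsBoundedInverse (shift T.adjoint (conj z)) (ContinuousLinearMap.adjoint R) := by
  rw [← adjoint_shift hT]
  exact IsBoundedInverse.adjoint hT h

variable {A : H →ₗ.[ℂ] H}

theorem resolventOp_conj {X : H →L[ℂ] H} {z : ℂ} (hA : IsSelfAdjoint A)
    (hz : z ∉ spec (addBounded A X)) :
    IsBoundedInverse (shift (addBounded A (ContinuousLinearMap.adjoint X)) (conj z))
      (ContinuousLinearMap.adjoint (resolventOp (addBounded A X) z)) := by
  have h1 := IsBoundedInverse.shift_adjoint (T := addBounded A X) hA.dense_domain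
    (isBoundedInverse_resolventOp hz)
  rwa [adjoint_addBounded hA.dense_domain, LinearPMap.isSelfAdjoint_def.1 hA] at h1

/-- If the resolvent `Q` at `z + μ⁻¹` existed, `μ⁻¹ (1 + μ⁻¹ Q)` would be an explicit inverse of `μ
- R`. -/
theorem mem_spec_of_mem_spectrum {T : H →ₗ.[ℂ] H} {R : H →L[ℂ] H} {z μ : ℂ}
    (h : IsBoundedInverse (shift T z) R) (hμ : μ ≠ 0) (hμR : μ ∈ spectrum ℂ R) :
    z + μ⁻¹ ∈ spec T := by
  by_contra hw
  have hQ := isBoundedInverse_resolventOp hw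
  set Q := resolventOp T (z + μ⁻¹)
  have h1 := resolvent_sub_of_shift h hQ
  have hcomm : Commute R Q := resolvent_commute h hQ
  rw [show z - (z + μ⁻¹) = -μ⁻¹ by ring] at h1
  refine hμR (spectrum.mem_resolventSet_iff.2 ?_)
  rw [isUnit_iff_exists]
  refine ⟨μ⁻¹ • (1 + μ⁻¹ • Q), ?_, ?_⟩
  · simp only [Algebra.algebraMap_eq_smul_one, sub_mul, mul_add, mul_one, one_mul, smul_mul_assoc,
      mul_smul_comm]
    linear_combination (norm := (match_scalars <;> field_simp <;> ring)) (-μ⁻¹) • h1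
  · simp only [Algebra.algebraMap_eq_smul_one, mul_sub, add_mul, mul_one, one_mul, smul_mul_assoc,
      mul_smul_comm, hcomm.eq.symm]
    linear_combination (norm := (match_scalars <;> field_simp <;> ring)) (-μ⁻¹) • h1

theorem notMem_of_infDist_pos {s : Set ℂ} {z : ℂ} (h : 0 < Metric.infDist z s) : z ∉ s :=
  fun hz => by simp [Metric.infDist_zero_of_mem hz] at h

/-- The resolvent commutes with its adjoint, the resolvent at the conjugate point, so it is normal
and its norm is its spectral radius. A spectral value `μ` of maximal modulus yields the point `z +
μ⁻¹` of the spectrum, at distance `‖R‖⁻¹` from `z`. -/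
theorem norm_resolventOp_le {z : ℂ} (hA : IsSelfAdjoint A) (hz : 0 < Metric.infDist z (spec A)) :
    ‖resolventOp A z‖ ≤ (Metric.infDist z (spec A))⁻¹ := by
  have hR := isBoundedInverse_resolventOp (notMem_of_infDist_pos hz)
  set R := resolventOp A z with hRdef
  rcases subsingleton_or_nontrivial H with hH | hH
  · have : R = 0 := by ext x; exact Subsingleton.elim _ _
    rw [this, norm_zero]; positivity
  rcases eq_or_ne R 0 with h0 | h0
  · rw [h0, norm_zero]; positivity
  have hadj : IsBoundedInverse (shift A (conj z)) (star R) := by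
    have := IsBoundedInverse.shift_adjoint hA.dense_domain hR
    rwa [LinearPMap.isSelfAdjoint_def.1 hA] at this
  have hn : IsStarNormal R := ⟨resolvent_commute hadj hR⟩
  obtain ⟨μ, hμ, hμn⟩ := spectrum.exists_nnnorm_eq_spectralRadius R
  rw [IsStarNormal.spectralRadius_eq_nnnorm, ENNReal.coe_inj] at hμn
  have hμn' : ‖μ‖ = ‖R‖ := congrArg NNReal.toReal hμn
  have hμ0 : μ ≠ 0 := norm_pos_iff.1 (hμn' ▸ norm_pos_iff.2 h0)
  have h1 := Metric.infDist_le_dist_of_mem (x := z) (mem_spec_of_mem_spectrum hR hμ0 hμ)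
  rw [dist_eq_norm, sub_add_cancel_left, norm_neg, norm_inv, hμn'] at h1
  exact (le_inv_comm₀ hz (norm_pos_iff.2 h0)).1 h1

variable {X : H →L[ℂ] H} {z : ℂ}

theorem notMem_spec_addBounded (hA : IsSelfAdjoint A) (hX : ‖X‖ < Metric.infDist z (spec A)) :
    z ∉ spec (addBounded A X) := by
  have hz : 0 < Metric.infDist z (spec A) := (norm_nonneg X).trans_lt hX
  have hR := isBoundedInverse_resolventOp (notMem_of_infDist_pos hz)
  have h1 : ‖-(X * resolventOp A z)‖ < 1 := by
    rw [norm_neg]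
    calc ‖X * resolventOp A z‖ ≤ ‖X‖ * ‖resolventOp A z‖ := norm_mul_le _ _
      _ ≤ ‖X‖ * (Metric.infDist z (spec A))⁻¹ := by
          gcongr; exact norm_resolventOp_le hA hz
      _ < 1 := by rw [← div_eq_mul_inv, div_lt_one hz]; exact hX
  have h2 : IsUnit (1 + X * resolventOp A z) := by
    rw [← sub_neg_eq_add]; exact (Units.oneSub _ h1).isUnit
  have h3 := hR.addBounded h2
  refine not_not.2 ⟨resolventOp A z * Ring.inverse (1 + X * resolventOp A z), ?_⟩
  rw [shift, addBounded_addBounded] at h3 ⊢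
  rwa [add_comm] at h3

theorem norm_resolventOp_addBounded_le (hA : IsSelfAdjoint A)
    (hX : ‖X‖ < Metric.infDist z (spec A)) :
    ‖resolventOp (addBounded A X) z‖ ≤ (Metric.infDist z (spec A) - ‖X‖)⁻¹ := by
  have hz : 0 < Metric.infDist z (spec A) := (norm_nonneg X).trans_lt hX
  have hR := isBoundedInverse_resolventOp (notMem_of_infDist_pos hz)
  have hR' := isBoundedInverse_resolventOp (notMem_spec_addBounded hA hX)
  have hb := norm_resolventOp_le hA hz
  rw [← addBounded_zero A] at hR
  have h1 := resolvent_sub hR' hR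
  rw [addBounded_zero, sub_self, zero_smul, add_zero, zero_sub] at h1
  set Q := resolventOp (addBounded A X) z
  set R := resolventOp A z
  set δ := Metric.infDist z (spec A)
  have h2 : ‖Q‖ ≤ ‖R‖ + ‖Q‖ * ‖X‖ * ‖R‖ := by
    calc ‖Q‖ = ‖R + Q * -X * R‖ := by rw [← h1]; congr 1; abel
      _ ≤ ‖R‖ + ‖Q * -X * R‖ := norm_add_le _ _
      _ ≤ ‖R‖ + ‖Q‖ * ‖X‖ * ‖R‖ := by
        gcongr
        refine (norm_mul_le _ _).trans ?_
        gcongr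
        refine (norm_mul_le _ _).trans ?_
        rw [norm_neg]
  have h3 : ‖Q‖ ≤ (1 + ‖Q‖ * ‖X‖) * δ⁻¹ := by
    calc ‖Q‖ ≤ (1 + ‖Q‖ * ‖X‖) * ‖R‖ := by linarith
      _ ≤ _ := by gcongr
  rw [← div_eq_mul_inv, le_div_iff₀ hz] at h3
  rw [← one_div, le_div_iff₀ (sub_pos.2 hX)]
  linarith

theorem differentiableOn_resolventOp_addBounded (hA : IsSelfAdjoint A) :
    DifferentiableOn ℂ (resolventOp (addBounded A X)) {z | ‖X‖ < Metric.infDist z (spec A)} :=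
  fun _ hz => (differentiableAt_resolventOp
    (notMem_spec_addBounded hA hz)).differentiableWithinAt

end Adjoint

end Operators

/-! ### The fixed point equations and the operator `Ω` for a single curve -/

variable {H : Type*} [NormedAddCommGroup H] [InnerProductSpace ℂ H] [CompleteSpace H]

/-- A curve `c` at distance at least `d` from the spectrum of the self-adjoint operator `A` and an
operator density `κ` along it whose total variation is less than `d ^ 2 / 4`. -/
structure ResolventKernel (A : H →ₗ.[ℂ] H) (I : Set ℝ) (c : ℝ → ℂ) (κ : ℝ → H →L[ℂ] H) (d : ℝ) :
    Prop where
  isSelfAdjoint : IsSelfAdjoint A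
  isOpen : IsOpen I
  nonempty : I.Nonempty
  continuousOn : ContinuousOn c I
  integrableOn : IntegrableOn κ I
  le_infDist : ∀ t ∈ I, d ≤ Metric.infDist (c t) (spec A)
  pos : 0 < d
  variation_lt : ∫ t in I, ‖κ t‖ < d ^ 2 / 4

namespace ResolventKernel

variable {A : H →ₗ.[ℂ] H} {I : Set ℝ} {c : ℝ → ℂ} {κ : ℝ → H →L[ℂ] H} {d : ℝ}

theorem notMem_spec (hK : ResolventKernel A I c κ d) {X : H →L[ℂ] H} (hX : ‖X‖ < d) {t : ℝ}
    (ht : t ∈ I) : c t ∉ spec (addBounded A X) :=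
  notMem_spec_addBounded hK.isSelfAdjoint (hX.trans_le (hK.le_infDist t ht))

theorem isBoundedInverse (hK : ResolventKernel A I c κ d) {X : H →L[ℂ] H} (hX : ‖X‖ < d) {t : ℝ}
    (ht : t ∈ I) :
    IsBoundedInverse (shift (addBounded A X) (c t)) (resolventOp (addBounded A X) (c t)) :=
  isBoundedInverse_resolventOp (hK.notMem_spec hX ht)

theorem norm_resolventOp_le (hK : ResolventKernel A I c κ d) {X : H →L[ℂ] H} (hX : ‖X‖ < d)
    {t : ℝ} (ht : t ∈ I) : ‖resolventOp (addBounded A X) (c t)‖ ≤ (d - ‖X‖)⁻¹ := by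
  have h1 := hK.le_infDist t ht
  refine (norm_resolventOp_addBounded_le hK.isSelfAdjoint (hX.trans_le h1)).trans ?_
  have : 0 < d - ‖X‖ := sub_pos.2 hX
  gcongr

theorem continuousOn_resolventOp (hK : ResolventKernel A I c κ d) {X : H →L[ℂ] H} (hX : ‖X‖ < d) :
    ContinuousOn (fun t => resolventOp (addBounded A X) (c t)) I :=
  (differentiableOn_resolventOp_addBounded hK.isSelfAdjoint).continuousOn.comp hK.continuousOn
    fun t ht => hX.trans_le (hK.le_infDist t ht)

theorem integrableOn_mul (hK : ResolventKernel A I c κ d) {L M : ℝ → H →L[ℂ] H} {l m : ℝ}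
    (hL : ContinuousOn L I) (hM : ContinuousOn M I) (hl : ∀ t ∈ I, ‖L t‖ ≤ l)
    (hm : ∀ t ∈ I, ‖M t‖ ≤ m) : IntegrableOn (fun t => L t * κ t * M t) I := by
  have hI := hK.isOpen.measurableSet
  refine Integrable.mono' ((hK.integrableOn.norm.const_mul l).mul_const m) ?_ ?_
  · exact ((hL.aestronglyMeasurable hI).mul hK.integrableOn.aestronglyMeasurable).mul
      (hM.aestronglyMeasurable hI)
  · refine (ae_restrict_mem hI).mono fun t ht => ?_
    have := hl t ht
    have := hm t ht
    have hl0 : 0 ≤ l := (norm_nonneg _).trans (hl t ht)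
    calc ‖L t * κ t * M t‖ ≤ ‖L t * κ t‖ * ‖M t‖ := norm_mul_le _ _
      _ ≤ ‖L t‖ * ‖κ t‖ * ‖M t‖ := by gcongr; exact norm_mul_le _ _
      _ ≤ l * ‖κ t‖ * m := by gcongr

theorem norm_integral_mul_le (hK : ResolventKernel A I c κ d) {L M : ℝ → H →L[ℂ] H} {l m : ℝ}
    (hl : ∀ t ∈ I, ‖L t‖ ≤ l) (hm : ∀ t ∈ I, ‖M t‖ ≤ m) :
    ‖∫ t in I, L t * κ t * M t‖ ≤ l * (∫ t in I, ‖κ t‖) * m := by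
  have hI := hK.isOpen.measurableSet
  rw [← integral_const_mul, ← integral_mul_const]
  refine norm_integral_le_of_norm_le ((hK.integrableOn.norm.const_mul l).mul_const m) ?_
  refine (ae_restrict_mem hI).mono fun t ht => ?_
  have := hl t ht
  have := hm t ht
  have hl0 : 0 ≤ l := (norm_nonneg _).trans (hl t ht)
  calc ‖L t * κ t * M t‖ ≤ ‖L t * κ t‖ * ‖M t‖ := norm_mul_le _ _
    _ ≤ ‖L t‖ * ‖κ t‖ * ‖M t‖ := by gcongr; exact norm_mul_le _ _
    _ ≤ l * ‖κ t‖ * m := by gcongr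

/-- The kernel of the adjoint operators. -/
theorem adjoint (hK : ResolventKernel A I c κ d) :
    ResolventKernel A I (fun t => conj (c t)) (fun t => star (κ t)) d where
  isSelfAdjoint := hK.isSelfAdjoint
  isOpen := hK.isOpen
  nonempty := hK.nonempty
  continuousOn := Complex.continuous_conj.comp_continuousOn hK.continuousOn
  integrableOn := by
    refine Integrable.mono hK.integrableOn (continuous_star.comp_aestronglyMeasurable
      hK.integrableOn.aestronglyMeasurable) (Eventually.of_forall fun t => ?_)
    rw [norm_star]
  le_infDist := fun t ht => by
    refine (hK.le_infDist t ht).trans ?_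
    -- The distance to the empty set is `0` by convention, so the positive lower bound `d` excludes
    -- an empty spectrum.
    have hne : (spec A).Nonempty := by
      by_contra h
      have h1 := hK.le_infDist t ht
      rw [not_nonempty_iff_eq_empty.1 h, Metric.infDist_empty] at h1
      exact absurd hK.pos (not_lt.2 h1)
    refine (Metric.le_infDist hne).2 fun y hy => ?_
    have hy' : conj y ∈ spec A := by
      intro hy'
      have hn : conj y ∉ spec A := not_not.2 hy'
      rw [← addBounded_zero A] at hn
      have h2 := resolventOp_conj hK.isSelfAdjoint hn
      rw [map_zero, addBounded_zero, Complex.conj_conj] at h2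
      exact hy ⟨_, h2⟩
    refine (Metric.infDist_le_dist_of_mem hy').trans_eq ?_
    rw [Complex.dist_conj_comm]
  pos := hK.pos
  variation_lt := by simpa only [norm_star] using hK.variation_lt

/-- The right transformator `X ↦ - ∫ κ (A + X - c)⁻¹`. -/
def rightMap (A : H →ₗ.[ℂ] H) (I : Set ℝ) (c : ℝ → ℂ) (κ : ℝ → H →L[ℂ] H) (X : H →L[ℂ] H) :
    H →L[ℂ] H :=
  -∫ t in I, κ t * resolventOp (addBounded A X) (c t)

/-- The left transformator `X ↦ - ∫ (A + X - c)⁻¹ κ`. -/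
def leftMap (A : H →ₗ.[ℂ] H) (I : Set ℝ) (c : ℝ → ℂ) (κ : ℝ → H →L[ℂ] H) (X : H →L[ℂ] H) :
    H →L[ℂ] H :=
  -∫ t in I, resolventOp (addBounded A X) (c t) * κ t

theorem integrableOn_rightMap (hK : ResolventKernel A I c κ d) {X : H →L[ℂ] H} (hX : ‖X‖ < d) :
    IntegrableOn (fun t => κ t * resolventOp (addBounded A X) (c t)) I := by
  have := hK.integrableOn_mul (L := fun _ => 1) continuousOn_const
    (hK.continuousOn_resolventOp hX) (fun _ _ => le_rfl) (fun t ht => hK.norm_resolventOp_le hX ht)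
  simpa only [one_mul] using this

theorem integrableOn_leftMap (hK : ResolventKernel A I c κ d) {X : H →L[ℂ] H} (hX : ‖X‖ < d) :
    IntegrableOn (fun t => resolventOp (addBounded A X) (c t) * κ t) I := by
  have := hK.integrableOn_mul (M := fun _ => 1) (hK.continuousOn_resolventOp hX) continuousOn_const
    (fun t ht => hK.norm_resolventOp_le hX ht) (fun _ _ => le_rfl)
  simpa only [mul_one] using this

theorem norm_rightMap_le (hK : ResolventKernel A I c κ d) {X : H →L[ℂ] H} (hX : ‖X‖ < d) :
    ‖rightMap A I c κ X‖ ≤ (∫ t in I, ‖κ t‖) * (d - ‖X‖)⁻¹ := by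
  have hI := hK.isOpen.measurableSet
  rw [rightMap, norm_neg, ← integral_mul_const]
  refine norm_integral_le_of_norm_le (hK.integrableOn.norm.mul_const _) ?_
  refine (ae_restrict_mem hI).mono fun t ht => ?_
  have := hK.norm_resolventOp_le hX ht
  exact (norm_mul_le _ _).trans (by gcongr)

theorem norm_rightMap_sub_le (hK : ResolventKernel A I c κ d) {X Y : H →L[ℂ] H} (hX : ‖X‖ < d)
    (hY : ‖Y‖ < d) : ‖rightMap A I c κ X - rightMap A I c κ Y‖ ≤
      (∫ t in I, ‖κ t‖) * ((d - ‖X‖)⁻¹ * ‖X - Y‖ * (d - ‖Y‖)⁻¹) := by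
  have hI := hK.isOpen.measurableSet
  rw [rightMap, rightMap, neg_sub_neg, ← integral_sub (hK.integrableOn_rightMap hY)
    (hK.integrableOn_rightMap hX), ← integral_mul_const]
  refine norm_integral_le_of_norm_le (hK.integrableOn.norm.mul_const _) ?_
  refine (ae_restrict_mem hI).mono fun t ht => ?_
  have h1 := hK.norm_resolventOp_le hX ht
  have h2 := hK.norm_resolventOp_le hY ht
  have h3 := resolvent_sub (hK.isBoundedInverse hX ht) (hK.isBoundedInverse hY ht)
  rw [sub_self, zero_smul, add_zero] at h3
  have h0 : 0 ≤ (d - ‖X‖)⁻¹ := inv_nonneg.2 (sub_pos.2 hX).le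
  rw [← mul_sub, ← neg_sub, h3]
  refine (norm_mul_le _ _).trans ?_
  gcongr
  rw [norm_neg]
  refine (norm_mul_le _ _).trans ?_
  gcongr
  refine (norm_mul_le _ _).trans ?_
  rw [norm_sub_rev]
  gcongr

/-- With `x = ‖X‖` and `V` the variation, the equation gives `x (d - x) ≤ V`. On `[d / 2, d - √V]`
the left side is at least `√V (d - √V)`, which exceeds `V` if `0 < √V < d / 2`; for `V = 0` the
inequality leaves only `x = 0`. -/
theorem norm_lt_half (hK : ResolventKernel A I c κ d) {X : H →L[ℂ] H}
    (hX : ‖X‖ < d - √(∫ t in I, ‖κ t‖)) (h : X = rightMap A I c κ X) : ‖X‖ < d / 2 := by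
  set V := ∫ t in I, ‖κ t‖ with hV
  have hV0 : 0 ≤ V := by positivity
  have hs := Real.sq_sqrt hV0
  have hs0 := Real.sqrt_nonneg V
  have hXd : ‖X‖ < d := by linarith
  have h1 := hK.norm_rightMap_le hXd
  rw [← h, ← div_eq_mul_inv, le_div_iff₀ (sub_pos.2 hXd)] at h1
  have hVd : V < d ^ 2 / 4 := hK.variation_lt
  have hsd : √V < d / 2 := by
    refine lt_of_pow_lt_pow_left₀ 2 (by linarith [hK.pos]) ?_
    rw [hs]; linarith
  by_contra! hc
  have h2 : √V * (d - √V) ≤ ‖X‖ * (d - ‖X‖) := by nlinarith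
  have h3 : √V * (d - 2 * √V) ≤ 0 := by nlinarith
  have h4 : √V = 0 := by
    by_contra h0
    have : 0 < √V := lt_of_le_of_ne hs0 (Ne.symm h0)
    nlinarith
  rw [h4] at hs hX
  nlinarith [hK.pos]

/-- For norms below `d / 2` the resolvents are bounded by `2 / d`, so the transformator contracts by
the factor `V / (d / 2) ^ 2 < 1`. -/
theorem eq_of_eq_rightMap (hK : ResolventKernel A I c κ d) {X Y : H →L[ℂ] H} (hX : ‖X‖ < d / 2)
    (hY : ‖Y‖ < d / 2) (h : X = rightMap A I c κ X) (h' : Y = rightMap A I c κ Y) : X = Y := by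
  have hd := hK.pos
  have h1 := hK.norm_rightMap_sub_le (X := X) (Y := Y) (by linarith) (by linarith)
  rw [← h, ← h'] at h1
  have h2 : (d - ‖X‖)⁻¹ ≤ (d / 2)⁻¹ := inv_anti₀ (by linarith) (by linarith)
  have h3 : (d - ‖Y‖)⁻¹ ≤ (d / 2)⁻¹ := inv_anti₀ (by linarith) (by linarith)
  by_contra hne
  have h4 : 0 < ‖X - Y‖ := norm_pos_iff.2 (sub_ne_zero.2 hne)
  have h5 : ‖X - Y‖ ≤ (∫ t in I, ‖κ t‖) * ((d / 2)⁻¹ * ‖X - Y‖ * (d / 2)⁻¹) := by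
    refine h1.trans ?_
    have : 0 ≤ (d - ‖Y‖)⁻¹ := inv_nonneg.2 (by linarith)
    gcongr
  have h6 : (∫ t in I, ‖κ t‖) * ((d / 2)⁻¹ * ‖X - Y‖ * (d / 2)⁻¹) < ‖X - Y‖ := by
    calc (∫ t in I, ‖κ t‖) * ((d / 2)⁻¹ * ‖X - Y‖ * (d / 2)⁻¹)
        < (d ^ 2 / 4) * ((d / 2)⁻¹ * ‖X - Y‖ * (d / 2)⁻¹) := by
          gcongr; exact hK.variation_lt
      _ = ‖X - Y‖ := by field_simp; norm_num
  linarith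

/-- Banach's fixed point theorem on the closed ball of radius `d / 2`, which the transformator maps
into the open ball because `V / (d / 2) < d / 2`. -/
theorem exists_eq_rightMap (hK : ResolventKernel A I c κ d) :
    ∃ X : H →L[ℂ] H, ‖X‖ < d / 2 ∧ X = rightMap A I c κ X := by
  have hd := hK.pos
  set V := ∫ t in I, ‖κ t‖ with hV
  have hV0 : 0 ≤ V := by positivity
  have hVd : V < d ^ 2 / 4 := hK.variation_lt
  set s := Metric.closedBall (0 : H →L[ℂ] H) (d / 2) with hs
  have hle : ∀ X ∈ s, ‖rightMap A I c κ X‖ < d / 2 := fun X hX => by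
    have hX' : ‖X‖ ≤ d / 2 := by simpa [hs] using hX
    calc ‖rightMap A I c κ X‖ ≤ V * (d - ‖X‖)⁻¹ := hK.norm_rightMap_le (by linarith)
      _ ≤ V * (d / 2)⁻¹ := by
        gcongr
        linarith
      _ < d ^ 2 / 4 * (d / 2)⁻¹ := by gcongr
      _ = d / 2 := by field_simp; norm_num
  have hmaps : MapsTo (rightMap A I c κ) s s := fun X hX => by
    simpa [hs] using (hle X hX).le
  set k : NNReal := ⟨V * ((d / 2)⁻¹ * (d / 2)⁻¹), by positivity⟩ with hk
  have hk1 : k < 1 := by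
    rw [← NNReal.coe_lt_coe]
    change V * ((d / 2)⁻¹ * (d / 2)⁻¹) < 1
    calc V * ((d / 2)⁻¹ * (d / 2)⁻¹) < (d ^ 2 / 4) * ((d / 2)⁻¹ * (d / 2)⁻¹) := by gcongr
      _ = 1 := by field_simp; norm_num
  have hcontr : ContractingWith k (hmaps.restrict (rightMap A I c κ) s s) := by
    refine ⟨hk1, LipschitzWith.of_dist_le_mul fun X Y => ?_⟩
    have hX : ‖(X : H →L[ℂ] H)‖ ≤ d / 2 := mem_closedBall_zero_iff.1 X.2
    have hY : ‖(Y : H →L[ℂ] H)‖ ≤ d / 2 := mem_closedBall_zero_iff.1 Y.2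
    have h2 : (d - ‖(X : H →L[ℂ] H)‖)⁻¹ ≤ (d / 2)⁻¹ := inv_anti₀ (by linarith) (by linarith)
    have h3 : (d - ‖(Y : H →L[ℂ] H)‖)⁻¹ ≤ (d / 2)⁻¹ := inv_anti₀ (by linarith) (by linarith)
    have h4 : 0 ≤ (d - ‖(Y : H →L[ℂ] H)‖)⁻¹ := inv_nonneg.2 (by linarith)
    rw [Subtype.dist_eq, Subtype.dist_eq, dist_eq_norm, dist_eq_norm]
    change ‖rightMap A I c κ X - rightMap A I c κ Y‖ ≤ V * ((d / 2)⁻¹ * (d / 2)⁻¹) * _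
    refine (hK.norm_rightMap_sub_le (by linarith) (by linarith)).trans ?_
    calc V * ((d - ‖(X : H →L[ℂ] H)‖)⁻¹ * ‖(X - Y : H →L[ℂ] H)‖ * (d - ‖(Y : H →L[ℂ] H)‖)⁻¹)
        ≤ V * ((d / 2)⁻¹ * ‖(X - Y : H →L[ℂ] H)‖ * (d / 2)⁻¹) := by gcongr
      _ = _ := by ring
  obtain ⟨X, hXs, hX, -⟩ := hcontr.exists_fixedPoint' Metric.isClosed_closedBall.isComplete hmaps
    (x := 0) (by simp [hs]; positivity) (edist_ne_top _ _)
  refine ⟨X, ?_, hX.symm⟩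
  rw [← show rightMap A I c κ X = X from hX]
  exact hle X hXs

theorem star_setIntegral {φ : ℝ → H →L[ℂ] H} : star (∫ t in I, φ t) = ∫ t in I, star (φ t) :=
  ((starL' ℝ : (H →L[ℂ] H) ≃L[ℝ] (H →L[ℂ] H)).integral_comp_comm φ).symm

theorem star_resolventOp (hK : ResolventKernel A I c κ d) {X : H →L[ℂ] H} (hX : ‖X‖ < d) {t : ℝ}
    (ht : t ∈ I) : star (resolventOp (addBounded A X) (c t)) =
      resolventOp (addBounded A (star X)) (starRingEnd ℂ (c t)) :=
  (resolventOp_conj hK.isSelfAdjoint (hK.notMem_spec hX ht)).boundedInverse_eq.symm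

theorem star_rightMap_conj (hK : ResolventKernel A I c κ d) {X : H →L[ℂ] H} (hX : ‖X‖ < d) :
    star (rightMap A I (fun t => starRingEnd ℂ (c t)) (fun t => star (κ t)) X) =
      leftMap A I c κ (star X) := by
  rw [rightMap, leftMap, star_neg, star_setIntegral]
  congr 1
  refine setIntegral_congr_fun hK.isOpen.measurableSet fun t ht => ?_
  have : star (resolventOp (addBounded A X) (conj (c t))) =
    resolventOp (addBounded A (star X)) (conj (conj (c t))) := hK.adjoint.star_resolventOp hX ht
  rw [star_mul, star_star, this, Complex.conj_conj]

section Omega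

variable {X Y : H →L[ℂ] H}

/-- The operator `Ω = ∫ (A + Y - c)⁻¹ κ (A + X - c)⁻¹`. -/
def omega (A : H →ₗ.[ℂ] H) (I : Set ℝ) (c : ℝ → ℂ) (κ : ℝ → H →L[ℂ] H) (X Y : H →L[ℂ] H) :
    H →L[ℂ] H :=
  ∫ t in I, resolventOp (addBounded A Y) (c t) * κ t * resolventOp (addBounded A X) (c t)

theorem integrableOn_omega (hK : ResolventKernel A I c κ d) (hX : ‖X‖ < d) (hY : ‖Y‖ < d) :
    IntegrableOn (fun t => resolventOp (addBounded A Y) (c t) * κ t *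
      resolventOp (addBounded A X) (c t)) I :=
  hK.integrableOn_mul (hK.continuousOn_resolventOp hY) (hK.continuousOn_resolventOp hX)
    (fun _ ht => hK.norm_resolventOp_le hY ht) (fun _ ht => hK.norm_resolventOp_le hX ht)

/-- The strict bounds on `‖X‖` and `‖Y‖` make `(d - ‖X‖) (d - ‖Y‖)` strictly larger than `d ^ 2 /
4`; the inequality stays strict unless the variation in the numerator is zero. -/
theorem norm_omega_le (hK : ResolventKernel A I c κ d) (hX : ‖X‖ < d / 2) (hY : ‖Y‖ < d / 2) :
    ‖omega A I c κ X Y‖ ≤ (∫ t in I, ‖κ t‖) / (1 / 4 * d ^ 2) ∧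
      (0 < ∫ t in I, ‖κ t‖ → ‖omega A I c κ X Y‖ < (∫ t in I, ‖κ t‖) / (1 / 4 * d ^ 2)) := by
  have hd := hK.pos
  have h1 := hK.norm_integral_mul_le (fun t ht => hK.norm_resolventOp_le (X := Y) (by linarith) ht)
    (fun t ht => hK.norm_resolventOp_le (X := X) (by linarith) ht)
  have h2 : 0 < d - ‖X‖ := by linarith
  have h3 : 0 < d - ‖Y‖ := by linarith
  have h4 : 1 / 4 * d ^ 2 < (d - ‖Y‖) * (d - ‖X‖) := by nlinarith
  have h5 : (d - ‖Y‖)⁻¹ * (∫ t in I, ‖κ t‖) * (d - ‖X‖)⁻¹ =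
      (∫ t in I, ‖κ t‖) / ((d - ‖Y‖) * (d - ‖X‖)) := by field_simp
  rw [h5] at h1
  refine ⟨h1.trans ?_, fun hV => h1.trans_lt ?_⟩
  · have : 0 ≤ ∫ t in I, ‖κ t‖ := by positivity
    gcongr
  · gcongr

theorem variation_div_lt_one (hK : ResolventKernel A I c κ d) :
    (∫ t in I, ‖κ t‖) / (1 / 4 * d ^ 2) < 1 := by
  have hd := hK.pos
  rw [div_lt_one (by positivity)]
  linarith [hK.variation_lt]

theorem isUnit_one_sub_omega (hK : ResolventKernel A I c κ d) (hX : ‖X‖ < d / 2)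
    (hY : ‖Y‖ < d / 2) : IsUnit (1 - omega A I c κ X Y) :=
  (Units.oneSub _ ((hK.norm_omega_le hX hY).1.trans_lt hK.variation_div_lt_one)).isUnit

theorem star_omega (hK : ResolventKernel A I c κ d) (hX : ‖X‖ < d) (hY : ‖Y‖ < d) :
    star (omega A I c κ X Y) =
      omega A I (fun t => starRingEnd ℂ (c t)) (fun t => star (κ t)) (star Y) (star X) := by
  rw [omega, star_setIntegral, omega]
  refine setIntegral_congr_fun hK.isOpen.measurableSet fun t ht => ?_
  simp only [star_mul, hK.star_resolventOp hX ht, hK.star_resolventOp hY ht, mul_assoc]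

/-- The intertwining relation, in terms of resolvents. -/
theorem resolvent_mul_one_sub_omega (hK : ResolventKernel A I c κ d) (hX : ‖X‖ < d)
    (hY : ‖Y‖ < d) (hXr : X = rightMap A I c κ X) (hYl : Y = leftMap A I c κ Y) {z : ℂ}
    {R Q : H →L[ℂ] H} (hR : IsBoundedInverse (shift (addBounded A X) z) R)
    (hQ : IsBoundedInverse (shift (addBounded A Y) z) Q) :
    Q * (1 - omega A I c κ X Y) = (1 - omega A I c κ X Y) * R := by
  have hI := hK.isOpen.measurableSet
  have e1 : Q * omega A I c κ X Y - omega A I c κ X Y * R = Q * (X - Y) * R := by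
    have i0 := hK.integrableOn_omega hX hY
    have i1 := hK.integrableOn_rightMap hX
    have i2 := hK.integrableOn_leftMap hY
    have h1 : Q * omega A I c κ X Y = ∫ t in I, Q * (resolventOp (addBounded A Y) (c t) * κ t *
        resolventOp (addBounded A X) (c t)) := (integral_const_mul_of_integrable i0).symm
    have h2 : omega A I c κ X Y * R = ∫ t in I, resolventOp (addBounded A Y) (c t) * κ t *
        resolventOp (addBounded A X) (c t) * R := (integral_mul_const_of_integrable i0).symm
    have h3 : X - Y = ∫ t in I, (resolventOp (addBounded A Y) (c t) * κ t -
        κ t * resolventOp (addBounded A X) (c t)) := by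
      rw [integral_sub i2 i1]
      conv_lhs => rw [hXr, hYl, rightMap, leftMap]
      abel
    have h4 : Q * (X - Y) * R = ∫ t in I, Q * (resolventOp (addBounded A Y) (c t) * κ t -
        κ t * resolventOp (addBounded A X) (c t)) * R := by
      have i3 : IntegrableOn (fun t => resolventOp (addBounded A Y) (c t) * κ t -
        κ t * resolventOp (addBounded A X) (c t)) I := i2.sub i1
      rw [h3, ← integral_const_mul_of_integrable i3,
        ← integral_mul_const_of_integrable (i3.const_mul Q)]
    rw [h1, h2, h4, ← integral_sub (i0.const_mul Q) (i0.mul_const R)]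
    refine setIntegral_congr_fun hI fun t ht => ?_
    have hRt := hK.isBoundedInverse hX ht
    have hQt := hK.isBoundedInverse hY ht
    have c1 := resolvent_sub_of_shift hR hRt
    have c2 := resolvent_sub_of_shift hQ hQt
    have c3 := resolvent_commute hR hRt
    set q := resolventOp (addBounded A Y) (c t)
    set r := resolventOp (addBounded A X) (c t)
    -- Both differences carry the same scalar: `R - r = (z - c) R r` and `Q - q = (z - c) Q q`.
    -- Multiplied out, this is the pointwise identity `Q q κ r - q κ r R = Q (q κ - κ r) R`.
    have key : Q * q * κ t * (R - r) = (Q - q) * κ t * (r * R) := by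
      rw [c1, c2, c3.eq]
      simp only [mul_assoc, smul_mul_assoc, mul_smul_comm]
    linear_combination (norm := noncomm_ring) -key
  have e2 := resolvent_sub hQ hR
  rw [sub_self, zero_smul, add_zero] at e2
  rw [mul_sub, sub_mul, mul_one, one_mul, sub_eq_sub_iff_sub_eq_sub, e1, e2]

end Omega

end ResolventKernel

/-! ### Reflection symmetry of the setting and of the continued derivative -/

theorem tendsto_conj_endPoint (e : EReal) :
    Tendsto (fun z : ℂ => conj z) (Setting.endPoint e) (Setting.endPoint e) := by
  have inf : Tendsto (fun z : ℂ => conj z) (Bornology.cobounded ℂ) (Bornology.cobounded ℂ) := by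
    rw [← tendsto_norm_atTop_iff_cobounded]
    simpa using tendsto_norm_cobounded_atTop
  induction e with
  | bot => rwa [endPoint_bot]
  | top => rwa [endPoint_top]
  | coe r =>
    rw [endPoint_coe]
    have := Complex.continuous_conj.tendsto (r : ℂ)
    rwa [Complex.conj_ofReal] at this

/-- Moving away from a set of real numbers in the imaginary direction. -/
theorem infDist_le_infDist_sub_mul_I {s : Set ℂ} (hs : ∀ z ∈ s, z.im = 0) {z : ℂ} (hz : z.im ≤ 0)
    {v : ℝ} (hv : 0 ≤ v) : Metric.infDist z s ≤ Metric.infDist (z - v * Complex.I) s := by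
  rcases s.eq_empty_or_nonempty with rfl | hne
  · simp
  refine (Metric.le_infDist hne).2 fun y hy => (Metric.infDist_le_dist_of_mem hy).trans ?_
  rw [dist_eq_norm, dist_eq_norm, ← abs_of_nonneg (norm_nonneg (z - y)),
    ← abs_of_nonneg (norm_nonneg (z - v * Complex.I - y)), ← sq_le_sq, Complex.sq_norm,
    Complex.sq_norm, Complex.normSq_apply, Complex.normSq_apply]
  simp [hs y hy]
  nlinarith

theorem neg_im_le_infDist {s : Set ℂ} (hs : ∀ z ∈ s, z.im = 0) (hne : s.Nonempty) (z : ℂ) :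
    -z.im ≤ Metric.infDist z s := by
  refine (Metric.le_infDist hne).2 fun y hy => ?_
  rw [dist_eq_norm]
  have := Complex.abs_im_le_norm (z - y)
  simp only [Complex.sub_im, hs y hy, sub_zero] at this
  exact (neg_le_abs _).trans this

theorem infDist_conj {s : Set ℂ} (hs : ∀ z ∈ s, z.im = 0) (z : ℂ) :
    Metric.infDist (conj z) s = Metric.infDist z s := by
  rcases s.eq_empty_or_nonempty with rfl | hne
  · simp
  have h : ∀ y ∈ s, dist (conj z) y = dist z y := fun y hy => by
    conv_lhs => rw [← Complex.conj_eq_iff_im.2 (hs y hy)]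
    rw [Complex.dist_conj_conj]
  refine le_antisymm ?_ ?_
  · refine (Metric.le_infDist hne).2 fun y hy => ?_
    rw [← h y hy]; exact Metric.infDist_le_dist_of_mem hy
  · refine (Metric.le_infDist hne).2 fun y hy => ?_
    rw [h y hy]; exact Metric.infDist_le_dist_of_mem hy

namespace Setting

variable {H₀ H₁ : Type*} [NormedAddCommGroup H₀] [InnerProductSpace ℂ H₀] [CompleteSpace H₀]
  [NormedAddCommGroup H₁] [InnerProductSpace ℂ H₁] [CompleteSpace H₁] {S : Setting H₀ H₁}

theorem isOpen_Δ₀ : IsOpen S.Δ₀ := isOpen_realIoo S.left S.right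

theorem nonempty_Δ₀ : S.Δ₀.Nonempty := nonempty_realIoo S.left_lt_right

theorem im_eq_zero_of_mem_σ₁ : ∀ z ∈ S.σ₁, z.im = 0 := fun z hz => by
  obtain ⟨t, -, rfl⟩ := S.spec₁ hz
  simp

theorem D_neg_one : S.D (-1) = S.Dminus := if_pos rfl

theorem D_one : S.D 1 = (fun z : ℂ => conj z) '' S.Dminus := if_neg (by decide)

theorem conj_mem_D {l : ℤˣ} {z : ℂ} (hz : z ∈ S.D l) : conj z ∈ S.D (-l) := by
  rcases Int.units_eq_one_or l with rfl | rfl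
  · rw [D_one] at hz
    obtain ⟨y, hy, rfl⟩ := hz
    rw [D_neg_one, Complex.conj_conj]
    exact hy
  · rw [neg_neg, D_one]
    rw [D_neg_one] at hz
    exact ⟨z, hz, rfl⟩

/-- `Δ₀` lies in the closure of `D⁻`, so adjoining it preserves connectedness, and the reflected set
shares the points of `Δ₀`. -/
theorem isPreconnected_domain : IsPreconnected (S.Dminus ∪
    (fun t : ℝ => (t : ℂ)) '' {t : ℝ | S.left < t ∧ t < S.right} ∪
      (fun z : ℂ => conj z) '' S.Dminus) := by
  set J : Set ℂ := (fun t : ℝ => (t : ℂ)) '' {t : ℝ | S.left < t ∧ t < S.right} with hJ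
  have h0 : IsPreconnected S.Dminus := S.isSimplyConnected_Dminus.isPathConnected.isConnected.2
  have h1 : IsPreconnected (S.Dminus ∪ J) := by
    refine h0.subset_closure subset_union_left (union_subset subset_closure ?_)
    exact S.subset_frontier.trans frontier_subset_closure
  have h2 : IsPreconnected ((fun z : ℂ => conj z) '' (S.Dminus ∪ J)) :=
    h1.image _ Complex.continuous_conj.continuousOn
  obtain ⟨t, ht⟩ := S.nonempty_Δ₀
  have hJJ : (fun z : ℂ => conj z) '' J = J := by
    rw [hJ, image_image]
    simp
  have h3 := h1.union (t : ℂ) (Or.inr ⟨t, ht, rfl⟩)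
    (show (t : ℂ) ∈ (fun z : ℂ => conj z) '' (S.Dminus ∪ J) from
      ⟨t, Or.inr ⟨t, ht, rfl⟩, by simp⟩) h2
  rw [image_union, hJJ] at h3
  convert h3 using 1
  ext z
  simp only [mem_union]
  tauto

/-- On the axis `K'` is the derivative of a family of self-adjoint operators. -/
theorem star_K'_ofReal {t : ℝ} (ht : t ∈ S.Δ₀) : star (S.K' t) = S.K' t := by
  have h1 := S.hasDerivAt t ht.1 ht.2
  have h2 := h1.star
  have e : ∀ s : ℝ, star (ContinuousLinearMap.adjoint S.B ∘L S.E₀.proj (Iio s) ∘L S.B) =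
      ContinuousLinearMap.adjoint S.B ∘L S.E₀.proj (Iio s) ∘L S.B := fun s => by
    have hE := (S.E₀.isStarProjection (Iio s) measurableSet_Iio).isSelfAdjoint
    rw [IsSelfAdjoint, ContinuousLinearMap.star_eq_adjoint] at hE
    rw [ContinuousLinearMap.star_eq_adjoint, ContinuousLinearMap.adjoint_comp,
      ContinuousLinearMap.adjoint_comp, ContinuousLinearMap.adjoint_adjoint, hE]
    rfl
  simp only [e] at h2
  exact h2.unique h1

/-- The symmetry `K'(z̄) = K'(z)*` of the continued derivative. -/
theorem K'_conj {l : ℤˣ} {z : ℂ} (hz : z ∈ S.D l) : S.K' (conj z) = star (S.K' z) := by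
  set U : Set ℂ := S.Dminus ∪ (fun t : ℝ => (t : ℂ)) '' {t : ℝ | S.left < t ∧ t < S.right} ∪
      (fun z : ℂ => conj z) '' S.Dminus with hU
  have hconj : ∀ z ∈ U, conj z ∈ U := by
    rintro z ((hz | ⟨t, ht, rfl⟩) | ⟨y, hy, rfl⟩)
    · exact Or.inr ⟨z, hz, rfl⟩
    · exact Or.inl (Or.inr ⟨t, ht, by simp⟩)
    · exact Or.inl (Or.inl (by simpa using hy))
  have hg : AnalyticOnNhd ℂ (fun z => star (S.K' (conj z))) U := by
    intro z hz
    rw [Complex.analyticAt_iff_eventually_differentiableAt]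
    have h1 := (Complex.analyticAt_iff_eventually_differentiableAt.1
      (S.analytic (conj z) (hconj z hz)))
    have h2 : Tendsto (fun z : ℂ => conj z) (𝓝 z) (𝓝 (conj z)) :=
      Complex.continuous_conj.continuousAt
    filter_upwards [h2.eventually h1] with w hw
    have := hw.star_conj
    rwa [Complex.conj_conj] at this
  obtain ⟨t, ht⟩ := S.nonempty_Δ₀
  have hfreq : ∃ᶠ w in 𝓝[≠] (t : ℂ), S.K' w = star (S.K' (conj w)) := by
    have h1 : Tendsto (fun t : ℝ => (t : ℂ)) (𝓝[≠] t) (𝓝[≠] (t : ℂ)) :=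
      tendsto_nhdsWithin_of_tendsto_nhds_of_eventually_within _
        (Complex.continuous_ofReal.continuousAt.tendsto.mono_left nhdsWithin_le_nhds)
        (eventually_mem_nhdsWithin.mono fun s hs => by simpa using hs)
    refine h1.frequently (Eventually.frequently ?_)
    filter_upwards [nhdsWithin_le_nhds (S.isOpen_Δ₀.mem_nhds ht)] with s hs
    rw [Complex.conj_ofReal, star_K'_ofReal hs]
  -- Schwarz reflection: both analytic functions agree on the real interval, hence on the connected
  -- domain.
  have hE := S.analytic.eqOn_of_preconnected_of_frequently_eq hg S.isPreconnected_domain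
    (z₀ := (t : ℂ)) (Or.inl (Or.inr ⟨t, ht, rfl⟩)) hfreq
  have hzU : z ∈ U := by
    rcases Int.units_eq_one_or l with rfl | rfl
    · rw [D_one] at hz; exact Or.inr hz
    · rw [D_neg_one] at hz; exact Or.inl (Or.inl hz)
  have := hE (hconj z hzU)
  simp only [Complex.conj_conj] at this
  exact this

theorem deriv_conj_comp (c : ℝ → ℂ) (t : ℝ) :
    deriv (fun t => conj (c t)) t = conj (deriv c t) := deriv.star

theorem IsContour.conj {l : ℤˣ} {c : ℝ → ℂ} (hc : S.IsContour l c) :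
    S.IsContour (-l) (fun t => conj (c t)) where
  lipschitz := by
    obtain ⟨k, hk⟩ := hc.lipschitz
    refine ⟨k, fun x hx y hy => ?_⟩
    have := hk hx hy
    rwa [edist_dist, Complex.dist_conj_conj, ← edist_dist]
  injOn := fun x hx y hy h => hc.injOn hx hy ((starRingEnd ℂ).injective h)
  mapsTo := fun t ht => conj_mem_D (hc.mapsTo ht)
  deformation := by
    obtain ⟨h, h1, h2, h3, h4, h5, h6⟩ := hc.deformation
    refine ⟨fun p => starRingEnd ℂ (h p), Complex.continuous_conj.comp_continuousOn h1,
      fun t ht => ?_, fun t ht => ?_, fun s hs t ht => conj_mem_D (h4 s hs t ht),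
      (tendsto_conj_endPoint _).comp h5, (tendsto_conj_endPoint _).comp h6⟩
    · simp only [h2 t ht, Complex.conj_ofReal]
    · simp only [h3 t ht]

theorem IsAdmissible.conj {l : ℤˣ} {c : ℝ → ℂ} (hc : S.IsAdmissible l c) :
    S.IsAdmissible (-l) (fun t => conj (c t)) where
  toIsContour := hc.toIsContour.conj
  finite_variation := by
    refine hc.finite_variation.congr_fun (fun t ht => ?_) S.isOpen_Δ₀.measurableSet
    simp only [deriv_conj_comp, K'_conj (hc.mapsTo ht), norm_star, RCLike.norm_conj]

theorem dist_conj (c : ℝ → ℂ) : S.dist (fun t => conj (c t)) = S.dist c := by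
  simp only [dist, infDist_conj S.im_eq_zero_of_mem_σ₁]

theorem dist_le (c : ℝ → ℂ) {t : ℝ} (ht : t ∈ S.Δ₀) : S.dist c ≤ Metric.infDist (c t) S.σ₁ :=
  ciInf_le (f := fun t : S.Δ₀ => Metric.infDist (c t) S.σ₁)
    ⟨0, by rintro _ ⟨t, rfl⟩; exact Metric.infDist_nonneg⟩ ⟨t, ht⟩

theorem dist_nonneg (c : ℝ → ℂ) : 0 ≤ S.dist c :=
  Real.iInf_nonneg fun _ => Metric.infDist_nonneg

theorem IsContour.continuousOn {l : ℤˣ} {c : ℝ → ℂ} (hc : S.IsContour l c) :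
    ContinuousOn c S.Δ₀ := hc.lipschitz.choose_spec.continuousOn

theorem analyticAt_of_mem_D {l : ℤˣ} {z : ℂ} (hz : z ∈ S.D l) : AnalyticAt ℂ S.K' z := by
  rcases Int.units_eq_one_or l with rfl | rfl
  · rw [D_one] at hz; exact S.analytic z (Or.inr hz)
  · rw [D_neg_one] at hz; exact S.analytic z (Or.inl (Or.inl hz))

theorem IsContour.continuousOn_K' {l : ℤˣ} {c : ℝ → ℂ} (hc : S.IsContour l c) :
    ContinuousOn (fun t => S.K' (c t)) S.Δ₀ := fun t ht =>
  (analyticAt_of_mem_D (hc.mapsTo ht)).continuousAt.comp_continuousWithinAt (hc.continuousOn t ht)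

/-- The operator density `K'(μ) dμ` along a curve. -/
def density (S : Setting H₀ H₁) (c : ℝ → ℂ) (t : ℝ) : H₁ →L[ℂ] H₁ := deriv c t • S.K' (c t)

theorem norm_density (c : ℝ → ℂ) (t : ℝ) : ‖S.density c t‖ = ‖deriv c t‖ * ‖S.K' (c t)‖ :=
  norm_smul _ _

theorem IsContour.aestronglyMeasurable_density {l : ℤˣ} {c : ℝ → ℂ} (hc : S.IsContour l c) :
    AEStronglyMeasurable (S.density c) (volume.restrict S.Δ₀) :=
  (measurable_deriv c).aestronglyMeasurable.smul
    (hc.continuousOn_K'.aestronglyMeasurable S.isOpen_Δ₀.measurableSet)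

theorem IsAdmissible.integrableOn_density {l : ℤˣ} {c : ℝ → ℂ} (hc : S.IsAdmissible l c) :
    IntegrableOn (S.density c) S.Δ₀ :=
  Integrable.mono' hc.finite_variation hc.aestronglyMeasurable_density
    (Eventually.of_forall fun t => (norm_density c t).le)

theorem variation_eq (c : ℝ → ℂ) : S.variation c = ∫ t in S.Δ₀, ‖S.density c t‖ := by
  simp only [variation, norm_density]

theorem density_conj {l : ℤˣ} {c : ℝ → ℂ} (hc : S.IsContour l c) {t : ℝ} (ht : t ∈ S.Δ₀) :
    S.density (fun t => conj (c t)) t = star (S.density c t) := by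
  rw [density, density, deriv_conj_comp, K'_conj (hc.mapsTo ht), star_smul]
  rfl

theorem IsContour.lowerDeformation {c : ℝ → ℂ} (hc : S.IsContour (-1) c) :
    ∃ h, LowerDeformation S.left S.right S.Dminus h ∧ ∀ t ∈ S.Δ₀, h (1, t) = c t := by
  obtain ⟨h, h1, h2, h3, h4, h5, h6⟩ := hc.deformation
  rw [D_neg_one] at h4
  exact ⟨h, ⟨S.left_lt_right, S.isOpen_Dminus, S.isSimplyConnected_Dminus, S.Dminus_subset, h1, h2,
    h4, h5, h6⟩, h3⟩

theorem endBound_of_norm_le (hdec : S.DecayAtInfinity) {f : ℂ → ℂ} {C₀ : ℝ} (hC₀ : 0 ≤ C₀)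
    (hf : ∀ z ∈ S.Dminus, ‖f z‖ ≤ C₀ * ‖S.K' z‖) {e : EReal} (he : e = S.left ∨ e = S.right) :
    EndBound S.Dminus f e := by
  refine ⟨fun r hr => ?_, fun hinf => ?_⟩
  · obtain ⟨C, -, γ, hγ, -, ε, hε, h⟩ := S.endpoint_bound r (by rwa [hr])
    refine ⟨C₀ * C, γ, hγ, ε, hε, fun z hz hzr => (hf z hz).trans ?_⟩
    rw [mul_assoc]
    exact mul_le_mul_of_nonneg_left (h z (Or.inl hz) hzr) hC₀
  · have h0 : S.left = ⊥ ∨ S.right = ⊤ := by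
      have hlt := S.left_lt_right
      rcases he with rfl | rfl <;> rcases hinf with h | h <;> simp_all
    obtain ⟨C, -, γ, hγ, R, hR, h⟩ := hdec h0
    refine ⟨C₀ * C, γ, hγ, R, hR, fun z hz hzR => (hf z hz).trans ?_⟩
    rw [mul_assoc]
    exact mul_le_mul_of_nonneg_left (h (-1) z (by rwa [D_neg_one]) hzR) hC₀

/-- If `K'` is analytic in the whole plane, then it vanishes. -/
theorem K'_eq_zero (hdec : S.DecayAtInfinity) (hl : S.left = ⊥) (hr : S.right = ⊤)
    (hD : ∀ w : ℂ, w.im < 0 → w ∈ S.Dminus) (z : ℂ) : S.K' z = 0 := by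
  have hall : ∀ z, AnalyticAt ℂ S.K' z := fun z => by
    rcases lt_trichotomy z.im 0 with h | h | h
    · exact S.analytic z (Or.inl (Or.inl (hD z h)))
    · refine S.analytic z (Or.inl (Or.inr ⟨z.re, ⟨?_, ?_⟩, Complex.ext rfl (by simp [h])⟩))
      · rw [hl]; exact EReal.bot_lt_coe _
      · rw [hr]; exact EReal.coe_lt_top _
    · exact S.analytic z (Or.inr ⟨conj z, hD _ (by simpa using h), by simp⟩)
  obtain ⟨C, hC, γ, hγ, R, hR, h⟩ := hdec (Or.inl hl)
  have hbound : ∀ z : ℂ, R < ‖z‖ → ‖S.K' z‖ ≤ C * ‖z‖ ^ γ := by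
    intro z hz
    rcases lt_trichotomy z.im 0 with h0 | h0 | h0
    · exact h (-1) z (by rw [D_neg_one]; exact hD z h0) hz
    -- The decay hypothesis covers only `D⁻` and its mirror image; at real points it is obtained by
    -- approaching from below.
    · have hz0 : z ≠ 0 := norm_pos_iff.1 (hR.trans hz)
      have hpath : Tendsto (fun v : ℝ => z - v * Complex.I) (𝓝[>] 0) (𝓝 z) := by
        have : Continuous fun v : ℝ => z - v * Complex.I := by fun_prop
        have := (this.tendsto 0).mono_left (nhdsWithin_le_nhds (s := Ioi 0))
        simpa using this
      have h1 : Tendsto (fun v : ℝ => ‖S.K' (z - v * Complex.I)‖) (𝓝[>] 0) (𝓝 ‖S.K' z‖) :=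
        ((hall z).continuousAt.tendsto.comp hpath).norm
      have h2 : Tendsto (fun v : ℝ => C * ‖z - v * Complex.I‖ ^ γ) (𝓝[>] 0) (𝓝 (C * ‖z‖ ^ γ)) :=
        (hpath.norm.rpow_const (Or.inl (norm_ne_zero_iff.2 hz0))).const_mul C
      refine le_of_tendsto_of_tendsto h1 h2 ?_
      filter_upwards [hpath.norm.eventually_const_lt hz, self_mem_nhdsWithin] with v hv
        (hv0 : 0 < v)
      exact h (-1) _ (by rw [D_neg_one]; exact hD _ (by simp [h0, hv0])) hv
    · exact h 1 z (by rw [D_one]; exact ⟨conj z, hD _ (by simpa using h0), by simp⟩) hz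
  -- Liouville: `K'` is entire and tends to zero at infinity.
  refine Differentiable.apply_eq_of_tendsto_cocompact (fun z => (hall z).differentiableAt) z ?_
  rw [← Metric.cobounded_eq_cocompact]
  have h3 : Tendsto (fun z : ℂ => C * ‖z‖ ^ γ) (Bornology.cobounded ℂ) (𝓝 0) := by
    have := (tendsto_rpow_neg_atTop (y := -γ) (by linarith)).const_mul C
    rw [mul_zero, neg_neg] at this
    exact this.comp tendsto_norm_cobounded_atTop
  refine squeeze_zero_norm' ?_ h3
  filter_upwards [tendsto_norm_cobounded_atTop.eventually_gt_atTop R] with z hz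
  exact hbound z hz

end Setting

/-! ### Independence of the contour for operator integrals -/

/-- The half-strip `|Re w| < η`, `Im w > - η`. -/
def halfStrip (η : ℝ) : Set ℂ := Complex.re ⁻¹' Ioo (-η) η ∩ Complex.im ⁻¹' Ioi (-η)

theorem isOpen_halfStrip (η : ℝ) : IsOpen (halfStrip η) :=
  (isOpen_Ioo.preimage Complex.continuous_re).inter (isOpen_Ioi.preimage Complex.continuous_im)

theorem isPreconnected_halfStrip (η : ℝ) : IsPreconnected (halfStrip η) :=
  (((convex_Ioo _ _).is_linear_preimage Complex.reLm.isLinear).inter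
    ((convex_Ioi _).is_linear_preimage Complex.imLm.isLinear)).isPreconnected

namespace Setting

variable {H₀ H₁ : Type*} [NormedAddCommGroup H₀] [InnerProductSpace ℂ H₀] [CompleteSpace H₀]
  [NormedAddCommGroup H₁] [InnerProductSpace ℂ H₁] [CompleteSpace H₁] {S : Setting H₀ H₁}

/-- An operator function that is holomorphic outside the `r`-neighbourhood of `σ₁` and bounded
outside every larger neighbourhood. -/
structure IsExterior (S : Setting H₀ H₁) (r : ℝ) (Φ : ℂ → H₁ →L[ℂ] H₁) : Prop where
  differentiableOn : DifferentiableOn ℂ Φ {z | r < Metric.infDist z S.σ₁}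
  bounded : ∀ r', r < r' → ∃ M, ∀ z, r' ≤ Metric.infDist z S.σ₁ → ‖Φ z‖ ≤ M

theorem isExterior_const (r : ℝ) (X : H₁ →L[ℂ] H₁) : S.IsExterior r fun _ => X :=
  ⟨differentiableOn_const _, fun _ _ => ⟨‖X‖, fun _ _ => le_rfl⟩⟩

theorem isExterior_resolventOp {r : ℝ} {X : H₁ →L[ℂ] H₁} (hX : ‖X‖ ≤ r) :
    S.IsExterior r (resolventOp (addBounded S.A₁ X)) := by
  refine ⟨(differentiableOn_resolventOp_addBounded S.selfAdjoint₁).mono fun z hz =>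
    hX.trans_lt hz, fun r' hr' => ⟨(r' - ‖X‖)⁻¹, fun z hz => ?_⟩⟩
  have h1 : 0 < r' - ‖X‖ := by linarith
  refine (norm_resolventOp_addBounded_le S.selfAdjoint₁ (z := z) ?_).trans ?_
  · exact (hX.trans_lt hr').trans_le hz
  · exact inv_anti₀ h1 (sub_le_sub_right hz _)

theorem IsExterior.star_conj {r : ℝ} {Φ : ℂ → H₁ →L[ℂ] H₁} (hΦ : S.IsExterior r Φ) :
    S.IsExterior r fun z => star (Φ (conj z)) := by
  have hσ := S.im_eq_zero_of_mem_σ₁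
  have hopen : IsOpen {z | r < Metric.infDist z S.σ₁} :=
    isOpen_lt continuous_const (Metric.continuous_infDist_pt _)
  refine ⟨fun z hz => ?_, fun r' hr' => ?_⟩
  · have hz' : conj z ∈ {z | r < Metric.infDist z S.σ₁} := by
      rw [mem_ofPred_eq, infDist_conj hσ]; exact hz
    have := ((hΦ.differentiableOn _ hz').differentiableAt (hopen.mem_nhds hz')).star_conj
    rw [Complex.conj_conj] at this
    exact this.differentiableWithinAt
  · obtain ⟨M, hM⟩ := hΦ.bounded r' hr'
    refine ⟨M, fun z hz => ?_⟩
    rw [norm_star]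
    exact hM _ (by rwa [infDist_conj hσ])

/-- The positive part of `Im w` moves `z` down, away from the real set `σ₁`. The real part and the
negative part of `Im w` cost at most `η` each. -/
theorem infDist_sub_ge {z w : ℂ} (hz : z.im ≤ 0) {η : ℝ} (hη : 0 < η) (hw : |w.re| < η)
    (hw' : -η < w.im) : Metric.infDist z S.σ₁ - 2 * η ≤ Metric.infDist (z - w) S.σ₁ := by
  have h1 := infDist_le_infDist_sub_mul_I S.im_eq_zero_of_mem_σ₁ hz (le_max_right w.im 0)
  have h2 := Metric.infDist_le_infDist_add_dist (s := S.σ₁)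
    (x := z - (max w.im 0 : ℝ) * Complex.I) (y := z - w)
  have h3 : Dist.dist (z - (max w.im 0 : ℝ) * Complex.I) (z - w) ≤ 2 * η := by
    rw [dist_eq_norm]
    refine (Complex.norm_le_abs_re_add_abs_im _).trans ?_
    have e1 : (z - (max w.im 0 : ℝ) * Complex.I - (z - w)).re = w.re := by simp
    have e2 : (z - (max w.im 0 : ℝ) * Complex.I - (z - w)).im = w.im - max w.im 0 := by
      simp
    rw [e1, e2]
    have : |w.im - max w.im 0| ≤ η := by
      rw [abs_le]
      rcases le_total w.im 0 with h | h
      · rw [max_eq_right h]; constructor <;> linarith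
      · rw [max_eq_left h]; constructor <;> linarith
    linarith
  linarith

section Independence

variable {c c' : ℝ → ℂ} {r : ℝ} {Φ Ψ : ℂ → H₁ →L[ℂ] H₁}

theorem IsContour.im_neg (hc : S.IsContour (-1) c) {t : ℝ} (ht : t ∈ S.Δ₀) : (c t).im < 0 := by
  have := hc.mapsTo ht
  rw [D_neg_one] at this
  exact S.Dminus_subset _ this

/-- The scalar integrand with the operator functions shifted by `w`. -/
def shifted (S : Setting H₀ H₁) (Φ Ψ : ℂ → H₁ →L[ℂ] H₁) (ψ : (H₁ →L[ℂ] H₁) →L[ℂ] ℂ) (w z : ℂ) : ℂ :=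
  ψ (Φ (z - w) * S.K' z * Ψ (z - w))

theorem norm_shifted_le {ψ : (H₁ →L[ℂ] H₁) →L[ℂ] ℂ} {w z : ℂ} {M N : ℝ} (hM : ‖Φ (z - w)‖ ≤ M)
    (hN : ‖Ψ (z - w)‖ ≤ N) : ‖S.shifted Φ Ψ ψ w z‖ ≤ ‖ψ‖ * M * N * ‖S.K' z‖ := by
  have hM0 := (norm_nonneg _).trans hM
  calc ‖S.shifted Φ Ψ ψ w z‖ ≤ ‖ψ‖ * ‖Φ (z - w) * S.K' z * Ψ (z - w)‖ := ψ.le_opNorm _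
    _ ≤ ‖ψ‖ * (M * ‖S.K' z‖ * N) := by
      gcongr
      refine (norm_mul_le _ _).trans ?_
      gcongr
      refine (norm_mul_le _ _).trans ?_
      gcongr
    _ = _ := by ring

theorem IsExterior.continuousOn_comp (hΦ : S.IsExterior r Φ) (hc : ContinuousOn c S.Δ₀) {w : ℂ}
    (hw : ∀ t ∈ S.Δ₀, r < Metric.infDist (c t - w) S.σ₁) :
    ContinuousOn (fun t => Φ (c t - w)) S.Δ₀ :=
  hΦ.differentiableOn.continuousOn.comp (hc.sub continuousOn_const) hw

theorem integrableOn_shifted (hc : S.IsAdmissible (-1) c) (hΦ : S.IsExterior r Φ)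
    (hΨ : S.IsExterior r Ψ) (ψ : (H₁ →L[ℂ] H₁) →L[ℂ] ℂ) {w : ℂ} {M N r' : ℝ} (hr' : r < r')
    (hw : ∀ t ∈ S.Δ₀, r' ≤ Metric.infDist (c t - w) S.σ₁)
    (hM : ∀ z, r' ≤ Metric.infDist z S.σ₁ → ‖Φ z‖ ≤ M)
    (hN : ∀ z, r' ≤ Metric.infDist z S.σ₁ → ‖Ψ z‖ ≤ N) :
    AEStronglyMeasurable (fun t => deriv c t * S.shifted Φ Ψ ψ w (c t))
      (volume.restrict S.Δ₀) ∧
    (∀ t ∈ S.Δ₀, ‖deriv c t * S.shifted Φ Ψ ψ w (c t)‖ ≤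
      ‖ψ‖ * M * N * (‖deriv c t‖ * ‖S.K' (c t)‖)) ∧
    IntegrableOn (fun t => deriv c t * S.shifted Φ Ψ ψ w (c t)) S.Δ₀ := by
  have hI := S.isOpen_Δ₀.measurableSet
  have hcc := hc.continuousOn
  have h1 : AEStronglyMeasurable (fun t => deriv c t * S.shifted Φ Ψ ψ w (c t))
      (volume.restrict S.Δ₀) := by
    refine (measurable_deriv c).aestronglyMeasurable.mul
      (ContinuousOn.aestronglyMeasurable ?_ hI)
    refine ψ.continuous.comp_continuousOn ?_
    exact ((hΦ.continuousOn_comp hcc fun t ht => hr'.trans_le (hw t ht)).mul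
      hc.continuousOn_K').mul (hΨ.continuousOn_comp hcc fun t ht => hr'.trans_le (hw t ht))
  have h2 : ∀ t ∈ S.Δ₀, ‖deriv c t * S.shifted Φ Ψ ψ w (c t)‖ ≤
      ‖ψ‖ * M * N * (‖deriv c t‖ * ‖S.K' (c t)‖) := fun t ht => by
    have := norm_shifted_le (S := S) (ψ := ψ) (hM _ (hw t ht)) (hN _ (hw t ht))
    rw [norm_mul]
    calc _ ≤ ‖deriv c t‖ * (‖ψ‖ * M * N * ‖S.K' (c t)‖) := by gcongr
      _ = _ := by ring
  exact ⟨h1, h2, Integrable.mono' (hc.finite_variation.const_mul _) h1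
    ((ae_restrict_mem hI).mono h2)⟩

/-- For `w` in the half-strip the shifted points of the contour keep a distance larger than `r` from
`σ₁`, uniformly. There `Φ` and `Ψ` are holomorphic and bounded, so a multiple of the variation
density dominates the integrand. -/
theorem differentiableOn_integral_shifted (hc : S.IsAdmissible (-1) c) (hΦ : S.IsExterior r Φ)
    (hΨ : S.IsExterior r Ψ) (ψ : (H₁ →L[ℂ] H₁) →L[ℂ] ℂ) {η : ℝ} (hη : 0 < η)
    (hd : r + 2 * η < S.dist c) :
    DifferentiableOn ℂ (fun w => ∫ t in S.Δ₀, deriv c t * S.shifted Φ Ψ ψ w (c t))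
      (halfStrip η) := by
  have hI := S.isOpen_Δ₀.measurableSet
  set r' := S.dist c - 2 * η with hr'
  have hrr' : r < r' := by linarith
  obtain ⟨M, hM⟩ := hΦ.bounded r' hrr'
  obtain ⟨N, hN⟩ := hΨ.bounded r' hrr'
  have hw : ∀ w ∈ halfStrip η, ∀ t ∈ S.Δ₀,
      r' ≤ Metric.infDist (c t - w) S.σ₁ := fun w hw t ht => by
    have h1 := infDist_sub_ge (S := S) (hc.im_neg ht).le hη (abs_lt.2 hw.1) hw.2
    have h2 := S.dist_le c ht
    linarith
  refine differentiableOn_integral_of_bound (isOpen_halfStrip η) (bound := fun t =>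
    ‖ψ‖ * M * N * (‖deriv c t‖ * ‖S.K' (c t)‖)) (fun w h => ?_) ?_ ?_ ?_
  · exact (integrableOn_shifted hc hΦ hΨ ψ hrr' (hw w h) hM hN).1
  · exact hc.finite_variation.const_mul _
  · exact (ae_restrict_mem hI).mono fun t ht w h =>
      (integrableOn_shifted hc hΦ hΨ ψ hrr' (hw w h) hM hN).2.1 t ht
  · refine (ae_restrict_mem hI).mono fun t ht => ?_
    have hsub : MapsTo (fun w => c t - w) (halfStrip η)
        {z | r < Metric.infDist z S.σ₁} := fun w h => hrr'.trans_le (hw w h t ht)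
    have e1 := hΦ.differentiableOn.comp (differentiableOn_id.const_sub (c t)) hsub
    have e2 := hΨ.differentiableOn.comp (differentiableOn_id.const_sub (c t)) hsub
    exact (ψ.differentiable.comp_differentiableOn
      ((e1.mul (differentiableOn_const _)).mul e2)).const_mul _

/-- Once `Im w > r`, every `z` with `Im z ≤ 0` has `z - w` at distance at least `Im w` from `σ₁`.
The scalar integrand is then holomorphic on all of `D⁻` and at `Δ₀`, with the end point behaviour of
`K'`, and the deformation argument applies. -/
theorem integral_shifted_eq (hdec : S.DecayAtInfinity) (hc : S.IsAdmissible (-1) c)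
    (hc' : S.IsAdmissible (-1) c') (hσ : S.σ₁.Nonempty)
    (hw : S.left = ⊥ → S.right = ⊤ → ∃ w : ℂ, w.im < 0 ∧ w ∉ S.Dminus) (hΦ : S.IsExterior r Φ)
    (hΨ : S.IsExterior r Ψ) (ψ : (H₁ →L[ℂ] H₁) →L[ℂ] ℂ) {w : ℂ} (hr : r < w.im) :
    ∫ t in S.Δ₀, deriv c t * S.shifted Φ Ψ ψ w (c t) =
      ∫ t in S.Δ₀, deriv c' t * S.shifted Φ Ψ ψ w (c' t) := by
  obtain ⟨M, hM⟩ := hΦ.bounded _ hr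
  obtain ⟨N, hN⟩ := hΨ.bounded _ hr
  have him : ∀ z : ℂ, z.im ≤ 0 → w.im ≤ Metric.infDist (z - w) S.σ₁ := fun z hz => by
    have := neg_im_le_infDist S.im_eq_zero_of_mem_σ₁ hσ (z - w)
    simp only [Complex.sub_im] at this
    linarith
  have hd : ∀ z : ℂ, z.im ≤ 0 → AnalyticAt ℂ S.K' z → AnalyticAt ℂ (S.shifted Φ Ψ ψ w) z := by
    intro z hz hK
    have hopen : IsOpen {z | r < Metric.infDist z S.σ₁} :=
      isOpen_lt continuous_const (Metric.continuous_infDist_pt _)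
    have hmem : z - w ∈ {z | r < Metric.infDist z S.σ₁} := hr.trans_le (him z hz)
    have e1 : AnalyticAt ℂ (fun z => Φ (z - w)) z :=
      AnalyticAt.comp (g := Φ) (f := fun z => z - w)
        (hΦ.differentiableOn.analyticAt (hopen.mem_nhds hmem)) (by fun_prop)
    have e2 : AnalyticAt ℂ (fun z => Ψ (z - w)) z :=
      AnalyticAt.comp (g := Ψ) (f := fun z => z - w)
        (hΨ.differentiableOn.analyticAt (hopen.mem_nhds hmem)) (by fun_prop)
    exact AnalyticAt.comp (g := ψ) (ψ.analyticAt _) ((e1.mul hK).mul e2)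
  have hb : ∀ e, e = S.left ∨ e = S.right → EndBound S.Dminus (S.shifted Φ Ψ ψ w) e := by
    intro e he
    obtain ⟨t, ht⟩ := S.nonempty_Δ₀
    have hM0 : 0 ≤ M := (norm_nonneg _).trans (hM _ (him (c t) (hc.im_neg ht).le))
    have hN0 : 0 ≤ N := (norm_nonneg _).trans (hN _ (him (c t) (hc.im_neg ht).le))
    refine endBound_of_norm_le hdec (C₀ := ‖ψ‖ * M * N) (by positivity) (fun z hz => ?_) he
    have := him z (S.Dminus_subset z hz).le
    exact norm_shifted_le (hM _ this) (hN _ this)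
  obtain ⟨h, hh, hhc⟩ := hc.lowerDeformation
  obtain ⟨h', hh', hhc'⟩ := hc'.lowerDeformation
  obtain ⟨k, hk⟩ := hc.lipschitz
  obtain ⟨k', hk'⟩ := hc'.lipschitz
  refine integral_eq_of_lowerDeformation hh hh' hw (fun z hz => ?_) (fun t ht => ?_)
    (hb _ (Or.inl rfl)) (hb _ (Or.inr rfl)) hk hk' hhc hhc' ?_ ?_
  · exact (hd z (S.Dminus_subset z hz).le
      (S.analytic z (Or.inl (Or.inl hz)))).differentiableAt.differentiableWithinAt
  · exact hd t (by simp) (S.analytic t (Or.inl (Or.inr ⟨t, ht, rfl⟩)))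
  · exact (integrableOn_shifted hc hΦ hΨ ψ hr (fun t ht => him _ (hc.im_neg ht).le) hM hN).2.2
  · exact (integrableOn_shifted hc' hΦ hΨ ψ hr (fun t ht => him _ (hc'.im_neg ht).le) hM hN).2.2

theorem integrableOn_mul_density_mul {l : ℤˣ} (hc : S.IsAdmissible l c) (hΦ : S.IsExterior r Φ)
    (hΨ : S.IsExterior r Ψ) (hd : r < S.dist c) :
    IntegrableOn (fun t => Φ (c t) * S.density c t * Ψ (c t)) S.Δ₀ := by
  have hI := S.isOpen_Δ₀.measurableSet
  obtain ⟨M, hM⟩ := hΦ.bounded _ hd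
  obtain ⟨N, hN⟩ := hΨ.bounded _ hd
  have hrc : MapsTo c S.Δ₀ {z | r < Metric.infDist z S.σ₁} := fun t ht => hd.trans_le (S.dist_le c ht)
  refine Integrable.mono' ((hc.integrableOn_density.norm.const_mul M).mul_const N) ?_ ?_
  · exact (((hΦ.differentiableOn.continuousOn.comp hc.continuousOn hrc).aestronglyMeasurable
      hI).mul hc.aestronglyMeasurable_density).mul
      ((hΨ.differentiableOn.continuousOn.comp hc.continuousOn hrc).aestronglyMeasurable hI)
  · refine (ae_restrict_mem hI).mono fun t ht => ?_
    have h1 := hM _ (S.dist_le c ht)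
    have h2 := hN _ (S.dist_le c ht)
    have hM0 : 0 ≤ M := (norm_nonneg _).trans h1
    refine (norm_mul_le _ _).trans ?_
    gcongr
    refine (norm_mul_le _ _).trans ?_
    gcongr

/-- Independence of the contour in the lower domain. -/
theorem integral_density_eq_of_neg_one (hdec : S.DecayAtInfinity) (hc : S.IsAdmissible (-1) c)
    (hc' : S.IsAdmissible (-1) c') (hr : 0 ≤ r) (hΦ : S.IsExterior r Φ) (hΨ : S.IsExterior r Ψ)
    (hd : r < S.dist c) (hd' : r < S.dist c') :
    ∫ t in S.Δ₀, Φ (c t) * S.density c t * Ψ (c t) =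
      ∫ t in S.Δ₀, Φ (c' t) * S.density c' t * Ψ (c' t) := by
  by_cases hw : S.left = ⊥ → S.right = ⊤ → ∃ w : ℂ, w.im < 0 ∧ w ∉ S.Dminus
  swap
  -- Here `Δ₀` is the whole line and `D⁻` contains the lower half-plane, so no exterior point is
  -- available to tell the two ends apart; but then `K'` vanishes.
  · push Not at hw
    obtain ⟨h1, h2, h3⟩ := hw
    have h0 : ∀ c t, S.density c t = 0 := fun c t => by
      rw [density, S.K'_eq_zero hdec h1 h2 h3, smul_zero]
    simp [h0]
  have hσ : S.σ₁.Nonempty := by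
    obtain ⟨t, ht⟩ := S.nonempty_Δ₀
    by_contra h
    have := hd.trans_le (S.dist_le c ht)
    rw [not_nonempty_iff_eq_empty.1 h, Metric.infDist_empty] at this
    linarith
  obtain ⟨η, hη, hη1, hη2⟩ : ∃ η > 0, r + 2 * η < S.dist c ∧ r + 2 * η < S.dist c' := by
    refine ⟨min (S.dist c - r) (S.dist c' - r) / 4, ?_, ?_, ?_⟩
    · have : 0 < min (S.dist c - r) (S.dist c' - r) := lt_min (by linarith) (by linarith)
      positivity
    · linarith [min_le_left (S.dist c - r) (S.dist c' - r)]
    · linarith [min_le_right (S.dist c - r) (S.dist c' - r)]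
  refine (SeparatingDual.eq_iff_forall_dual_eq (R := ℂ)).2 fun ψ => ?_
  rw [← ψ.integral_comp_comm (integrableOn_mul_density_mul hc hΦ hΨ hd),
    ← ψ.integral_comp_comm (integrableOn_mul_density_mul hc' hΦ hΨ hd')]
  have e : ∀ c t, ψ (Φ (c t) * S.density c t * Ψ (c t)) =
      deriv c t * S.shifted Φ Ψ ψ 0 (c t) := fun c t => by
    rw [density, shifted, sub_zero, mul_smul_comm, smul_mul_assoc, map_smul, smul_eq_mul]
  simp only [e]
  -- At `w = 0` the integrand may be singular inside `D⁻`. Equality is known for `Im w > r` and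
  -- reaches `0` by the identity theorem on the half-strip.
  have a1 := (differentiableOn_integral_shifted hc hΦ hΨ ψ hη hη1).analyticOnNhd (isOpen_halfStrip η)
  have a2 := (differentiableOn_integral_shifted hc' hΦ hΨ ψ hη hη2).analyticOnNhd (isOpen_halfStrip η)
  have hw0 : ((r + 1 : ℝ) * Complex.I) ∈ halfStrip η := by
    simp [halfStrip, hη]; linarith
  refine a1.eqOn_of_preconnected_of_eventuallyEq a2 (isPreconnected_halfStrip η) hw0 ?_
    (show (0 : ℂ) ∈ halfStrip η by simp [halfStrip, hη])
  have hev : ∀ᶠ w : ℂ in 𝓝 ((r + 1 : ℝ) * Complex.I), r < w.im :=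
    Complex.continuous_im.continuousAt.eventually_const_lt (by simp)
  filter_upwards [hev] with w hw'
  exact integral_shifted_eq hdec hc hc' hσ hw hΦ hΨ ψ hw'

theorem star_integral_density {l : ℤˣ} (hc : S.IsContour l c) :
    star (∫ t in S.Δ₀, Φ (c t) * S.density c t * Ψ (c t)) =
      ∫ t in S.Δ₀, star (Ψ (conj (conj (c t)))) * S.density (fun t => conj (c t)) t *
        star (Φ (conj (conj (c t)))) := by
  rw [ResolventKernel.star_setIntegral]
  refine setIntegral_congr_fun S.isOpen_Δ₀.measurableSet fun t ht => ?_
  simp only [density_conj hc ht, star_mul, Complex.conj_conj, mul_assoc]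

/-- Independence of the contour. -/
theorem integral_density_eq {l : ℤˣ} (hc : S.IsAdmissible l c) (hc' : S.IsAdmissible l c')
    (hpair : (∀ t ∈ S.Δ₀, c t = c' t) ∨ S.DecayAtInfinity) (hr : 0 ≤ r) (hΦ : S.IsExterior r Φ)
    (hΨ : S.IsExterior r Ψ) (hd : r < S.dist c) (hd' : r < S.dist c') :
    ∫ t in S.Δ₀, Φ (c t) * S.density c t * Ψ (c t) =
      ∫ t in S.Δ₀, Φ (c' t) * S.density c' t * Ψ (c' t) := by
  rcases hpair with heq | hdec
  · refine setIntegral_congr_fun S.isOpen_Δ₀.measurableSet fun t ht => ?_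
    have h1 : c =ᶠ[𝓝 t] c' := by
      filter_upwards [S.isOpen_Δ₀.mem_nhds ht] with s hs using heq s hs
    simp only [density, h1.deriv_eq, heq t ht]
  rcases Int.units_eq_one_or l with rfl | rfl
  -- Taking adjoints reflects the upper contours into the lower domain and interchanges the roles of
  -- `Φ` and `Ψ`.
  · refine star_injective ?_
    rw [star_integral_density hc.toIsContour, star_integral_density hc'.toIsContour]
    exact integral_density_eq_of_neg_one (Φ := fun z => star (Ψ (conj z)))
      (Ψ := fun z => star (Φ (conj z))) hdec hc.conj hc'.conj hr hΨ.star_conj hΦ.star_conj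
      (by rwa [dist_conj]) (by rwa [dist_conj])
  · exact integral_density_eq_of_neg_one hdec hc hc' hr hΦ hΨ hd hd'

end Independence

end Setting

/-! ### From intertwined resolvents to similarity, domains included -/

section Intertwining

variable {H : Type*} [NormedAddCommGroup H] [InnerProductSpace ℂ H] {T T' : H →ₗ.[ℂ] H}
  {V R Q : H →L[ℂ] H} {z : ℂ}

theorem shift_apply (T : H →ₗ.[ℂ] H) (z : ℂ) (x : (shift T z).domain) :
    shift T z x = T ⟨x, x.2⟩ - z • (x : H) := by
  change (-(z • (1 : H →L[ℂ] H))) (x : H) + T ⟨x, x.2⟩ = _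
  simp only [neg_apply, smul_apply, one_apply_eq_self]
  abel

/-- The hypothesis reads `V⁻¹ Q = R V⁻¹`. With `u = (T' - z) x`, so that `x = Q u`, it follows that
`V⁻¹ x = R (V⁻¹ u)` lies in the domain of `T`, and `T - z` maps it to `V⁻¹ u`. -/
theorem inverse_mem_domain (hR : IsBoundedInverse (shift T z) R)
    (hQ : IsBoundedInverse (shift T' z) Q) (hV : IsUnit V) (h : Q * V = V * R) {x : H}
    (hx : x ∈ T'.domain) :
    ∃ h : Ring.inverse V x ∈ T.domain, T ⟨_, h⟩ = Ring.inverse V (T' ⟨x, hx⟩) := by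
  set W := Ring.inverse V with hW
  have hWV : W * V = 1 := Ring.inverse_mul_cancel V hV
  have hVW : V * W = 1 := Ring.mul_inverse_cancel V hV
  have hc : W * Q = R * W := by
    calc W * Q = W * (Q * V) * W := by rw [mul_assoc, mul_assoc, hVW, mul_one]
      _ = R * W := by rw [h, ← mul_assoc, hWV, one_mul]
  have h1 := hQ.1 ⟨x, hx⟩
  rw [shift_apply] at h1
  set u := T' ⟨x, hx⟩ - z • x with hu
  have h2 : W x = R (W u) := by
    have := DFunLike.congr_fun hc u
    simp only [mul_apply_eq_comp] at this
    rw [← this]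
    exact congrArg W h1.symm
  obtain ⟨hd, e⟩ := hR.2 (W u)
  rw [shift_apply] at e
  generalize R (W u) = y at h2 hd e
  subst h2
  have hd' : W x ∈ T.domain := hd
  have e' : T ⟨W x, hd'⟩ - z • W x = W u := e
  exact ⟨hd', by rw [sub_eq_iff_eq_add.1 e', hu, map_sub, map_smul, sub_add_cancel]⟩

/-- If `V⁻¹ x = R v`, then `x = V R v = Q V v` lies in the range of `Q`. -/
theorem mem_domain_of_inverse_mem (hR : IsBoundedInverse (shift T z) R)
    (hQ : IsBoundedInverse (shift T' z) Q) (hV : IsUnit V) (h : Q * V = V * R) {x : H}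
    (hx : Ring.inverse V x ∈ T.domain) : x ∈ T'.domain := by
  have hVW : V * Ring.inverse V = 1 := Ring.mul_inverse_cancel V hV
  have h1 := hR.1 ⟨_, hx⟩
  set v := shift T z ⟨_, hx⟩
  obtain ⟨hd, -⟩ := hQ.2 (V v)
  have h2 : Q (V v) = V (R v) := DFunLike.congr_fun h v
  rw [h2, h1, show V (Ring.inverse V x) = x from DFunLike.congr_fun hVW x] at hd
  exact hd

theorem boundedMul_inverse_eq (hR : IsBoundedInverse (shift T z) R)
    (hQ : IsBoundedInverse (shift T' z) Q) (hV : IsUnit V) (h : Q * V = V * R) :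
    boundedMul (Ring.inverse V) T' = mulBounded T (Ring.inverse V) := by
  refine LinearPMap.ext (Submodule.ext fun x => ⟨fun hx => ?_, fun hx => ?_⟩) fun x hx hx' => ?_
  · exact (inverse_mem_domain hR hQ hV h hx).choose
  · exact mem_domain_of_inverse_mem hR hQ hV h hx
  · exact (inverse_mem_domain hR hQ hV h hx).choose_spec.symm

theorem similar_of_intertwining (hR : IsBoundedInverse (shift T z) R)
    (hQ : IsBoundedInverse (shift T' z) Q) (hV : IsUnit V) (h : Q * V = V * R) :
    Similar T T' := by
  have hWV (x) : Ring.inverse V (V x) = x := DFunLike.congr_fun (Ring.inverse_mul_cancel V hV) x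
  have hVW (x) : V (Ring.inverse V x) = x := DFunLike.congr_fun (Ring.mul_inverse_cancel V hV) x
  refine ⟨ContinuousLinearEquiv.equivOfInverse V (Ring.inverse V) hWV hVW, fun x y => ?_⟩
  rw [LinearPMap.mem_graph_iff, LinearPMap.mem_graph_iff]
  simp only [ContinuousLinearEquiv.equivOfInverse_apply]
  constructor
  · rintro ⟨⟨x, hx⟩, rfl, rfl⟩
    have hd : V x ∈ T'.domain := mem_domain_of_inverse_mem hR hQ hV h (by rwa [hWV])
    refine ⟨⟨V x, hd⟩, rfl, ?_⟩
    obtain ⟨h1, h2⟩ := inverse_mem_domain hR hQ hV h hd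
    rw [← hVW (T' ⟨V x, hd⟩), ← h2]
    congr 2
    simp only [hWV]
  · rintro ⟨⟨x', hx'⟩, h1, h2⟩
    obtain ⟨h3, h4⟩ := inverse_mem_domain hR hQ hV h hx'
    simp only at h1
    have h5 : Ring.inverse V x' = x := by rw [h1, hWV]
    refine ⟨⟨x, h5 ▸ h3⟩, rfl, ?_⟩
    rw [h2, hWV] at h4
    rw [← h4]
    congr 2
    exact h5.symm

end Intertwining

/-! ### The equations for both contours and the adjoint of `Ω` -/

namespace Setting

variable {H₀ H₁ : Type*} [NormedAddCommGroup H₀] [InnerProductSpace ℂ H₀] [CompleteSpace H₀]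
  [NormedAddCommGroup H₁] [InnerProductSpace ℂ H₁] [CompleteSpace H₁] {S : Setting H₀ H₁}

open ResolventKernel

theorem variation_conj {l : ℤˣ} {c : ℝ → ℂ} (hc : S.IsContour l c) :
    S.variation (fun t => conj (c t)) = S.variation c := by
  rw [variation_eq, variation_eq]
  refine setIntegral_congr_fun S.isOpen_Δ₀.measurableSet fun t ht => ?_
  simp only [density_conj hc ht, norm_star]

theorem IsAdmissible.resolventKernel {l : ℤˣ} {c : ℝ → ℂ} (hc : S.IsAdmissible l c)
    (hV : S.variation c < 1 / 4 * S.dist c ^ 2) :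
    ResolventKernel S.A₁ S.Δ₀ c (S.density c) (S.dist c) where
  isSelfAdjoint := S.selfAdjoint₁
  isOpen := S.isOpen_Δ₀
  nonempty := S.nonempty_Δ₀
  continuousOn := hc.continuousOn
  integrableOn := hc.integrableOn_density
  le_infDist := fun _ ht => S.dist_le c ht
  pos := by
    have h1 : 0 ≤ S.variation c := by rw [variation_eq]; positivity
    refine lt_of_le_of_ne (S.dist_nonneg c) fun h => ?_
    rw [← h] at hV
    linarith
  variation_lt := by
    rw [← variation_eq]; linarith

theorem W₁op_eq (c : ℝ → ℂ) (X : H₁ →L[ℂ] H₁) :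
    S.W₁op c (addBounded S.A₁ X) = rightMap S.A₁ S.Δ₀ c (S.density c) X := by
  rw [W₁op, rightMap]
  simp only [density, smul_mul_assoc]
  rfl

theorem IsRootPart.norm_lt_half {l : ℤˣ} {c : ℝ → ℂ} (hc : S.IsAdmissible l c)
    (hV : S.variation c < 1 / 4 * S.dist c ^ 2) {X : H₁ →L[ℂ] H₁} (hX : S.IsRootPart c X) :
    ‖X‖ < S.dist c / 2 := by
  have h1 := hX.norm_lt
  have h2 := hX.equation
  rw [variation_eq] at h1
  rw [W₁op_eq] at h2
  exact (hc.resolventKernel hV).norm_lt_half h1 h2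

/-- The resolvent of `A₁ + X` is holomorphic off the `‖X‖`-neighbourhood of `σ₁` and bounded off
larger ones, so contour independence applies with `r = ‖X‖`. -/
theorem rightMap_eq {l : ℤˣ} {c c' : ℝ → ℂ} (hc : S.IsAdmissible l c) (hc' : S.IsAdmissible l c')
    (hpair : (∀ t ∈ S.Δ₀, c t = c' t) ∨ S.DecayAtInfinity) {X : H₁ →L[ℂ] H₁}
    (hX : ‖X‖ < S.dist c) (hX' : ‖X‖ < S.dist c') :
    rightMap S.A₁ S.Δ₀ c (S.density c) X = rightMap S.A₁ S.Δ₀ c' (S.density c') X := by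
  have := integral_density_eq hc hc' hpair (norm_nonneg X) (isExterior_const _ 1)
    (isExterior_resolventOp le_rfl) hX hX'
  simp only [one_mul] at this
  rw [rightMap, rightMap, this]

/-- The adjoint of the root for the opposite contour solves the left equation. -/
theorem IsRootPart.star_eq_leftMap {l : ℤˣ} {c c' : ℝ → ℂ} (hc : S.IsAdmissible l c)
    (hc' : S.IsAdmissible (-l) c') (hV : S.variation c < 1 / 4 * S.dist c ^ 2)
    (hV' : S.variation c' < 1 / 4 * S.dist c' ^ 2)
    (hpair : (∀ t ∈ S.Δ₀, c' t = conj (c t)) ∨ S.DecayAtInfinity) {X : H₁ →L[ℂ] H₁}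
    (hX : S.IsRootPart c' X) :
    ‖X‖ < S.dist c / 2 ∧ star X = leftMap S.A₁ S.Δ₀ c (S.density c) (star X) := by
  have hVc : S.variation (fun t => conj (c t)) <
      1 / 4 * S.dist (fun t => conj (c t)) ^ 2 := by
    rwa [variation_conj hc.toIsContour, dist_conj]
  have hpair' : (∀ t ∈ S.Δ₀, conj (c t) = c' t) ∨ S.DecayAtInfinity :=
    hpair.imp (fun h t ht => (h t ht).symm) id
  have hK := hc.resolventKernel hV
  have hK' := hc'.resolventKernel hV'
  have hKc := hc.conj.resolventKernel hVc
  have hXn := hX.norm_lt_half hc' hV'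
  have hXe : X = rightMap S.A₁ S.Δ₀ c' (S.density c') X := by
    rw [← W₁op_eq]; exact hX.equation
  have key : ‖X‖ < S.dist c / 2 ∧
      X = rightMap S.A₁ S.Δ₀ (fun t => conj (c t)) (S.density fun t => conj (c t)) X := by
    have hd := hK.pos
    have hd' := hK'.pos
    -- If `c` is the closer contour, the bound on `‖X‖` by `c` is not immediate. A solution `Y` is
    -- then constructed on the mirror image of `c`, transferred to `c'`, and identified with `X` by
    -- uniqueness there. In the other case `X` itself can be transferred.
    rcases le_total (S.dist c) (S.dist c') with hle | hle
    · obtain ⟨Y, hY, hYe⟩ := hKc.exists_eq_rightMap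
      rw [dist_conj] at hY
      have hYe' : Y = rightMap S.A₁ S.Δ₀ c' (S.density c') Y := by
        rw [← rightMap_eq hc.conj hc' hpair' (by rw [dist_conj]; linarith) (by linarith)]
        exact hYe
      have : X = Y := hK'.eq_of_eq_rightMap hXn (by linarith) hXe hYe'
      rw [this]
      exact ⟨hY, hYe⟩
    · refine ⟨by linarith, ?_⟩
      rw [rightMap_eq hc.conj hc' hpair' (by rw [dist_conj]; linarith) (by linarith)]
      exact hXe
  refine ⟨key.1, ?_⟩
  rw [← hK.star_rightMap_conj (by linarith [key.1, hK.pos])]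
  conv_lhs => rw [key.2]
  congr 1
  rw [rightMap, rightMap]
  congr 1
  refine setIntegral_congr_fun S.isOpen_Δ₀.measurableSet fun t ht => ?_
  simp only [density_conj hc.toIsContour ht]

theorem adjoint_Z (X : H₁ →L[ℂ] H₁) : (S.Z X).adjoint = addBounded S.A₁ (star X) := by
  rw [Z, adjoint_addBounded S.selfAdjoint₁.dense_domain,
    LinearPMap.isSelfAdjoint_def.1 S.selfAdjoint₁]
  rfl

theorem omegaIntegrand_eq (c : ℝ → ℂ) (X Y : H₁ →L[ℂ] H₁) (t : ℝ) :
    S.omegaIntegrand c X Y t = resolventOp (addBounded S.A₁ (star Y)) (c t) * S.density c t *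
      resolventOp (addBounded S.A₁ X) (c t) := by
  rw [omegaIntegrand, adjoint_Z, density, mul_smul_comm, smul_mul_assoc, mul_assoc]
  rfl

theorem Omega_eq (Γ : ℤˣ → ℝ → ℂ) (X : ℤˣ → H₁ →L[ℂ] H₁) (l : ℤˣ) :
    S.Omega Γ X l = omega S.A₁ S.Δ₀ (Γ l) (S.density (Γ l)) (X l) (star (X (-l))) := by
  simp only [Omega, omega, omegaIntegrand_eq]

section Main

variable {Γ : ℤˣ → ℝ → ℂ} {X : ℤˣ → H₁ →L[ℂ] H₁}

theorem pair_neg (hpair : (∀ t ∈ S.Δ₀, Γ (-1) t = conj (Γ 1 t)) ∨ S.DecayAtInfinity) (l : ℤˣ) :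
    (∀ t ∈ S.Δ₀, Γ (-l) t = conj (Γ l t)) ∨ S.DecayAtInfinity := by
  rcases Int.units_eq_one_or l with rfl | rfl
  · exact hpair
  · refine hpair.imp (fun h t ht => ?_) id
    rw [h t ht, neg_neg, Complex.conj_conj]

/-- The adjoint reflects `Γ l` and interchanges the two resolvents, which gives the integrand of the
opposite `Ω` on the mirror image of `Γ l`; contour independence moves it to `Γ (-l)`. -/
theorem star_Omega (hΓ : ∀ l, S.IsAdmissible l (Γ l))
    (hbound : ∀ l, S.variation (Γ l) < 1 / 4 * S.dist (Γ l) ^ 2)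
    (hpair : (∀ t ∈ S.Δ₀, Γ (-1) t = conj (Γ 1 t)) ∨ S.DecayAtInfinity)
    (hX : ∀ l, S.IsRootPart (Γ l) (X l)) (l : ℤˣ) : S.Omega Γ X (-l) = star (S.Omega Γ X l) := by
  have h1 := (hX l).norm_lt_half (hΓ l) (hbound l)
  have h2 := (hX (-l)).norm_lt_half (hΓ (-l)) (hbound (-l))
  have h3 := ((hX (-l)).star_eq_leftMap (hΓ l) (hΓ (-l)) (hbound l) (hbound (-l))
    (pair_neg hpair l)).1
  have h4 : ‖X l‖ < S.dist (Γ (-l)) / 2 := by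
    have h := pair_neg hpair (-l)
    have hΓ' := hΓ (-(-l))
    have hb' := hbound (-(-l))
    have hX' := hX (-(-l))
    have := (hX'.star_eq_leftMap (hΓ (-l)) hΓ' (hbound (-l)) hb' h).1
    rwa [neg_neg] at this
  have hK := (hΓ l).resolventKernel (hbound l)
  have hK' := (hΓ (-l)).resolventKernel (hbound (-l))
  have hd := hK.pos
  have hd' := hK'.pos
  rw [Omega_eq, Omega_eq, hK.star_omega (by linarith) (by rw [norm_star]; linarith), star_star,
    neg_neg, omega, omega]
  have h5 : (∀ t ∈ S.Δ₀, Γ (-l) t = conj (Γ l t)) ∨ S.DecayAtInfinity := pair_neg hpair l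
  -- The larger of the two norms serves as radius, since both resolvents must be holomorphic outside
  -- the same neighbourhood of `σ₁`.
  rw [integral_density_eq (Φ := resolventOp (addBounded S.A₁ (star (X l))))
    (Ψ := resolventOp (addBounded S.A₁ (X (-l)))) (r := max ‖X l‖ ‖X (-l)‖) (hΓ (-l)) (hΓ l).conj h5
    (le_max_of_le_left (norm_nonneg _))
    (isExterior_resolventOp (by rw [norm_star]; exact le_max_left _ _))
    (isExterior_resolventOp (le_max_right _ _)) (max_lt (by linarith) (by linarith))
    (by rw [dist_conj]; exact max_lt (by linarith) (by linarith))]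
  refine setIntegral_congr_fun S.isOpen_Δ₀.measurableSet fun t ht => ?_
  simp only [density_conj (hΓ l).toIsContour ht]

end Main

end Setting

/-! ### Multiplicativity of projection-valued measures -/

namespace ProjectionMeasure

variable {H : Type*} [NormedAddCommGroup H] [InnerProductSpace ℂ H] [CompleteSpace H]
  (E : ProjectionMeasure H)

theorem scalar_apply (x : H) {s : Set ℝ} (hs : MeasurableSet s) :
    E.scalar x s = ENNReal.ofReal (‖E.proj s x‖ ^ 2) :=
  Measure.ofMeasurable_apply s hs

theorem scalar_univ (x : H) : E.scalar x Set.univ = ENNReal.ofReal (‖x‖ ^ 2) := by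
  rw [scalar_apply E x MeasurableSet.univ, E.univ]
  rfl

theorem isFiniteMeasure_scalar (x : H) : IsFiniteMeasure (E.scalar x) :=
  ⟨by rw [scalar_univ]; exact ENNReal.ofReal_lt_top⟩

theorem proj_union {s t : Set ℝ} (hs : MeasurableSet s) (ht : MeasurableSet t)
    (hd : Disjoint s t) : E.proj (s ∪ t) = E.proj s + E.proj t := by
  ext x
  set f : ℕ → Set ℝ := fun n => if n = 0 then s else if n = 1 then t else ∅ with hf
  have hU : ⋃ n, f n = s ∪ t := by
    ext y
    simp only [mem_iUnion, hf]
    constructor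
    · rintro ⟨n, hn⟩
      split_ifs at hn
      · exact Or.inl hn
      · exact Or.inr hn
      · exact hn.elim
    · rintro (h | h)
      · exact ⟨0, by simpa using h⟩
      · exact ⟨1, by simpa using h⟩
  have hm : ∀ n, MeasurableSet (f n) := fun n => by
    simp only [hf]
    split_ifs
    exacts [hs, ht, MeasurableSet.empty]
  have hp : Pairwise (Function.onFun Disjoint f) := fun m n hmn => by
    simp only [Function.onFun, hf]
    split_ifs with h1 h2 h3 h4 h5 h6 <;> first | exact hd | exact hd.symm | simp
    all_goals exact absurd (by omega) hmn
  have h1 := E.hasSum f hm hp x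
  rw [hU] at h1
  have h2 : HasSum (fun n => E.proj (f n) x) (∑ n ∈ Finset.range 2, E.proj (f n) x) := by
    refine hasSum_sum_of_ne_finset_zero fun n hn => ?_
    have hn' : 1 < n := by simpa using hn
    simp [hf, show n ≠ 0 by omega, show n ≠ 1 by omega, E.empty]
  rw [h1.unique h2]
  simp [Finset.sum_range_succ, hf]

theorem proj_compl {s : Set ℝ} (hs : MeasurableSet s) : E.proj sᶜ = 1 - E.proj s := by
  have := E.proj_union hs hs.compl disjoint_compl_right
  rw [union_compl_self, E.univ] at this
  rw [this, add_sub_cancel_left]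

/-- `P + Q` is again idempotent, so `P Q + Q P = 0`. Multiplying by `P` on either side gives `P Q =
-P Q P = Q P`, hence `2 P Q = 0`. -/
theorem proj_mul_proj_of_disjoint {s t : Set ℝ} (hs : MeasurableSet s) (ht : MeasurableSet t)
    (hd : Disjoint s t) : E.proj s * E.proj t = 0 := by
  have h1 := (E.isStarProjection s hs).isIdempotentElem.eq
  have h2 := (E.isStarProjection t ht).isIdempotentElem.eq
  have h3 := (E.isStarProjection _ (hs.union ht)).isIdempotentElem.eq
  rw [E.proj_union hs ht hd] at h3
  set P := E.proj s
  set Q := E.proj t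
  have h4 : P * Q + Q * P = 0 := by
    have : (P + Q) * (P + Q) = P * P + Q * Q + (P * Q + Q * P) := by noncomm_ring
    rw [this, h1, h2] at h3
    exact left_eq_add.1 h3.symm
  have h5 : P * Q + P * Q * P = 0 := by
    have := congrArg (P * ·) h4
    simpa only [mul_add, ← mul_assoc, h1, mul_zero] using this
  have h6 : P * Q * P + Q * P = 0 := by
    have := congrArg (· * P) h4
    simpa only [add_mul, mul_assoc, h1, zero_mul] using this
  have h7 : (2 : ℂ) • (P * Q) = 0 := by
    linear_combination (norm := module) h5 - h6 + h4
  exact (smul_eq_zero.1 h7).resolve_left two_ne_zero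

theorem proj_mul_proj {s t : Set ℝ} (hs : MeasurableSet s) (ht : MeasurableSet t) :
    E.proj s * E.proj t = E.proj (s ∩ t) := by
  have e1 : E.proj s = E.proj (s ∩ t) + E.proj (s \ t) := by
    rw [← E.proj_union (hs.inter ht) (hs.diff ht)
      (disjoint_sdiff_right.mono_left inter_subset_right), inter_union_sdiff]
  have e2 : E.proj t = E.proj (s ∩ t) + E.proj (t \ s) := by
    rw [← E.proj_union (hs.inter ht) (ht.diff hs)
      (disjoint_sdiff_right.mono_left inter_subset_left), inter_comm, inter_union_sdiff]
  have h1 := E.proj_mul_proj_of_disjoint (hs.inter ht) (ht.diff hs)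
    (disjoint_sdiff_right.mono_left inter_subset_left)
  have h2 := E.proj_mul_proj_of_disjoint (hs.diff ht) (hs.inter ht)
    (disjoint_sdiff_left.mono_right inter_subset_right)
  have h3 := E.proj_mul_proj_of_disjoint (hs.diff ht) (ht.diff hs)
    (disjoint_left.2 fun x hx hx' => hx.2 hx'.1)
  rw [e1, e2, mul_add, add_mul, add_mul, h1, h2, h3,
    (E.isStarProjection _ (hs.inter ht)).isIdempotentElem.eq]
  simp

theorem inner_proj_eq_zero {s t : Set ℝ} (hs : MeasurableSet s) (ht : MeasurableSet t)
    (hd : Disjoint s t) (x y : H) : inner ℂ (E.proj s x) (E.proj t y) = 0 := by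
  have h1 : ContinuousLinearMap.adjoint (E.proj s) = E.proj s := (E.isStarProjection s hs).isSelfAdjoint
  rw [← ContinuousLinearMap.adjoint_inner_right, h1, ← mul_apply_eq_comp,
    E.proj_mul_proj_of_disjoint hs ht hd]
  simp

/-- The scalar measure of a sum of vectors from complementary spectral subspaces. -/
theorem scalar_add {s : Set ℝ} (hs : MeasurableSet s) (x y : H) :
    E.scalar (E.proj s x + E.proj sᶜ y) = (E.scalar x).restrict s + (E.scalar y).restrict sᶜ := by
  ext t ht
  rw [Measure.add_apply, Measure.restrict_apply ht, Measure.restrict_apply ht, scalar_apply E _ ht,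
    scalar_apply E _ (ht.inter hs), scalar_apply E _ (ht.inter hs.compl),
    ← ENNReal.ofReal_add (by positivity) (by positivity)]
  congr 1
  have h1 : E.proj t (E.proj s x + E.proj sᶜ y) = E.proj (t ∩ s) x + E.proj (t ∩ sᶜ) y := by
    rw [map_add, ← mul_apply_eq_comp, ← mul_apply_eq_comp, E.proj_mul_proj ht hs,
      E.proj_mul_proj ht hs.compl]
  rw [h1, sq, sq, sq]
  refine norm_add_sq_eq_norm_sq_add_norm_sq_of_inner_eq_zero (𝕜 := ℂ) _ _ ?_
  exact E.inner_proj_eq_zero (ht.inter hs) (ht.inter hs.compl)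
    (disjoint_compl_right.mono inter_subset_right inter_subset_right) x y

theorem scalar_proj {s : Set ℝ} (hs : MeasurableSet s) (x : H) :
    E.scalar (E.proj s x) = (E.scalar x).restrict s := by
  have h0 : E.scalar 0 = 0 := by
    ext t ht
    rw [scalar_apply E _ ht]
    simp
  have := E.scalar_add hs x 0
  rwa [map_zero, add_zero, h0, Measure.restrict_zero, add_zero] at this

end ProjectionMeasure

/-! ### Spectral subspaces of a self-adjoint operator -/

namespace IsSpectralMeasure

variable {H : Type*} [NormedAddCommGroup H] [InnerProductSpace ℂ H] [CompleteSpace H]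
  {A : H →ₗ.[ℂ] H} {E : ProjectionMeasure H}

theorem proj_mem_domain (hE : IsSpectralMeasure A E) {s : Set ℝ} (hs : MeasurableSet s) {x : H}
    (hx : x ∈ A.domain) : E.proj s x ∈ A.domain := by
  rw [hE.mem_domain] at hx ⊢
  rw [E.scalar_proj hs]
  exact (lintegral_mono' Measure.restrict_le_self le_rfl).trans_lt hx

theorem proj_mem_domain_of_bounded (hE : IsSpectralMeasure A E) {s : Set ℝ} (hs : MeasurableSet s)
    {C : ℝ} (hC : ∀ t ∈ s, t ^ 2 ≤ C) (x : H) : E.proj s x ∈ A.domain := by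
  rw [hE.mem_domain, E.scalar_proj hs]
  have := E.isFiniteMeasure_scalar x
  refine (setLIntegral_mono (g := fun _ => ENNReal.ofReal C) measurable_const fun t ht =>
    ENNReal.ofReal_le_ofReal (hC t ht)).trans_lt ?_
  rw [setLIntegral_const]
  exact ENNReal.mul_lt_top ENNReal.ofReal_lt_top (measure_lt_top _ _)

theorem integrable_id (hE : IsSpectralMeasure A E) {x : H} (hx : x ∈ A.domain) :
    Integrable (fun t : ℝ => t) (E.scalar x) := by
  have := E.isFiniteMeasure_scalar x
  have h1 : Integrable (fun t : ℝ => t ^ 2) (E.scalar x) := by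
    refine ⟨by fun_prop, ?_⟩
    rw [hasFiniteIntegral_iff_ofReal (Eventually.of_forall fun t => sq_nonneg t)]
    exact (hE.mem_domain x).1 hx
  refine Integrable.mono' (h1.add (integrable_const 1)) (by fun_prop)
    (Eventually.of_forall fun t => ?_)
  simp only [Pi.add_apply, Real.norm_eq_abs]
  rw [abs_le]
  constructor <;> nlinarith [sq_nonneg (t - 1), sq_nonneg (t + 1)]

theorem inner_symm (hA : IsSelfAdjoint A) (x y : A.domain) :
    inner ℂ (A x) (y : H) = inner ℂ (x : H) (A y) := by
  have h := A.adjoint_isFormalAdjoint hA.dense_domain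
  rw [LinearPMap.isSelfAdjoint_def.1 hA] at h
  exact h x y

variable {s : Set ℝ}

/-- `A` has no matrix elements between complementary spectral subspaces. -/
theorem re_inner_eq_zero (hA : IsSelfAdjoint A) (hE : IsSpectralMeasure A E)
    (hs : MeasurableSet s) {x y : H} (hx : E.proj s x ∈ A.domain) (hy : E.proj sᶜ y ∈ A.domain) :
    (inner ℂ (E.proj sᶜ y) (A ⟨_, hx⟩)).re = 0 := by
  have hadd : E.proj s x + E.proj sᶜ y ∈ A.domain := A.domain.add_mem hx hy
  -- Scalar measures add over complementary subspaces, and with them the quadratic form. The sum of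
  -- the cross terms is therefore zero, and by symmetry of `A` these terms are conjugate to each
  -- other.
  have h1 := hE.inner_eq ⟨_, hadd⟩
  have h2 := hE.inner_eq ⟨_, hx⟩
  have h3 := hE.inner_eq ⟨_, hy⟩
  have i2 := hE.integrable_id hx
  have i3 := hE.integrable_id hy
  simp only [E.scalar_add hs, E.scalar_proj hs, E.scalar_proj hs.compl] at h1 h2 h3 i2 i3
  rw [integral_add_measure i2 i3, Complex.ofReal_add, ← h2, ← h3] at h1
  have h4 : A ⟨E.proj s x + E.proj sᶜ y, hadd⟩ = A ⟨_, hx⟩ + A ⟨_, hy⟩ :=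
    A.map_add ⟨_, hx⟩ ⟨_, hy⟩
  rw [h4, inner_add_left, inner_add_right, inner_add_right] at h1
  have h5 := inner_symm hA ⟨_, hx⟩ ⟨_, hy⟩
  simp only at h5
  have h6 := inner_conj_symm (𝕜 := ℂ) (A ⟨_, hx⟩) (E.proj sᶜ y)
  have h7 : inner ℂ (E.proj s x) (A ⟨_, hy⟩) + inner ℂ (E.proj sᶜ y) (A ⟨_, hx⟩) = 0 := by
    linear_combination h1
  rw [← h5, ← h6] at h7
  have := congrArg Complex.re h7
  rw [Complex.add_re, Complex.conj_re, Complex.zero_re] at this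
  linarith

/-- Replacing `y` by `i y` upgrades the vanishing real part of the matrix elements to full
orthogonality, and density of the domain kills the component in the complementary subspace. -/
theorem proj_apply_eq (hA : IsSelfAdjoint A) (hE : IsSpectralMeasure A E)
    (hs : MeasurableSet s) {x : H} (hx : E.proj s x ∈ A.domain) :
    E.proj s (A ⟨_, hx⟩) = A ⟨_, hx⟩ := by
  have h1 : ∀ y ∈ A.domain, inner ℂ (E.proj sᶜ y) (A ⟨_, hx⟩) = 0 := by
    intro y hy
    have hy' := hE.proj_mem_domain hs.compl hy
    have hIy : E.proj sᶜ (Complex.I • y) ∈ A.domain := by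
      rw [map_smul]; exact A.domain.smul_mem _ hy'
    have e1 := re_inner_eq_zero hA hE hs hx hy'
    have e2 := re_inner_eq_zero hA hE hs hx hIy
    rw [map_smul, inner_smul_left] at e2
    simp at e2
    exact Complex.ext e1 e2
  have h2 : E.proj sᶜ (A ⟨_, hx⟩) = 0 := by
    refine hA.dense_domain.eq_zero_of_inner_right ℂ fun y hy => ?_
    have h3 : ContinuousLinearMap.adjoint (E.proj sᶜ) = E.proj sᶜ :=
      (E.isStarProjection _ hs.compl).isSelfAdjoint
    rw [← h3, ContinuousLinearMap.adjoint_inner_right]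
    exact h1 y hy
  rw [E.proj_compl hs] at h2
  exact (sub_eq_zero.1 h2).symm

/-- The quadratic form of `A - t₀` on a spectral subspace near `t₀`. -/
theorem abs_re_inner_sub_le (hE : IsSpectralMeasure A E) (hs : MeasurableSet s) {t₀ δ : ℝ}
    (hδ : ∀ t ∈ s, |t - t₀| ≤ δ) {x : H} (hx : E.proj s x ∈ A.domain) :
    |(inner ℂ (E.proj s x) (A ⟨_, hx⟩)).re - t₀ * ‖E.proj s x‖ ^ 2| ≤ δ * ‖E.proj s x‖ ^ 2 := by
  have := E.isFiniteMeasure_scalar x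
  have h1 := hE.inner_eq ⟨_, hx⟩
  have i1 := hE.integrable_id hx
  simp only [E.scalar_proj hs] at h1 i1
  have h2 : (E.scalar x).real s = ‖E.proj s x‖ ^ 2 := by
    rw [Measure.real, E.scalar_apply x hs, ENNReal.toReal_ofReal (by positivity)]
  rw [h1, Complex.ofReal_re]
  have h3 : ∫ t in s, (t - t₀) ∂(E.scalar x) = (∫ t in s, t ∂(E.scalar x)) - t₀ * ‖E.proj s x‖ ^ 2 := by
    rw [integral_sub i1 (integrable_const _), setIntegral_const, h2, smul_eq_mul, mul_comm]
  rw [← h3, ← h2, ← Real.norm_eq_abs]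
  exact norm_setIntegral_le_of_norm_le_const (measure_lt_top _ _) hδ

/-- The spectral measure is tied to `A` only through the quadratic form, so an operator bound has to
be recovered by polarization: with `u = E(s) x` and `w = (A - t₀) u`, the form of `A - t₀` is
compared at `u + δ⁻¹ w` and `u - δ⁻¹ w`. -/
theorem norm_sub_le (hA : IsSelfAdjoint A) (hE : IsSpectralMeasure A E)
    (hs : MeasurableSet s) {t₀ δ : ℝ} (hδ0 : 0 < δ) (hδ : ∀ t ∈ s, |t - t₀| ≤ δ) (x : H) :
    ∃ hx : E.proj s x ∈ A.domain, ‖A ⟨_, hx⟩ - (t₀ : ℂ) • E.proj s x‖ ≤ δ * ‖E.proj s x‖ := by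
  have hC : ∀ t ∈ s, t ^ 2 ≤ (|t₀| + δ) ^ 2 := fun t ht => by
    rw [sq_le_sq, abs_of_nonneg (by positivity : 0 ≤ |t₀| + δ)]
    have := abs_sub_abs_le_abs_sub t t₀
    linarith [hδ t ht]
  have hdom := hE.proj_mem_domain_of_bounded hs hC
  have hidem : ∀ y, E.proj s (E.proj s y) = E.proj s y := fun y =>
    DFunLike.congr_fun (E.isStarProjection s hs).isIdempotentElem.eq y
  refine ⟨hdom x, ?_⟩
  set u := E.proj s x with hu
  have hPu : E.proj s u = u := hidem x
  set w := A ⟨u, hdom x⟩ - (t₀ : ℂ) • u with hw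
  have hPw : E.proj s w = w := by
    rw [hw, map_sub, map_smul, hPu, proj_apply_eq hA hE hs]
  have hud : u ∈ A.domain := hdom x
  have hwd : w ∈ A.domain := hPw ▸ hdom w
  set r : ℂ := ((δ⁻¹ : ℝ) : ℂ) with hr
  have quad : ∀ ε : ℂ, ∀ hd : u + ε • w ∈ A.domain,
      |(inner ℂ (u + ε • w) (A ⟨_, hd⟩)).re - t₀ * ‖u + ε • w‖ ^ 2| ≤ δ * ‖u + ε • w‖ ^ 2 := by
    intro ε hd
    have hP : E.proj s (u + ε • w) = u + ε • w := by rw [map_add, map_smul, hPu, hPw]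
    have := hE.abs_re_inner_sub_le hs hδ (x := u + ε • w) (hdom _)
    simp only [hP] at this
    exact this
  have hdε : ∀ ε : ℂ, u + ε • w ∈ A.domain := fun ε =>
    A.domain.add_mem hud (A.domain.smul_mem _ hwd)
  have hAε : ∀ ε : ℂ, A ⟨u + ε • w, hdε ε⟩ = A ⟨u, hud⟩ + ε • A ⟨w, hwd⟩ := fun ε => by
    rw [← A.map_smul, ← A.map_add]; rfl
  have hAu : A ⟨u, hud⟩ = w + (t₀ : ℂ) • u := by rw [hw]; simp
  have hsym : inner ℂ u (A ⟨w, hwd⟩) = inner ℂ (w + (t₀ : ℂ) • u) w := by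
    rw [← hAu]; exact (inner_symm hA ⟨u, hud⟩ ⟨w, hwd⟩).symm
  have q1 := (abs_le.1 (quad r (hdε r))).2
  have q2 := (abs_le.1 (quad (-r) (hdε (-r)))).1
  rw [hAε, hAu] at q1 q2
  have nrm : ∀ ε : ℝ, ‖u + (ε : ℂ) • w‖ ^ 2 =
      ‖u‖ ^ 2 + 2 * ε * (inner ℂ u w).re + ε ^ 2 * ‖w‖ ^ 2 := fun ε => by
    rw [norm_add_sq (𝕜 := ℂ), inner_smul_right, norm_smul]
    simp [mul_pow]
    ring
  have frm : ∀ ε : ℝ, (inner ℂ (u + (ε : ℂ) • w) (w + (t₀ : ℂ) • u + (ε : ℂ) • A ⟨w, hwd⟩)).re =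
      (inner ℂ u w).re + t₀ * ‖u‖ ^ 2 + 2 * ε * ‖w‖ ^ 2 + 2 * ε * t₀ * (inner ℂ u w).re +
        ε ^ 2 * (inner ℂ w (A ⟨w, hwd⟩)).re := fun ε => by
    have hre : (inner ℂ w u).re = (inner ℂ u w).re := by
      rw [← inner_conj_symm, Complex.conj_re]
    have hnu : (inner ℂ u u).re = ‖u‖ ^ 2 := inner_self_eq_norm_sq (𝕜 := ℂ) u
    have hnw : (inner ℂ w w).re = ‖w‖ ^ 2 := inner_self_eq_norm_sq (𝕜 := ℂ) w
    simp only [inner_add_left, inner_add_right, inner_smul_left, inner_smul_right, hsym,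
      Complex.conj_ofReal, Complex.add_re, Complex.re_ofReal_mul, hre, hnu, hnw]
    ring
  have hneg : -r = ((-δ⁻¹ : ℝ) : ℂ) := by rw [hr]; push_cast; rfl
  rw [hneg, nrm, frm] at q2
  rw [hr, nrm, frm] at q1
  -- The difference of the two forms is `4 δ⁻¹ ‖w‖ ^ 2`; the two norms on the right combine by the
  -- parallelogram law.
  have h4 : 4 * δ⁻¹ * ‖w‖ ^ 2 ≤ δ * (2 * ‖u‖ ^ 2 + 2 * δ⁻¹ ^ 2 * ‖w‖ ^ 2) := by nlinarith
  have h5 : δ * (2 * ‖u‖ ^ 2 + 2 * δ⁻¹ ^ 2 * ‖w‖ ^ 2) = 2 * δ * ‖u‖ ^ 2 + 2 * δ⁻¹ * ‖w‖ ^ 2 := by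
    field_simp
  have h6 : δ⁻¹ * ‖w‖ ^ 2 ≤ δ * ‖u‖ ^ 2 := by linarith
  have h7 : ‖w‖ ^ 2 ≤ (δ * ‖u‖) ^ 2 := by
    rw [inv_mul_le_iff₀ hδ0] at h6
    calc ‖w‖ ^ 2 ≤ δ * (δ * ‖u‖ ^ 2) := h6
      _ = _ := by ring
  exact le_of_sq_le_sq h7 (by positivity) 

/-- The spectral measure vanishes near every real point of the resolvent set. -/
theorem exists_proj_eq_zero (hA : IsSelfAdjoint A) (hE : IsSpectralMeasure A E) {t₀ : ℝ}
    (ht₀ : (t₀ : ℂ) ∉ spec A) : ∃ δ > 0, E.proj (Ioo (t₀ - δ) (t₀ + δ)) = 0 := by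
  have hR := isBoundedInverse_resolventOp ht₀
  set R := resolventOp A t₀
  -- This `δ` has `‖R‖ δ ≤ 1 / 2`, so a vector `u` of the spectral subspace satisfies `‖u‖ ≤ ‖R‖ ‖(A
  -- - t₀) u‖ ≤ ‖u‖ / 2`.
  refine ⟨(2 * (‖R‖ + 1))⁻¹, by positivity, ?_⟩
  set δ := (2 * (‖R‖ + 1))⁻¹ with hδ
  ext x
  obtain ⟨hx, h1⟩ := norm_sub_le hA hE (s := Ioo (t₀ - δ) (t₀ + δ)) measurableSet_Ioo (t₀ := t₀)
    (δ := δ) (by positivity) (fun t ht => abs_le.2 ⟨by linarith [ht.1], by linarith [ht.2]⟩) x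
  have h2 := hR.1 ⟨_, hx⟩
  rw [shift_apply] at h2
  set u := E.proj (Ioo (t₀ - δ) (t₀ + δ)) x
  have h3 : ‖u‖ ≤ ‖R‖ * (δ * ‖u‖) := by
    conv_lhs => rw [← show R (A ⟨u, hx⟩ - (t₀ : ℂ) • u) = u from h2]
    exact (R.le_opNorm _).trans (by gcongr)
  have h4 : ‖R‖ * δ ≤ 1 / 2 := by
    rw [hδ, mul_inv_le_iff₀ (by positivity)]
    linarith [norm_nonneg R]
  have h5 : ‖u‖ ≤ 0 := by nlinarith [norm_nonneg u]
  exact norm_le_zero_iff.1 h5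

end IsSpectralMeasure

/-! ### Positivity of the variation for nonzero coupling -/

namespace Setting

variable {H₀ H₁ : Type*} [NormedAddCommGroup H₀] [InnerProductSpace ℂ H₀] [CompleteSpace H₀]
  [NormedAddCommGroup H₁] [InnerProductSpace ℂ H₁] [CompleteSpace H₁] {S : Setting H₀ H₁}

/-- The spectral measure of `A₀` lives on `Δ₀`. -/
theorem scalar_compl_Δ₀ (x : H₀) : S.E₀.scalar x S.Δ₀ᶜ = 0 := by
  have h1 : S.E₀.scalar x (closure S.Δ₀)ᶜ = 0 := by
    refine measure_null_of_locally_null _ fun t ht => ?_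
    have hsp : (t : ℂ) ∉ spec S.A₀ := by
      rw [S.spec₀, Complex.isometry_ofReal.isClosedEmbedding.closure_image_eq]
      rintro ⟨s, hs, e⟩
      have : s = t := by exact_mod_cast e
      exact ht (this ▸ hs)
    obtain ⟨δ, hδ, h0⟩ := IsSpectralMeasure.exists_proj_eq_zero S.selfAdjoint₀
      S.isSpectralMeasure hsp
    refine ⟨Ioo (t - δ) (t + δ), nhdsWithin_le_nhds
      (Ioo_mem_nhds (by linarith) (by linarith)), ?_⟩
    rw [ProjectionMeasure.scalar_apply _ _ measurableSet_Ioo, h0]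
    simp
  -- Only here does absolute continuity enter: it excludes point masses at finite end points of
  -- `Δ₀`.
  have h2 : S.E₀.scalar x (frontier S.Δ₀) = 0 :=
    S.absolutelyContinuous x ((convex_realIoo S.left S.right).addHaar_frontier volume)
  refine measure_mono_null (fun t ht => ?_) (measure_union_null h1 h2)
  by_cases htc : t ∈ closure S.Δ₀
  · exact Or.inr ⟨htc, fun h => ht (interior_subset h)⟩
  · exact Or.inl htc

theorem scalar_Iio (x : H₁) (t : ℝ) : S.E₀.scalar (S.B x) (Iio t) = ENNReal.ofReal
    (RCLike.re (inner ℂ x ((ContinuousLinearMap.adjoint S.B ∘L S.E₀.proj (Iio t) ∘L S.B) x))) := by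
  rw [ProjectionMeasure.scalar_apply _ _ measurableSet_Iio,
    ← inner_starProjection (S.E₀.isStarProjection _ measurableSet_Iio)]
  congr 2
  exact (ContinuousLinearMap.adjoint_inner_right _ _ _).symm

/-- The distribution function of the scalar measure of `B x` is constant on `Δ₀`, so this measure
has no mass there; outside `Δ₀` it has none either, and its total mass is `‖B x‖ ^ 2`. -/
theorem B_eq_zero_of_K'_eq_zero (h : ∀ t ∈ S.Δ₀, S.K' t = 0) : S.B = 0 := by
  ext x
  have := S.E₀.isFiniteMeasure_scalar (S.B x)
  have hconst : ∀ s ∈ S.Δ₀, ∀ t ∈ S.Δ₀, S.E₀.scalar (S.B x) (Iio s) = S.E₀.scalar (S.B x) (Iio t) := by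
    intro s hs t ht
    rw [scalar_Iio, scalar_Iio]
    have hd : ∀ u ∈ S.Δ₀, HasDerivWithinAt (fun s : ℝ =>
        ContinuousLinearMap.adjoint S.B ∘L S.E₀.proj (Iio s) ∘L S.B) 0 S.Δ₀ u := fun u hu => by
      have := S.hasDerivAt u hu.1 hu.2
      rw [h u hu] at this
      exact this.hasDerivWithinAt
    have hc := (convex_realIoo S.left S.right).norm_image_sub_le_of_norm_hasDerivWithin_le
      (C := 0) hd (fun u hu => by simp) hs ht
    rw [zero_mul] at hc
    rw [sub_eq_zero.1 (norm_le_zero_iff.1 hc)]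
  have hIco : ∀ s ∈ S.Δ₀, ∀ t ∈ S.Δ₀, S.E₀.scalar (S.B x) (Ico s t) = 0 := by
    intro s hs t ht
    have e : Ico s t = Iio t \ Iio s := by ext u; simp
    rcases le_total s t with hst | hst
    · rw [e, measure_sdiff (Iio_subset_Iio hst) measurableSet_Iio.nullMeasurableSet
        (measure_ne_top _ _), hconst s hs t ht, tsub_self]
    · rw [Ico_eq_empty (not_lt.2 hst), measure_empty]
  have hΔ : S.E₀.scalar (S.B x) S.Δ₀ = 0 := by
    refine measure_null_of_locally_null _ fun t ht => ?_
    obtain ⟨ε, hε, hball⟩ := Metric.isOpen_iff.1 S.isOpen_Δ₀ t ht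
    have hs : t - ε / 2 ∈ S.Δ₀ := hball (by
      rw [Metric.mem_ball, Real.dist_eq, abs_lt]; constructor <;> linarith)
    have hs' : t + ε / 2 ∈ S.Δ₀ := hball (by
      rw [Metric.mem_ball, Real.dist_eq, abs_lt]; constructor <;> linarith)
    exact ⟨Ico (t - ε / 2) (t + ε / 2), nhdsWithin_le_nhds
      (Ico_mem_nhds (by linarith) (by linarith)), hIco _ hs _ hs'⟩
  have huniv : S.E₀.scalar (S.B x) Set.univ = 0 := by
    rw [← union_compl_self S.Δ₀]
    exact measure_union_null hΔ (scalar_compl_Δ₀ _)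
  rw [ProjectionMeasure.scalar_univ, ENNReal.ofReal_eq_zero] at huniv
  have : ‖S.B x‖ = 0 := by
    have := sq_nonneg ‖S.B x‖
    exact pow_eq_zero_iff two_ne_zero |>.1 (le_antisymm huniv this)
  simpa using this

/-- If the variation along a contour vanishes, so does `K'`. -/
theorem K'_eq_zero_of_variation_eq_zero {l : ℤˣ} {c : ℝ → ℂ} (hc : S.IsAdmissible l c)
    (hV : S.variation c = 0) : ∀ t ∈ S.Δ₀, S.K' t = 0 := by
  have hI := S.isOpen_Δ₀.measurableSet
  rw [variation_eq, integral_eq_zero_iff_of_nonneg (fun t => norm_nonneg _)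
    hc.integrableOn_density.norm, Filter.EventuallyEq, ae_restrict_iff' hI] at hV
  obtain ⟨t₁, ht₁⟩ := S.nonempty_Δ₀
  obtain ⟨ε, hε, hball⟩ := Metric.isOpen_iff.1 S.isOpen_Δ₀ t₁ ht₁
  have hsub : Icc t₁ (t₁ + ε / 2) ⊆ S.Δ₀ := fun t ht => hball (by
    rw [Metric.mem_ball, Real.dist_eq, abs_lt]; constructor <;> linarith [ht.1, ht.2])
  obtain ⟨k, hk⟩ := hc.lipschitz
  set Z := Icc t₁ (t₁ + ε / 2) ∩ {t | S.K' (c t) = 0} with hZ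
  -- With only finitely many zeros of `K'` on this piece, vanishing variation would give `c' = 0`
  -- almost everywhere there, and equal values of `c` at its two ends would contradict injectivity.
  -- Infinitely many zeros accumulate on the compact image, so the identity theorem applies.
  have hinf : Z.Infinite := by
    intro hfin
    have h0 : ∀ᵐ t, t ∈ Ioc t₁ (t₁ + ε / 2) → deriv c t = 0 := by
      have hn : ∀ᵐ t, t ∉ Z := by
        rw [ae_iff]
        simpa using hfin.measure_zero volume
      filter_upwards [hV, hn] with t h1 h2 ht
      have ht' : t ∈ Icc t₁ (t₁ + ε / 2) := Ioc_subset_Icc_self ht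
      have h3 := h1 (hsub ht')
      simp only [Pi.zero_apply, norm_eq_zero, density, smul_eq_zero] at h3
      exact h3.resolve_right fun h => h2 ⟨ht', h⟩
    have h1 := integral_deriv_mul_comp (c := c) (a := t₁) (b := t₁ + ε / 2) (by linarith)
      (hk.mono hsub) isOpen_univ (f := fun _ => 1) (G := fun z => z)
      (fun z _ => hasDerivAt_id z) (fun _ _ => mem_univ _)
    rw [intervalIntegral.integral_of_le (by linarith), setIntegral_congr_ae (g := fun _ => 0)
      measurableSet_Ioc (h0.mono fun t ht h => by rw [ht h, zero_mul]), integral_zero] at h1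
    have h2 := hc.injOn (hsub ⟨by linarith, le_rfl⟩) ht₁ (sub_eq_zero.1 h1.symm)
    linarith
  have hinj : InjOn c Z := hc.injOn.mono (inter_subset_left.trans hsub)
  have hcomp : IsCompact (c '' Icc t₁ (t₁ + ε / 2)) :=
    isCompact_Icc.image_of_continuousOn (hc.continuousOn.mono hsub)
  obtain ⟨z, hz, hacc⟩ := (hinf.image hinj).exists_accPt_of_subset_isCompact hcomp
    (image_mono inter_subset_left)
  obtain ⟨t, ht, rfl⟩ := hz
  have hmem : c t ∈ S.Dminus ∪ (fun t : ℝ => (t : ℂ)) '' {t : ℝ | S.left < t ∧ t < S.right} ∪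
      (fun z : ℂ => conj z) '' S.Dminus := by
    have := hc.mapsTo (hsub ht)
    rcases Int.units_eq_one_or l with rfl | rfl
    · rw [D_one] at this; exact Or.inr this
    · rw [D_neg_one] at this; exact Or.inl (Or.inl this)
  have hfreq : ∃ᶠ w in 𝓝[≠] (c t), S.K' w = (fun _ => (0 : H₁ →L[ℂ] H₁)) w := by
    refine (accPt_iff_frequently_nhdsNE.1 hacc).mono ?_
    rintro _ ⟨s, hs, rfl⟩
    exact hs.2
  have hE := S.analytic.eqOn_of_preconnected_of_frequently_eq
    (fun _ _ => analyticAt_const) S.isPreconnected_domain hmem hfreq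
  exact fun s hs => hE (Or.inl (Or.inr ⟨s, hs, rfl⟩))

theorem variation_pos {l : ℤˣ} {c : ℝ → ℂ} (hc : S.IsAdmissible l c) (hB : S.B ≠ 0) :
    0 < S.variation c := by
  refine lt_of_le_of_ne (by rw [variation_eq]; positivity) fun h => hB ?_
  exact B_eq_zero_of_K'_eq_zero (K'_eq_zero_of_variation_eq_zero hc h.symm)

end Setting

/-! ### Integrals along closed contours -/

namespace ClosedContour

section Basic

variable {F : Type*} [NormedAddCommGroup F] [NormedSpace ℂ F] {γ : ClosedContour} {f g : ℂ → F}

theorem mem_support (i : Fin γ.n) {t : ℝ} (ht : t ∈ Icc (0 : ℝ) 1) : γ.curve i t ∈ γ.support :=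
  mem_iUnion.2 ⟨i, t, ht, rfl⟩

theorem continuousOn_curve (i : Fin γ.n) : ContinuousOn (γ.curve i) (Icc 0 1) :=
  (γ.lipschitz i).choose_spec.continuousOn

theorem isCompact_support (γ : ClosedContour) : IsCompact γ.support :=
  isCompact_iUnion fun i => isCompact_Icc.image_of_continuousOn (continuousOn_curve i)

theorem integrable_of_continuousOn (hf : ContinuousOn f γ.support) : γ.Integrable f := fun i =>
  intervalIntegrable_deriv_smul zero_le_one (γ.lipschitz i).choose_spec
    (hf.comp (continuousOn_curve i) fun _ ht => mem_support i ht)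

theorem integrand_eqOn (h : EqOn f g γ.support) (i : Fin γ.n) :
    EqOn (fun t => deriv (γ.curve i) t • f (γ.curve i t))
      (fun t => deriv (γ.curve i) t • g (γ.curve i t)) (uIcc 0 1) := fun t ht => by
  rw [uIcc_of_le zero_le_one] at ht
  exact congrArg (deriv (γ.curve i) t • ·) (h (mem_support i ht))

theorem integral_congr (h : EqOn f g γ.support) : γ.integral f = γ.integral g :=
  Finset.sum_congr rfl fun i _ => intervalIntegral.integral_congr (integrand_eqOn h i)

theorem integral_add (hf : ContinuousOn f γ.support) (hg : ContinuousOn g γ.support) :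
    γ.integral (fun z => f z + g z) = γ.integral f + γ.integral g := by
  simp only [ClosedContour.integral]
  rw [← Finset.sum_add_distrib]
  refine Finset.sum_congr rfl fun i _ => ?_
  simp only [smul_add]
  exact intervalIntegral.integral_add (integrable_of_continuousOn hf i)
    (integrable_of_continuousOn hg i)

theorem integral_sub (hf : ContinuousOn f γ.support) (hg : ContinuousOn g γ.support) :
    γ.integral (fun z => f z - g z) = γ.integral f - γ.integral g := by
  simp only [ClosedContour.integral]
  rw [← Finset.sum_sub_distrib]
  refine Finset.sum_congr rfl fun i _ => ?_
  simp only [smul_sub]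
  exact intervalIntegral.integral_sub (integrable_of_continuousOn hf i)
    (integrable_of_continuousOn hg i)

theorem integral_clm [CompleteSpace F] {E : Type*} [NormedAddCommGroup E] [NormedSpace ℂ E]
    [CompleteSpace E] (hf : ContinuousOn f γ.support) (L : F →L[ℂ] E) :
    γ.integral (fun z => L (f z)) = L (γ.integral f) := by
  simp only [ClosedContour.integral]
  rw [map_sum]
  refine Finset.sum_congr rfl fun i _ => ?_
  rw [← L.intervalIntegral_comp_comm (integrable_of_continuousOn hf i)]
  simp only [map_smul]

theorem integral_smul_const [CompleteSpace F] {f : ℂ → ℂ} (hf : ContinuousOn f γ.support) (v : F) :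
    γ.integral (fun z => f z • v) = γ.integral f • v :=
  integral_clm hf ((ContinuousLinearMap.id ℂ ℂ).smulRight v)

/-- Cauchy's theorem, if every curve runs through the domain of a primitive. -/
theorem integral_eq_zero_of_hasDerivAt [CompleteSpace F] (hf : ContinuousOn f γ.support)
    (h : ∀ i, ∃ U, IsOpen U ∧ MapsTo (γ.curve i) (Icc 0 1) U ∧
      ∃ G : ℂ → F, ∀ z ∈ U, HasDerivAt G (f z) z) : γ.integral f = 0 := by
  refine (SeparatingDual.eq_zero_iff_forall_dual_eq_zero (R := ℂ) (γ.integral f)).2 fun φ => ?_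
  rw [← integral_clm hf φ]
  refine Finset.sum_eq_zero fun i _ => ?_
  obtain ⟨U, hU, hm, G, hG⟩ := h i
  have := integral_deriv_mul_comp zero_le_one (γ.lipschitz i).choose_spec hU
    (G := fun z => φ (G z)) (f := fun z => φ (f z))
    (fun z hz => φ.hasFDerivAt.comp_hasDerivAt z (hG z hz)) hm
  rw [γ.closed i, sub_self] at this
  exact this

/-- The Cauchy integral is holomorphic off the contour. -/
theorem differentiableOn_cauchy [CompleteSpace F] (hf : ContinuousOn f γ.support) :
    DifferentiableOn ℂ (fun w => γ.integral fun z => (z - w)⁻¹ • f z) γ.supportᶜ := by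
  intro w hw
  obtain ⟨r, hr, hball⟩ := Metric.isOpen_iff.1 γ.isCompact_support.isClosed.isOpen_compl w hw
  have hsep : ∀ z ∈ γ.support, ∀ u ∈ Metric.ball w (r / 2), r / 2 ≤ ‖z - u‖ := fun z hz u hu => by
    have h1 : r ≤ dist z w := not_lt.1 fun h => hball h hz
    have h2 := dist_triangle z u w
    rw [Metric.mem_ball] at hu
    rw [← dist_eq_norm]
    linarith
  have hne : ∀ z ∈ γ.support, ∀ u ∈ Metric.ball w (r / 2), z - u ≠ 0 := fun z hz u hu =>
    norm_pos_iff.1 (by linarith [hsep z hz u hu])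
  suffices DifferentiableOn ℂ (fun w => γ.integral fun z => (z - w)⁻¹ • f z)
      (Metric.ball w (r / 2)) from
    (this.differentiableAt (Metric.ball_mem_nhds w (by positivity))).differentiableWithinAt
  simp only [ClosedContour.integral]
  refine DifferentiableOn.fun_sum fun i _ => ?_
  simp only [intervalIntegral.integral_of_le zero_le_one]
  have hcont : ∀ u ∈ Metric.ball w (r / 2),
      ContinuousOn (fun z => (z - u)⁻¹ • f z) γ.support := fun u hu =>
    ((continuousOn_id.sub continuousOn_const).inv₀ fun z hz => hne z hz u hu).smul hf
  refine differentiableOn_integral_of_bound Metric.isOpen_ball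
    (bound := fun t => (r / 2)⁻¹ * ‖deriv (γ.curve i) t • f (γ.curve i t)‖)
    (fun u hu => (integrable_of_continuousOn (hcont u hu) i).1.aestronglyMeasurable)
    ((integrable_of_continuousOn hf i).1.norm.const_mul _) ?_ ?_
  · filter_upwards [ae_restrict_mem measurableSet_Ioc] with t ht u hu
    have h1 := hsep _ (mem_support i (Ioc_subset_Icc_self ht)) u hu
    rw [smul_comm, norm_smul, norm_inv]
    gcongr
  · filter_upwards [ae_restrict_mem measurableSet_Ioc] with t ht u hu
    have h1 := hne _ (mem_support i (Ioc_subset_Icc_self ht)) u hu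
    exact ((((differentiableAt_id.const_sub _).inv h1).smul_const _).const_smul
      _).differentiableWithinAt

/-- The quotient `(z - w) / (z - w₀)` stays within distance less than `1` of `1` along the contour,
so its principal logarithm is a primitive of the difference of the integrands. -/
theorem integral_inv_sub_eq {w w₀ : ℂ} (h : ∀ z ∈ γ.support, ‖w - w₀‖ < ‖z - w₀‖) :
    γ.integral (fun z => (z - w)⁻¹) = γ.integral (fun z => (z - w₀)⁻¹) := by
  have hne : ∀ z, ‖w - w₀‖ < ‖z - w₀‖ → z - w₀ ≠ 0 ∧ z - w ≠ 0 := fun z hz =>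
    ⟨norm_pos_iff.1 ((norm_nonneg _).trans_lt hz), fun h0 => by
      rw [sub_eq_zero.1 h0] at hz; exact lt_irrefl _ hz⟩
  have hc : ContinuousOn (fun z => (z - w)⁻¹) γ.support :=
    (continuousOn_id.sub continuousOn_const).inv₀ fun z hz => (hne z (h z hz)).2
  have hc₀ : ContinuousOn (fun z => (z - w₀)⁻¹) γ.support :=
    (continuousOn_id.sub continuousOn_const).inv₀ fun z hz => (hne z (h z hz)).1
  rw [← sub_eq_zero, ← integral_sub hc hc₀]
  refine integral_eq_zero_of_hasDerivAt (hc.sub hc₀) fun i => ⟨{z | ‖w - w₀‖ < ‖z - w₀‖},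
    isOpen_lt continuous_const (by fun_prop), fun t ht => h _ (mem_support i ht),
    fun z => Complex.log ((z - w) / (z - w₀)), fun z hz => ?_⟩
  obtain ⟨h1, h2⟩ := hne z hz
  have hd : HasDerivAt (fun z => (z - w) / (z - w₀))
      ((1 * (z - w₀) - (z - w) * 1) / (z - w₀) ^ 2) z :=
    ((hasDerivAt_id z).sub_const w).div ((hasDerivAt_id z).sub_const w₀) h1
  have hmem : (z - w) / (z - w₀) ∈ Complex.slitPlane := by
    have h3 : (z - w) / (z - w₀) = 1 - (w - w₀) / (z - w₀) := by
      field_simp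
      ring
    have h4 : ‖(w - w₀) / (z - w₀)‖ < 1 := by
      rw [norm_div, div_lt_one (norm_pos_iff.2 h1)]
      exact hz
    refine Or.inl ?_
    rw [h3, Complex.sub_re, Complex.one_re, sub_pos]
    exact (Complex.re_le_norm _).trans_lt h4
  have hl := hd.clog hmem
  rwa [show (1 * (z - w₀) - (z - w) * 1) / (z - w₀) ^ 2 / ((z - w) / (z - w₀)) =
    (z - w)⁻¹ - (z - w₀)⁻¹ by field_simp] at hl

end Basic

section Resolvent

variable {𝔸 : Type*} [NormedRing 𝔸] [NormedAlgebra ℂ 𝔸] {γ : ClosedContour}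

theorem continuousOn_resolvent [CompleteSpace 𝔸] {b : 𝔸} (h : Disjoint γ.support (spectrum ℂ b)) :
    ContinuousOn (resolvent b) γ.support := fun z hz =>
  (spectrum.hasDerivAt_resolvent_const_left (𝕜 := ℂ) (a := b) (k := z)
    (not_not.1 (disjoint_left.1 h hz))).continuousAt.continuousWithinAt

theorem resolvent_sub_resolvent {b : 𝔸} {z w : ℂ} (hz : z ∈ resolventSet ℂ b)
    (hw : w ∈ resolventSet ℂ b) :
    resolvent b z - resolvent b w = (w - z) • (resolvent b w * resolvent b z) := by
  have h1 : resolvent b w * (algebraMap ℂ 𝔸 w - b) = 1 := Ring.inverse_mul_cancel _ hw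
  have h2 : (algebraMap ℂ 𝔸 z - b) * resolvent b z = 1 := Ring.mul_inverse_cancel _ hz
  calc _ = resolvent b w * (algebraMap ℂ 𝔸 w - b) * resolvent b z
        - resolvent b w * ((algebraMap ℂ 𝔸 z - b) * resolvent b z) := by
        rw [h1, h2, one_mul, mul_one]
    _ = resolvent b w * (algebraMap ℂ 𝔸 (w - z)) * resolvent b z := by
        rw [map_sub]
        noncomm_ring
    _ = _ := by
        rw [Algebra.algebraMap_eq_smul_one, mul_smul_comm, mul_one, smul_mul_assoc]

variable [CompleteSpace 𝔸]

/-- The Riesz projection of the whole spectrum is the identity. -/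
theorem integral_resolvent {b : 𝔸} (h : Disjoint γ.support (spectrum ℂ b))
    (hw : ∀ w ∈ spectrum ℂ b, (2 * Real.pi * Complex.I)⁻¹ * γ.integral (fun z => (z - w)⁻¹) = 1) :
    (2 * Real.pi * Complex.I : ℂ)⁻¹ • γ.integral (resolvent b) = 1 := by
  nontriviality 𝔸
  set κ : ℂ := (2 * Real.pi * Complex.I)⁻¹ with hκ
  set P := κ • γ.integral (resolvent b) with hP
  have hT := continuousOn_resolvent h
  have hcl : IsClosed (spectrum ℂ b) := spectrum.isClosed b
  -- The Cauchy integral of the resolvent. Off the spectrum and the contour it equals `resolvent b w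
  -- * (n(w) - P)`, where `n(w)` is the winding number.
  let Q : ℂ → 𝔸 := fun w => κ • γ.integral fun z => (z - w)⁻¹ • resolvent b z
  have hQd : DifferentiableOn ℂ Q γ.supportᶜ := (differentiableOn_cauchy hT).const_smul κ
  have hQ : ∀ w, w ∉ γ.support → w ∉ spectrum ℂ b →
      Q w = resolvent b w * (algebraMap ℂ 𝔸 (κ * γ.integral fun z => (z - w)⁻¹) - P) := by
    intro w hwγ hws
    have hne : ∀ z ∈ γ.support, z - w ≠ 0 := fun z hz h0 => hwγ (sub_eq_zero.1 h0 ▸ hz)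
    have hc : ContinuousOn (fun z => (z - w)⁻¹) γ.support :=
      (continuousOn_id.sub continuousOn_const).inv₀ hne
    have e1 : γ.integral (fun z => (z - w)⁻¹ • resolvent b z) =
        γ.integral (fun z => (z - w)⁻¹ • resolvent b w - resolvent b w * resolvent b z) := by
      refine integral_congr fun z hz => ?_
      have e2 := resolvent_sub_resolvent (not_not.1 (disjoint_left.1 h hz)) (not_not.1 hws)
      have e3 := hne z hz
      have e4 : (z - w)⁻¹ * (w - z) = -1 := by
        field_simp
        ring
      rw [sub_eq_iff_eq_add] at e2
      calc (z - w)⁻¹ • resolvent b z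
          = (z - w)⁻¹ • ((w - z) • (resolvent b w * resolvent b z) + resolvent b w) := by rw [← e2]
        _ = _ := by
          rw [smul_add, smul_smul, e4, neg_one_smul]
          abel
    simp only [Q]
    rw [e1, integral_sub (f := fun z => (z - w)⁻¹ • resolvent b w)
      (g := fun z => resolvent b w * resolvent b z) (hc.smul continuousOn_const)
      (continuousOn_const.mul hT),
      integral_smul_const hc,
      show γ.integral (fun z => resolvent b w * resolvent b z) = resolvent b w * γ.integral (resolvent b)
        from integral_clm hT (ContinuousLinearMap.mul ℂ 𝔸 (resolvent b w))]
    rw [mul_sub, hP, Algebra.algebraMap_eq_smul_one, mul_smul_comm, mul_smul_comm, mul_one, smul_sub,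
      smul_smul]
  classical
  -- The winding number is prescribed only on the spectrum, as in Dixon's proof of Cauchy's theorem.
  -- It is still `1` near each spectral point, so the two formulas fit together to an entire
  -- function; this vanishes at infinity, hence everywhere, and `1 - P = 0`.
  let Ψ : ℂ → 𝔸 := fun w => if w ∈ spectrum ℂ b then Q w else resolvent b w * (1 - P)
  have hΨ0 : ∀ w, w ∉ spectrum ℂ b → Ψ w = resolvent b w * (1 - P) := fun w hw => if_neg hw
  have hΨd : Differentiable ℂ Ψ := by
    intro w
    by_cases hws : w ∈ spectrum ℂ b
    · have hwγ : w ∈ γ.supportᶜ := fun h' => disjoint_left.1 h h' hws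
      obtain ⟨r, hr, hball⟩ := Metric.isOpen_iff.1 γ.isCompact_support.isClosed.isOpen_compl w hwγ
      refine (hQd.differentiableAt (γ.isCompact_support.isClosed.isOpen_compl.mem_nhds
        hwγ)).congr_of_eventuallyEq ?_
      filter_upwards [Metric.ball_mem_nhds w hr] with u hu
      by_cases hus : u ∈ spectrum ℂ b
      · exact if_pos hus
      · rw [hΨ0 u hus, hQ u (hball hu) hus, integral_inv_sub_eq (w₀ := w), hw w hws, map_one]
        intro z hz
        rw [← dist_eq_norm, ← dist_eq_norm]
        exact (Metric.mem_ball.1 hu).trans_le (not_lt.1 fun h' => hball h' hz)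
    · refine DifferentiableAt.congr_of_eventuallyEq (f := fun w => resolvent b w * (1 - P))
        ((spectrum.hasDerivAt_resolvent_const_left (not_not.1 hws)).differentiableAt.mul_const _) ?_
      filter_upwards [hcl.isOpen_compl.mem_nhds hws] with u hu using hΨ0 u hu
  have hfar : ∀ᶠ w in cocompact ℂ, w ∉ spectrum ℂ b :=
    (spectrum.isCompact (𝕜 := ℂ) b).compl_mem_cocompact
  have hlim : Tendsto Ψ (cocompact ℂ) (𝓝 0) := by
    have h1 : Tendsto (fun w => resolvent b w * (1 - P)) (cocompact ℂ) (𝓝 (0 * (1 - P))) := by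
      refine Tendsto.mul_const _ ?_
      rw [← Metric.cobounded_eq_cocompact]
      exact spectrum.resolvent_tendsto_cobounded b
    rw [zero_mul] at h1
    refine h1.congr' ?_
    filter_upwards [hfar] with w hw using (hΨ0 w hw).symm
  have hzero : ∀ w, Ψ w = 0 := fun w =>
    hΨd.apply_eq_of_tendsto_cocompact w hlim
  obtain ⟨w, hws⟩ := hfar.exists
  have h2 := hzero w
  rw [hΨ0 w hws] at h2
  have h3 : (algebraMap ℂ 𝔸 w - b) * resolvent b w = 1 :=
    Ring.mul_inverse_cancel _ (not_not.1 hws)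
  have h4 : 1 - P = 0 := by
    calc 1 - P = (algebraMap ℂ 𝔸 w - b) * resolvent b w * (1 - P) := by rw [h3, one_mul]
      _ = 0 := by rw [mul_assoc, h2, mul_zero]
  exact (sub_eq_zero.1 h4).symm

/-- The first moment of the resolvent along a contour around the spectrum. -/
theorem integral_smul_resolvent {b : 𝔸} (h : Disjoint γ.support (spectrum ℂ b))
    (hw : ∀ w ∈ spectrum ℂ b, (2 * Real.pi * Complex.I)⁻¹ * γ.integral (fun z => (z - w)⁻¹) = 1) :
    (2 * Real.pi * Complex.I : ℂ)⁻¹ • γ.integral (fun z => z • resolvent b z) = b := by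
  have hT := continuousOn_resolvent h
  -- `z (z - b)⁻¹ = 1 + b (z - b)⁻¹`, and constants integrate to zero over closed curves.
  have h1 : γ.integral (fun z => z • resolvent b z) =
      γ.integral (fun z => 1 + b * resolvent b z) := by
    refine integral_congr fun z hz => ?_
    have h3 : (algebraMap ℂ 𝔸 z - b) * resolvent b z = 1 :=
      Ring.mul_inverse_cancel _ (not_not.1 (disjoint_left.1 h hz))
    change z • resolvent b z = 1 + b * resolvent b z
    rw [← h3, sub_mul, sub_add_cancel, Algebra.algebraMap_eq_smul_one, smul_mul_assoc, one_mul]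
  have h2 : γ.integral (fun _ => (1 : 𝔸)) = 0 :=
    integral_eq_zero_of_hasDerivAt continuousOn_const fun i => ⟨univ, isOpen_univ, mapsTo_univ _ _,
      fun z => z • (1 : 𝔸), fun z _ => by simpa using (hasDerivAt_id z).smul_const (1 : 𝔸)⟩
  rw [h1, integral_add (f := fun _ => 1) (g := fun z => b * resolvent b z) continuousOn_const
    (continuousOn_const.mul hT), h2, zero_add,
    show γ.integral (fun z => b * resolvent b z) = b * γ.integral (resolvent b) from
      integral_clm hT (ContinuousLinearMap.mul ℂ 𝔸 b), ← mul_smul_comm, integral_resolvent h hw,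
    mul_one]

end Resolvent

end ClosedContour

/-! ### Everywhere defined operators -/

section Everywhere

variable {H : Type*} [NormedAddCommGroup H] [InnerProductSpace ℂ H]

theorem addBounded_everywhere (a X : H →L[ℂ] H) :
    addBounded (everywhere a) X = everywhere (a + X) :=
  LinearPMap.ext rfl fun x _ _ => add_comm (X x) (a x)

theorem shift_everywhere (a : H →L[ℂ] H) (z : ℂ) :
    shift (everywhere a) z = everywhere (a - z • 1) := by
  rw [shift, addBounded_everywhere, sub_eq_add_neg]

theorem isBoundedInverse_everywhere {a R : H →L[ℂ] H} :
    IsBoundedInverse (everywhere a) R ↔ R * a = 1 ∧ a * R = 1 := by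
  refine ⟨fun h => ⟨?_, ?_⟩, fun h => ⟨fun x => DFunLike.congr_fun h.1 _, fun y =>
    ⟨Submodule.mem_top, DFunLike.congr_fun h.2 y⟩⟩⟩
  · ext x
    exact h.1 ⟨x, Submodule.mem_top⟩
  · ext y
    exact (h.2 y).choose_spec

theorem spec_everywhere (b : H →L[ℂ] H) : spec (everywhere b) = spectrum ℂ b := by
  ext z
  refine not_congr ?_
  simp only [shift_everywhere, isBoundedInverse_everywhere]
  rw [spectrum.mem_resolventSet_iff, Algebra.algebraMap_eq_smul_one, IsUnit.sub_iff]
  exact ⟨fun ⟨R, h1, h2⟩ => ⟨⟨_, R, h2, h1⟩, rfl⟩, fun ⟨u, hu⟩ => ⟨↑u⁻¹, by rw [← hu]; simp⟩⟩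

theorem mulBounded_everywhere (b V : H →L[ℂ] H) :
    mulBounded (everywhere b) V = everywhere (b * V) :=
  LinearPMap.ext rfl fun _ _ _ => rfl

/-- This is the Hellinger–Toeplitz theorem: symmetry on the whole space implies continuity. -/
theorem exists_eq_everywhere [CompleteSpace H] {A : H →ₗ.[ℂ] H} (hA : IsSelfAdjoint A)
    (h : A.domain = ⊤) : ∃ a : H →L[ℂ] H, A = everywhere a := by
  let T : H →ₗ[ℂ] H := A.toFun ∘ₗ (LinearEquiv.ofTop A.domain h).symm.toLinearMap
  have hT : T.IsSymmetric := fun x y => by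
    have h1 := LinearPMap.adjoint_isFormalAdjoint hA.dense_domain
    rw [LinearPMap.isSelfAdjoint_def.1 hA] at h1
    exact h1 ⟨x, h ▸ Submodule.mem_top⟩ ⟨y, h ▸ Submodule.mem_top⟩
  exact ⟨⟨T, hT.continuous⟩, LinearPMap.ext h fun x hx hx' => rfl⟩

end Everywhere

/-! ### Cauchy's theorem near a subset of the real line -/

theorem infDist_flatten_le {σ : Set ℂ} (hσ : ∀ s ∈ σ, s.im = 0) {z w : ℂ} (hre : w.re = z.re)
    (him : |w.im| ≤ |z.im|) : Metric.infDist w σ ≤ Metric.infDist z σ := by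
  rcases σ.eq_empty_or_nonempty with rfl | hne
  · simp
  refine (Metric.le_infDist hne).2 fun s hs => (Metric.infDist_le_dist_of_mem hs).trans ?_
  rw [Complex.dist_eq_re_im, Complex.dist_eq_re_im, hre, hσ s hs, sub_zero, sub_zero]
  have := sq_le_sq.2 him
  gcongr

/-- A curve near the real line runs in a simply connected neighbourhood. -/
theorem exists_simplyConnected_of_real {σ : Set ℂ} (hσ : ∀ s ∈ σ, s.im = 0) {ρ : ℝ} {c : ℝ → ℂ}
    (hc : ContinuousOn c (Icc 0 1)) (hm : ∀ t ∈ Icc (0 : ℝ) 1, Metric.infDist (c t) σ < ρ) :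
    ∃ U : Set ℂ, IsOpen U ∧ IsSimplyConnected U ∧ MapsTo c (Icc 0 1) U ∧
      ∀ z ∈ U, Metric.infDist z σ < ρ := by
  have hreal : ∀ z : ℂ, Metric.infDist z σ < ρ → Metric.infDist ((z.re : ℝ) : ℂ) σ < ρ :=
    fun z hz => (infDist_flatten_le hσ (by simp) (by simp)).trans_lt hz
  let O : Set ℝ := {x | Metric.infDist (x : ℂ) σ < ρ}
  have hO : IsOpen O := isOpen_lt
    ((Metric.continuous_infDist_pt σ).comp Complex.continuous_ofReal) continuous_const
  have h0 : (0 : ℝ) ∈ Icc (0 : ℝ) 1 := ⟨le_rfl, zero_le_one⟩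
  -- The curve stays over a single component `J` of the real trace of the neighbourhood. The part of
  -- the neighbourhood over `J` is deformed vertically onto the interval `J`, hence contractible.
  let J : Set ℝ := connectedComponentIn O (c 0).re
  have hJ : IsOpen J := hO.connectedComponentIn
  have hJO : J ⊆ O := connectedComponentIn_subset _ _
  have hJc : Convex ℝ J := isPreconnected_connectedComponentIn.ordConnected.convex
  have hx₀ : (c 0).re ∈ J := mem_connectedComponentIn (hreal _ (hm 0 h0))
  have hcJ : ∀ t ∈ Icc (0 : ℝ) 1, (c t).re ∈ J := fun t ht =>
    (isPreconnected_Icc.image (fun t => (c t).re)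
      (Complex.continuous_re.comp_continuousOn hc)).subset_connectedComponentIn
      ⟨0, h0, rfl⟩ (by rintro _ ⟨s, hs, rfl⟩; exact hreal _ (hm s hs)) ⟨t, ht, rfl⟩
  let U : Set ℂ := {z | Metric.infDist z σ < ρ ∧ z.re ∈ J}
  refine ⟨U, (isOpen_lt (Metric.continuous_infDist_pt σ) continuous_const).inter
    (hJ.preimage Complex.continuous_re), ?_, fun t ht => ⟨hm t ht, hcJ t ht⟩, fun z hz => hz.1⟩
  let p : C(U, J) := ⟨fun z => ⟨(z : ℂ).re, z.2.2⟩, by fun_prop⟩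
  let q : C(J, U) := ⟨fun x => ⟨((x : ℝ) : ℂ), hJO x.2, by simp⟩, by fun_prop⟩
  have : ContractibleSpace J := hJc.contractibleSpace ⟨_, hx₀⟩
  have hpq : p.comp q = ContinuousMap.id J := by ext x; simp [p, q]
  have hmem : ∀ x : unitInterval × U,
      (((x.2 : ℂ).re : ℂ) + ((x.1 : ℝ) * (x.2 : ℂ).im : ℝ) * Complex.I) ∈ U := fun x => by
    refine ⟨(infDist_flatten_le hσ (z := x.2) (by simp) ?_).trans_lt x.2.2.1, by simp [x.2.2.2]⟩
    simp only [Complex.add_im, Complex.ofReal_im, Complex.mul_im, Complex.ofReal_re, Complex.I_im,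
      Complex.I_re, mul_one, mul_zero, add_zero, zero_add]
    rw [abs_mul, abs_of_nonneg x.1.2.1]
    exact mul_le_of_le_one_left (abs_nonneg _) x.1.2.2
  have hqp : (q.comp p).Homotopic (ContinuousMap.id U) := by
    refine ⟨⟨⟨fun x => ⟨_, hmem x⟩, by fun_prop⟩, fun x => ?_, fun x => ?_⟩⟩
    · ext1; simp [p, q]
    · ext1; simp
  let e : ContinuousMap.HomotopyEquiv U J := ⟨p, q, hqp, hpq ▸ ContinuousMap.Homotopic.refl _⟩
  have : ContractibleSpace U := e.contractibleSpace
  exact (inferInstance : SimplyConnectedSpace U)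

/-- No winding condition is needed: each curve runs in a simply connected part of the neighbourhood,
where `f` has a primitive. -/
theorem ClosedContour.integral_eq_zero_of_near_real {F : Type*} [NormedAddCommGroup F]
    [NormedSpace ℂ F] [CompleteSpace F] {γ : ClosedContour} {f : ℂ → F} {σ : Set ℂ}
    (hσ : ∀ s ∈ σ, s.im = 0) {ρ : ℝ} (hf : DifferentiableOn ℂ f {z | Metric.infDist z σ < ρ})
    (hγ : ∀ z ∈ γ.support, Metric.infDist z σ < ρ) : γ.integral f = 0 := by
  refine integral_eq_zero_of_hasDerivAt (hf.continuousOn.mono hγ) fun i => ?_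
  obtain ⟨U, hU, hs, hm, hUN⟩ := exists_simplyConnected_of_real hσ (continuousOn_curve i)
    fun t ht => hγ _ (mem_support i ht)
  exact ⟨U, hU, hm, exists_primitive hU hs (hf.mono hUN)⟩

/-! ### Contour integrals of the inverse of the transfer function -/

namespace ResolventKernel

variable {H : Type*} [NormedAddCommGroup H] [InnerProductSpace ℂ H] [CompleteSpace H]
  {A : H →ₗ.[ℂ] H} {I : Set ℝ} {c : ℝ → ℂ} {κ : ℝ → H →L[ℂ] H} {d ρ : ℝ} {X Y : H →L[ℂ] H}
  {z : ℂ}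

/-- The factor `F(z)` in the factorization `A - z + W(z) = F(z) (A + X - z)`. -/
def factor (A : H →ₗ.[ℂ] H) (I : Set ℝ) (c : ℝ → ℂ) (κ : ℝ → H →L[ℂ] H) (X : H →L[ℂ] H)
    (z : ℂ) : H →L[ℂ] H :=
  1 + ∫ t in I, κ t * ((c t - z)⁻¹ • resolventOp (addBounded A X) (c t))

/-- The operator `G(z)` in the identity `F(z) - (A + Y - z) G(z) = 1 - Ω`. -/
def remainder (A : H →ₗ.[ℂ] H) (I : Set ℝ) (c : ℝ → ℂ) (κ : ℝ → H →L[ℂ] H) (X Y : H →L[ℂ] H)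
    (z : ℂ) : H →L[ℂ] H :=
  ∫ t in I, resolventOp (addBounded A Y) (c t) * κ t *
    ((c t - z)⁻¹ • resolventOp (addBounded A X) (c t))

theorem sub_le_norm_sub (hK : ResolventKernel A I c κ d) (hz : Metric.infDist z (spec A) < ρ)
    {t : ℝ} (ht : t ∈ I) : d - ρ ≤ ‖c t - z‖ := by
  have h1 := hK.le_infDist t ht
  have h2 := Metric.infDist_le_infDist_add_dist (s := spec A) (x := c t) (y := z)
  rw [dist_eq_norm] at h2
  linarith

theorem sub_ne_zero_of_lt (hK : ResolventKernel A I c κ d) (hρ : ρ < d)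
    (hz : Metric.infDist z (spec A) < ρ) {t : ℝ} (ht : t ∈ I) : c t - z ≠ 0 :=
  norm_pos_iff.1 ((sub_pos.2 hρ).trans_le (hK.sub_le_norm_sub hz ht))

theorem norm_pole_le (hK : ResolventKernel A I c κ d) (hX : ‖X‖ < d) (hρ : ρ < d)
    (hz : Metric.infDist z (spec A) < ρ) {t : ℝ} (ht : t ∈ I) :
    ‖(c t - z)⁻¹ • resolventOp (addBounded A X) (c t)‖ ≤ (d - ρ)⁻¹ * (d - ‖X‖)⁻¹ := by
  have h0 := sub_pos.2 hρ
  rw [norm_smul, norm_inv]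
  gcongr
  · exact hK.sub_le_norm_sub hz ht
  · exact hK.norm_resolventOp_le hX ht

theorem continuousOn_pole (hK : ResolventKernel A I c κ d) (hX : ‖X‖ < d) (hρ : ρ < d)
    (hz : Metric.infDist z (spec A) < ρ) :
    ContinuousOn (fun t => (c t - z)⁻¹ • resolventOp (addBounded A X) (c t)) I :=
  ((hK.continuousOn.sub continuousOn_const).inv₀ fun _ ht =>
    hK.sub_ne_zero_of_lt hρ hz ht).smul (hK.continuousOn_resolventOp hX)

theorem differentiableOn_integral_pole (hK : ResolventKernel A I c κ d) (hX : ‖X‖ < d) (hρ : ρ < d)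
    {L : ℝ → H →L[ℂ] H} {l : ℝ} (hL : ContinuousOn L I) (hl : ∀ t ∈ I, ‖L t‖ ≤ l) :
    DifferentiableOn ℂ (fun z => ∫ t in I, L t * κ t *
      ((c t - z)⁻¹ • resolventOp (addBounded A X) (c t))) {z | Metric.infDist z (spec A) < ρ} := by
  refine differentiableOn_integral_of_bound
    (isOpen_lt (Metric.continuous_infDist_pt _) continuous_const)
    (bound := fun t => l * ‖κ t‖ * ((d - ρ)⁻¹ * (d - ‖X‖)⁻¹)) (fun z hz =>
      (hK.integrableOn_mul hL (hK.continuousOn_pole hX hρ hz) hl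
        fun t ht => hK.norm_pole_le hX hρ hz ht).aestronglyMeasurable)
    ((hK.integrableOn.norm.const_mul _).mul_const _) ?_ ?_
  · filter_upwards [ae_restrict_mem hK.isOpen.measurableSet] with t ht z hz
    refine (norm_mul_le _ _).trans (mul_le_mul ((norm_mul_le _ _).trans ?_)
      (hK.norm_pole_le hX hρ hz ht) (norm_nonneg _) ?_)
    · exact mul_le_mul_of_nonneg_right (hl t ht) (norm_nonneg _)
    · exact mul_nonneg ((norm_nonneg _).trans (hl t ht)) (norm_nonneg _)
  · filter_upwards [ae_restrict_mem hK.isOpen.measurableSet] with t ht z hz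
    exact ((((differentiableAt_id.const_sub _).inv
      (hK.sub_ne_zero_of_lt hρ hz ht)).smul_const _).const_mul _).differentiableWithinAt

theorem integrableOn_factor (hK : ResolventKernel A I c κ d) (hX : ‖X‖ < d) (hρ : ρ < d)
    (hz : Metric.infDist z (spec A) < ρ) :
    IntegrableOn (fun t => κ t * ((c t - z)⁻¹ • resolventOp (addBounded A X) (c t))) I := by
  have := hK.integrableOn_mul (L := fun _ => 1) continuousOn_const
    (hK.continuousOn_pole hX hρ hz) (fun _ _ => le_rfl) (fun t ht => hK.norm_pole_le hX hρ hz ht)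
  simpa only [one_mul] using this

theorem differentiableOn_factor (hK : ResolventKernel A I c κ d) (hX : ‖X‖ < d) (hρ : ρ < d) :
    DifferentiableOn ℂ (factor A I c κ X) {z | Metric.infDist z (spec A) < ρ} := by
  have := hK.differentiableOn_integral_pole hX hρ (L := fun _ => 1) continuousOn_const
    (fun _ _ => le_rfl)
  simp only [one_mul] at this
  exact this.const_add 1

theorem differentiableOn_remainder (hK : ResolventKernel A I c κ d) (hX : ‖X‖ < d) (hY : ‖Y‖ < d)
    (hρ : ρ < d) :
    DifferentiableOn ℂ (remainder A I c κ X Y) {z | Metric.infDist z (spec A) < ρ} :=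
  hK.differentiableOn_integral_pole hX hρ (hK.continuousOn_resolventOp hY)
    fun _ ht => hK.norm_resolventOp_le hY ht

/-- The integral in the factor has norm at most `V / ((d - ρ) (d - ‖X‖)) < 1`. -/
theorem isUnit_factor (hK : ResolventKernel A I c κ d) (hX : ‖X‖ < d) (hρ : ρ < d)
    (hV : ∫ t in I, ‖κ t‖ < (d - ρ) * (d - ‖X‖)) (hz : Metric.infDist z (spec A) < ρ) :
    IsUnit (factor A I c κ X z) := by
  have h1 := sub_pos.2 hρ
  have h2 := sub_pos.2 hX
  have hn : ‖-∫ t in I, κ t * ((c t - z)⁻¹ • resolventOp (addBounded A X) (c t))‖ < 1 := by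
    rw [norm_neg]
    calc _ ≤ ∫ t in I, ‖κ t‖ * ((d - ρ)⁻¹ * (d - ‖X‖)⁻¹) := by
          refine norm_integral_le_of_norm_le (hK.integrableOn.norm.mul_const _) ?_
          filter_upwards [ae_restrict_mem hK.isOpen.measurableSet] with t ht
          exact (norm_mul_le _ _).trans
            (mul_le_mul_of_nonneg_left (hK.norm_pole_le hX hρ hz ht) (norm_nonneg _))
      _ < 1 := by
          rw [integral_mul_const, ← mul_inv, ← div_eq_mul_inv, div_lt_one (by positivity)]
          exact hV
  have := (Units.oneSub _ hn).isUnit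
  rwa [Units.val_oneSub, sub_neg_eq_add] at this

variable {a : H →L[ℂ] H}

theorem resolventOp_mul_sub (hK : ResolventKernel (everywhere a) I c κ d) (hX : ‖X‖ < d) {t : ℝ}
    (ht : t ∈ I) (z : ℂ) : resolventOp (addBounded (everywhere a) X) (c t) * (a + X - z • 1) =
      1 + (c t - z) • resolventOp (addBounded (everywhere a) X) (c t) := by
  have h := hK.isBoundedInverse hX ht
  set R := resolventOp (addBounded (everywhere a) X) (c t)
  rw [addBounded_everywhere, shift_everywhere, isBoundedInverse_everywhere] at h
  rw [show a + X - z • 1 = (a + X - c t • 1) + (c t - z) • 1 by module, mul_add, h.1,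
    mul_smul_comm, mul_one]

theorem sub_mul_resolventOp (hK : ResolventKernel (everywhere a) I c κ d) (hY : ‖Y‖ < d) {t : ℝ}
    (ht : t ∈ I) (z : ℂ) : (a + Y - z • 1) * resolventOp (addBounded (everywhere a) Y) (c t) =
      1 + (c t - z) • resolventOp (addBounded (everywhere a) Y) (c t) := by
  have h := hK.isBoundedInverse hY ht
  set R := resolventOp (addBounded (everywhere a) Y) (c t)
  rw [addBounded_everywhere, shift_everywhere, isBoundedInverse_everywhere] at h
  rw [show a + Y - z • 1 = (a + Y - c t • 1) + (c t - z) • 1 by module, add_mul, h.2,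
    smul_mul_assoc, one_mul]

/-- The factorization of the transfer function. -/
theorem factor_mul (hK : ResolventKernel (everywhere a) I c κ d) (hX : ‖X‖ < d)
    (hXr : X = rightMap (everywhere a) I c κ X) (hρ : ρ < d)
    (hz : Metric.infDist z (spec (everywhere a)) < ρ) :
    factor (everywhere a) I c κ X z * (a + X - z • 1) =
      a - z • 1 + ∫ t in I, (c t - z)⁻¹ • κ t := by
  have hi := hK.integrableOn_factor hX hρ hz
  have hr := hK.integrableOn_rightMap hX
  have e1 : (∫ t in I, κ t * ((c t - z)⁻¹ • resolventOp (addBounded (everywhere a) X) (c t))) *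
      (a + X - z • 1) = (∫ t in I, (c t - z)⁻¹ • κ t) - X := by
    -- Since `r (a + X - z) = 1 + (c - z) r`, the integrand splits into that of the transfer
    -- function and `κ r`, whose integral is `-X`.
    have e2 : ∀ t ∈ I, κ t * ((c t - z)⁻¹ • resolventOp (addBounded (everywhere a) X) (c t)) *
        (a + X - z • 1) - κ t * resolventOp (addBounded (everywhere a) X) (c t) =
          (c t - z)⁻¹ • κ t := fun t ht => by
      rw [mul_smul_comm, smul_mul_assoc, mul_assoc, hK.resolventOp_mul_sub hX ht, mul_add, smul_add,
        mul_smul_comm, smul_smul, inv_mul_cancel₀ (hK.sub_ne_zero_of_lt hρ hz ht), one_smul,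
        mul_one, add_sub_cancel_right]
    rw [← setIntegral_congr_fun hK.isOpen.measurableSet e2, integral_sub (hi.mul_const _) hr,
      integral_mul_const_of_integrable hi]
    have e3 : ∫ t in I, κ t * resolventOp (addBounded (everywhere a) X) (c t) = -X := by
      conv_rhs => rw [hXr, rightMap, neg_neg]
    rw [e3]
    abel
  rw [factor, add_mul, one_mul, e1]
  abel

/-- Since `(a + Y - z) q = 1 + (c - z) q`, the integrand of `(a + Y - z) G(z)` splits into that of
`F(z) - 1` and that of `Ω`. -/
theorem factor_sub (hK : ResolventKernel (everywhere a) I c κ d) (hX : ‖X‖ < d) (hY : ‖Y‖ < d)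
    (hρ : ρ < d) (hz : Metric.infDist z (spec (everywhere a)) < ρ) :
    factor (everywhere a) I c κ X z -
      (a + Y - z • 1) * remainder (everywhere a) I c κ X Y z = 1 - omega (everywhere a) I c κ X Y := by
  have hi := hK.integrableOn_factor hX hρ hz
  have ho := hK.integrableOn_omega hX hY
  have hr := hK.integrableOn_mul (hK.continuousOn_resolventOp hY) (hK.continuousOn_pole hX hρ hz)
    (fun t ht => hK.norm_resolventOp_le hY ht) (fun t ht => hK.norm_pole_le hX hρ hz ht)
  have e1 : (a + Y - z • 1) * remainder (everywhere a) I c κ X Y z =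
      (∫ t in I, κ t * ((c t - z)⁻¹ • resolventOp (addBounded (everywhere a) X) (c t))) +
        omega (everywhere a) I c κ X Y := by
    rw [remainder, omega, ← integral_const_mul_of_integrable hr, ← integral_add hi ho]
    refine setIntegral_congr_fun hK.isOpen.measurableSet fun t ht => ?_
    rw [← mul_assoc, ← mul_assoc, hK.sub_mul_resolventOp hY ht, add_mul, add_mul, one_mul]
    congr 1
    rw [mul_smul_comm, smul_mul_assoc, smul_mul_assoc, smul_smul,
      inv_mul_cancel₀ (hK.sub_ne_zero_of_lt hρ hz ht), one_smul]
  rw [factor, e1]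
  abel

theorem mul_one_sub_omega (hK : ResolventKernel (everywhere a) I c κ d) (hX : ‖X‖ < d)
    (hY : ‖Y‖ < d) (hXr : X = rightMap (everywhere a) I c κ X)
    (hYl : Y = leftMap (everywhere a) I c κ Y) :
    (a + Y) * (1 - omega (everywhere a) I c κ X Y) =
      (1 - omega (everywhere a) I c κ X Y) * (a + X) := by
  obtain ⟨t, ht⟩ := hK.nonempty
  have hR := hK.isBoundedInverse hX ht
  have hQ := hK.isBoundedInverse hY ht
  have h := hK.resolvent_mul_one_sub_omega hX hY hXr hYl hR hQ
  set V := 1 - omega (everywhere a) I c κ X Y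
  rw [addBounded_everywhere, shift_everywhere, isBoundedInverse_everywhere] at hR hQ
  rw [addBounded_everywhere, addBounded_everywhere] at h
  set R := resolventOp (everywhere (a + X)) (c t)
  set Q := resolventOp (everywhere (a + Y)) (c t)
  have h1 : (a + Y - c t • 1) * V = V * (a + X - c t • 1) := by
    calc _ = (a + Y - c t • 1) * V * (R * (a + X - c t • 1)) := by rw [hR.1, mul_one]
      _ = (a + Y - c t • 1) * (V * R) * (a + X - c t • 1) := by simp only [mul_assoc]
      _ = (a + Y - c t • 1) * Q * V * (a + X - c t • 1) := by rw [← h]; simp only [mul_assoc]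
      _ = _ := by rw [hQ.2, one_mul]
  simp only [sub_mul, mul_sub, smul_mul_assoc, mul_smul_comm, one_mul, mul_one] at h1
  exact sub_left_injective h1

end ResolventKernel

namespace ResolventKernel

variable {H : Type*} [NormedAddCommGroup H] [InnerProductSpace ℂ H] [CompleteSpace H]
  {I : Set ℝ} {c : ℝ → ℂ} {κ : ℝ → H →L[ℂ] H} {d ρ : ℝ} {X Y a : H →L[ℂ] H} {z : ℂ}

/-- With `W = (1 - Ω)⁻¹` and `T = (z - a - X)⁻¹`, the relation between `F` and `G` and the
intertwining of `a + Y` with `a + X` give `W F = 1 + (a + X - z) W G`. Hence the inverse `-T F⁻¹`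
equals `-T W - W G F⁻¹`, where only the first term is singular at the spectrum of `a + X`. -/
theorem isBoundedInverse_transfer (hK : ResolventKernel (everywhere a) I c κ d) (hX : ‖X‖ < d / 2)
    (hY : ‖Y‖ < d / 2) (hXr : X = rightMap (everywhere a) I c κ X)
    (hYl : Y = leftMap (everywhere a) I c κ Y) (hρ : ρ < d)
    (hV : ∫ t in I, ‖κ t‖ < (d - ρ) * (d - ‖X‖))
    (hz : Metric.infDist z (spec (everywhere a)) < ρ) (hzs : z ∉ spectrum ℂ (a + X)) :
    IsBoundedInverse (addBounded (shift (everywhere a) z) (∫ t in I, (c t - z)⁻¹ • κ t))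
      (-(resolvent (a + X) z * Ring.inverse (1 - omega (everywhere a) I c κ X Y)) -
        Ring.inverse (1 - omega (everywhere a) I c κ X Y) *
          remainder (everywhere a) I c κ X Y z * Ring.inverse (factor (everywhere a) I c κ X z)) := by
  have hd := hK.pos
  have hX' : ‖X‖ < d := by linarith
  have hY' : ‖Y‖ < d := by linarith
  have hVu := hK.isUnit_one_sub_omega hX hY
  have hfu := hK.isUnit_factor hX' hρ hV hz
  have hsub := hK.factor_sub hX' hY' hρ hz
  have hint := hK.mul_one_sub_omega hX' hY' hXr hYl
  rw [shift_everywhere, addBounded_everywhere, ← hK.factor_mul hX' hXr hρ hz]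
  set V := 1 - omega (everywhere a) I c κ X Y
  set F := factor (everywhere a) I c κ X z
  set G := remainder (everywhere a) I c κ X Y z
  set W := Ring.inverse V
  have hWV : W * V = 1 := Ring.inverse_mul_cancel _ hVu
  have hVW : V * W = 1 := Ring.mul_inverse_cancel _ hVu
  have hFi : Ring.inverse F * F = 1 := Ring.inverse_mul_cancel _ hfu
  have hiF : F * Ring.inverse F = 1 := Ring.mul_inverse_cancel _ hfu
  have hT1 : resolvent (a + X) z * (algebraMap ℂ _ z - (a + X)) = 1 :=
    Ring.inverse_mul_cancel _ (not_not.1 hzs)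
  have hT2 : (algebraMap ℂ _ z - (a + X)) * resolvent (a + X) z = 1 :=
    Ring.mul_inverse_cancel _ (not_not.1 hzs)
  rw [Algebra.algebraMap_eq_smul_one] at hT1 hT2
  set T := resolvent (a + X) z
  have hb : a + X - z • 1 = -(z • 1 - (a + X)) := by abel
  have hT1' : -T * (a + X - z • 1) = 1 := by rw [hb, neg_mul_neg, hT1]
  have hT2' : (a + X - z • 1) * -T = 1 := by rw [hb, neg_mul_neg, hT2]
  have hW : W * (a + Y - z • 1) = (a + X - z • 1) * W := by
    have h1 : W * (a + Y) = (a + X) * W := by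
      calc _ = W * ((a + Y) * V) * W := by rw [mul_assoc, mul_assoc, hVW, mul_one]
        _ = W * V * (a + X) * W := by rw [hint]; simp only [mul_assoc]
        _ = _ := by rw [hWV, one_mul]
    rw [mul_sub, sub_mul, h1, mul_smul_comm, smul_mul_assoc, one_mul, mul_one]
  have key : -(T * W) - W * G * Ring.inverse F = -T * Ring.inverse F := by
    have h2 : W * F = 1 + (a + X - z • 1) * (W * G) := by
      rw [← mul_assoc, ← hW, mul_assoc, sub_eq_iff_eq_add.1 hsub, mul_add, hWV]
    have h3 : -T * W * F = -T + W * G := by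
      rw [mul_assoc, h2, mul_add, mul_one, ← mul_assoc, hT1', one_mul]
    calc _ = -T * W * F * Ring.inverse F - W * G * Ring.inverse F := by
          rw [mul_assoc (-T * W), hiF, mul_one, neg_mul]
      _ = _ := by rw [h3, add_mul, add_sub_cancel_right]
  rw [key, isBoundedInverse_everywhere]
  constructor
  · rw [mul_assoc, ← mul_assoc (Ring.inverse F), hFi, one_mul, hT1']
  · rw [mul_assoc, ← mul_assoc (a + X - z • 1), hT2', one_mul, hiF]

/-- The contour may reach the boundary of the closed `d / 2`-neighbourhood, so holomorphy is needed
on a slightly larger open one; the strict bound `‖X‖ < d / 2` leaves room for it. -/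
theorem exists_radius (hK : ResolventKernel (everywhere a) I c κ d) (hX : ‖X‖ < d / 2) :
    ∃ ρ, d / 2 < ρ ∧ ρ < d ∧ ∫ t in I, ‖κ t‖ < (d - ρ) * (d - ‖X‖) := by
  have hd := hK.pos
  have hV := hK.variation_lt
  have hV0 : 0 ≤ ∫ t in I, ‖κ t‖ := by positivity
  have hx : 0 < d - ‖X‖ := by linarith
  obtain ⟨r, h1, h2⟩ := exists_between (show (∫ t in I, ‖κ t‖) / (d - ‖X‖) < d / 2 by
    rw [div_lt_iff₀ hx]
    nlinarith)
  have h3 : 0 ≤ (∫ t in I, ‖κ t‖) / (d - ‖X‖) := by positivity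
  refine ⟨d - r, by linarith, by linarith, ?_⟩
  rw [sub_sub_cancel]
  exact (div_lt_iff₀ hx).1 h1

/-- The contour integrals of the inverse transfer function around the spectrum of `A + X`. -/
theorem contour_transfer (hK : ResolventKernel (everywhere a) I c κ d) (hX : ‖X‖ < d / 2)
    (hY : ‖Y‖ < d / 2) (hXr : X = rightMap (everywhere a) I c κ X)
    (hYl : Y = leftMap (everywhere a) I c κ Y) (hre : ∀ s ∈ spec (everywhere a), s.im = 0)
    {γ : ClosedContour} (hγ : γ.GoesAround (spec (addBounded (everywhere a) X))
      (Metric.cthickening (d / 2) (spec (everywhere a)))) {M : ℂ → H →ₗ.[ℂ] H}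
    (hM : ∀ z, M z = addBounded (shift (everywhere a) z) (∫ t in I, (c t - z)⁻¹ • κ t)) :
    (∀ z ∈ γ.support, ∃ R, IsBoundedInverse (M z) R) ∧
      γ.Integrable (fun z => boundedInverse (M z)) ∧
      -(1 / (2 * Real.pi * Complex.I) : ℂ) • γ.integral (fun z => boundedInverse (M z)) =
        Ring.inverse (1 - omega (everywhere a) I c κ X Y) ∧
      -(1 / (2 * Real.pi * Complex.I) : ℂ) • γ.integral (fun z => z • boundedInverse (M z)) =
        (a + X) * Ring.inverse (1 - omega (everywhere a) I c κ X Y) := by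
  have hd := hK.pos
  obtain ⟨ρ, hρ1, hρ, hV⟩ := hK.exists_radius hX
  have hX' : ‖X‖ < d := by linarith
  have hY' : ‖Y‖ < d := by linarith
  have hspec : spec (addBounded (everywhere a) X) = spectrum ℂ (a + X) := by
    rw [addBounded_everywhere, spec_everywhere]
  have hdisj : Disjoint γ.support (spectrum ℂ (a + X)) := hspec ▸ hγ.disjoint
  have hwind := hspec ▸ hγ.winding
  have hN : ∀ z ∈ γ.support, Metric.infDist z (spec (everywhere a)) < ρ := fun z hz => by
    have h1 := Metric.mem_cthickening_iff.1 (hγ.inside hz)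
    exact (ENNReal.toReal_le_of_le_ofReal (by linarith) h1).trans_lt hρ1
  set W := Ring.inverse (1 - omega (everywhere a) I c κ X Y)
  set h : ℂ → H →L[ℂ] H := fun z =>
    W * remainder (everywhere a) I c κ X Y z * Ring.inverse (factor (everywhere a) I c κ X z)
  have hinv : ∀ z ∈ γ.support, IsBoundedInverse (M z) (-(resolvent (a + X) z * W) - h z) :=
    fun z hz => hM z ▸ hK.isBoundedInverse_transfer hX hY hXr hYl hρ hV (hN z hz)
      (disjoint_left.1 hdisj hz)
  have hh : DifferentiableOn ℂ h {z | Metric.infDist z (spec (everywhere a)) < ρ} := by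
    refine ((hK.differentiableOn_remainder hX' hY' hρ).const_mul W).mul fun z hz => ?_
    exact (differentiableAt_inverse (𝕜 := ℂ) (hK.isUnit_factor hX' hρ hV hz)).comp_differentiableWithinAt
      z (hK.differentiableOn_factor hX' hρ z hz)
  have hT := ClosedContour.continuousOn_resolvent hdisj
  have hTW : ContinuousOn (fun z => resolvent (a + X) z * W) γ.support := hT.mul continuousOn_const
  have hhc := hh.continuousOn.mono hN
  have heq : EqOn (fun z => boundedInverse (M z)) (fun z => -(resolvent (a + X) z * W) - h z)
      γ.support := fun z hz => (hinv z hz).boundedInverse_eq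
  have hcont := (hTW.neg.sub hhc).congr heq
  refine ⟨fun z hz => ⟨_, hinv z hz⟩, ClosedContour.integrable_of_continuousOn hcont, ?_, ?_⟩
  -- The holomorphic part `h` integrates to zero by Cauchy's theorem. The sign arises because
  -- `resolvent b z` is `(z - b)⁻¹`.
  · have e1 : γ.integral (fun z => boundedInverse (M z)) = -(γ.integral (resolvent (a + X)) * W) := by
      rw [ClosedContour.integral_congr heq, ClosedContour.integral_sub (g := h)
        (f := fun z => -(resolvent (a + X) z * W)) hTW.neg hhc,
        ClosedContour.integral_eq_zero_of_near_real hre hh hN, sub_zero]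
      exact ClosedContour.integral_clm hT (-(ContinuousLinearMap.mul ℂ _).flip W)
    rw [e1, one_div, neg_smul_neg, ← smul_mul_assoc, ClosedContour.integral_resolvent hdisj hwind,
      one_mul]
  · have hidh : DifferentiableOn ℂ (fun z => z • h z)
        {z | Metric.infDist z (spec (everywhere a)) < ρ} := differentiableOn_id.smul hh
    have hzT : ContinuousOn (fun z => z • resolvent (a + X) z) γ.support := continuousOn_id.smul hT
    have hzTW : ContinuousOn (fun z => -(z • resolvent (a + X) z * W)) γ.support :=
      (hzT.mul continuousOn_const).neg
    have e2 : EqOn (fun z => z • boundedInverse (M z))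
        (fun z => -(z • resolvent (a + X) z * W) - z • h z) γ.support := fun z hz => by
      simp only
      rw [(hinv z hz).boundedInverse_eq, smul_sub, smul_neg, smul_mul_assoc]
    have e1 : γ.integral (fun z => z • boundedInverse (M z)) =
        -(γ.integral (fun z => z • resolvent (a + X) z) * W) := by
      rw [ClosedContour.integral_congr e2, ClosedContour.integral_sub hzTW
        (hidh.continuousOn.mono hN), ClosedContour.integral_eq_zero_of_near_real hre hidh hN,
        sub_zero]
      exact ClosedContour.integral_clm hzT (-(ContinuousLinearMap.mul ℂ _).flip W)
    rw [e1, one_div, neg_smul_neg, ← smul_mul_assoc,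
      ClosedContour.integral_smul_resolvent hdisj hwind]

end ResolventKernel

/-! ### Collected data of the two contours -/

namespace Setting

open ResolventKernel

variable {H₀ H₁ : Type*} [NormedAddCommGroup H₀] [InnerProductSpace ℂ H₀] [CompleteSpace H₀]
  [NormedAddCommGroup H₁] [InnerProductSpace ℂ H₁] [CompleteSpace H₁] {S : Setting H₀ H₁}
  {Γ : ℤˣ → ℝ → ℂ} {X : ℤˣ → H₁ →L[ℂ] H₁}

theorem M₁_eq (c : ℝ → ℂ) (z : ℂ) : S.M₁ c z =
    addBounded (shift S.A₁ z) (∫ t in S.Δ₀, (c t - z)⁻¹ • S.density c t) := by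
  rw [M₁, W₁]
  simp only [density, smul_smul, mul_comm]

/-- The data attached to the two contours: the resolvent kernel and the two root equations. -/
theorem root_data (hΓ : ∀ l, S.IsAdmissible l (Γ l))
    (hbound : ∀ l, S.variation (Γ l) < 1 / 4 * S.dist (Γ l) ^ 2)
    (hpair : (∀ t ∈ S.Δ₀, Γ (-1) t = conj (Γ 1 t)) ∨ S.DecayAtInfinity)
    (hX : ∀ l, S.IsRootPart (Γ l) (X l)) (l : ℤˣ) :
    ‖X l‖ < S.dist (Γ l) / 2 ∧ ‖star (X (-l))‖ < S.dist (Γ l) / 2 ∧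
      X l = rightMap S.A₁ S.Δ₀ (Γ l) (S.density (Γ l)) (X l) ∧
      star (X (-l)) = leftMap S.A₁ S.Δ₀ (Γ l) (S.density (Γ l)) (star (X (-l))) := by
  have h := (hX (-l)).star_eq_leftMap (hΓ l) (hΓ (-l)) (hbound l) (hbound (-l)) (pair_neg hpair l)
  exact ⟨(hX l).norm_lt_half (hΓ l) (hbound l), (norm_star (X (-l))).symm ▸ h.1,
    (hX l).equation.trans (S.W₁op_eq _ _), h.2⟩

end Setting

end Feshbach

end

theorem theorem3p4 {H₀ H₁ : Type*}
    [NormedAddCommGroup H₀] [InnerProductSpace ℂ H₀] [CompleteSpace H₀]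
    [NormedAddCommGroup H₁] [InnerProductSpace ℂ H₁] [CompleteSpace H₁] [Nontrivial H₁]
    (S : Feshbach.Setting H₀ H₁)
    (Γ : ℤˣ → ℝ → ℂ) (hΓ : ∀ l, S.IsAdmissible l (Γ l))
    (hbound : ∀ l, S.variation (Γ l) < 1 / 4 * S.dist (Γ l) ^ 2)
    (hpair : (∀ t ∈ S.Δ₀, Γ (-1) t = conj (Γ 1 t)) ∨ S.DecayAtInfinity)
    (X : ℤˣ → H₁ →L[ℂ] H₁) (hX : ∀ l, S.IsRootPart (Γ l) (X l)) :
    (∀ l : ℤˣ,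
      IntegrableOn (S.omegaIntegrand (Γ l) (X l) (X (-l))) S.Δ₀ ∧
      ‖S.Omega Γ X l‖ ≤ S.variation (Γ l) / (1 / 4 * S.dist (Γ l) ^ 2) ∧
      (S.B ≠ 0 → ‖S.Omega Γ X l‖ < S.variation (Γ l) / (1 / 4 * S.dist (Γ l) ^ 2)) ∧
      S.variation (Γ l) / (1 / 4 * S.dist (Γ l) ^ 2) < 1 ∧
      S.Omega Γ X (-l) = ContinuousLinearMap.adjoint (S.Omega Γ X l) ∧
      IsUnit (1 - S.Omega Γ X l) ∧
      Feshbach.boundedMul (Ring.inverse (1 - S.Omega Γ X l)) (S.Z (X (-l))).adjoint =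
        Feshbach.mulBounded (S.Z (X l)) (Ring.inverse (1 - S.Omega Γ X l)) ∧
      (S.A₁.domain = ⊤ → ∀ γ : Feshbach.ClosedContour,
        γ.GoesAround (Feshbach.spec (S.Z (X l))) (Metric.cthickening (S.dist (Γ l) / 2) S.σ₁) →
          (∀ z ∈ γ.support, ∃ R, Feshbach.IsBoundedInverse (S.M₁ (Γ l) z) R) ∧
          γ.Integrable (fun z => Feshbach.boundedInverse (S.M₁ (Γ l) z)) ∧
          -(1 / (2 * Real.pi * Complex.I) : ℂ) •
              γ.integral (fun z => Feshbach.boundedInverse (S.M₁ (Γ l) z)) =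
            Ring.inverse (1 - S.Omega Γ X l) ∧
          Feshbach.everywhere (-(1 / (2 * Real.pi * Complex.I) : ℂ) •
              γ.integral (fun z => z • Feshbach.boundedInverse (S.M₁ (Γ l) z))) =
            Feshbach.boundedMul (Ring.inverse (1 - S.Omega Γ X l)) (S.Z (X (-l))).adjoint ∧
          Feshbach.everywhere (-(1 / (2 * Real.pi * Complex.I) : ℂ) •
              γ.integral (fun z => z • Feshbach.boundedInverse (S.M₁ (Γ l) z))) =
            Feshbach.mulBounded (S.Z (X l)) (Ring.inverse (1 - S.Omega Γ X l)))) ∧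
    Feshbach.Similar (S.Z (X 1)) (S.Z (X (-1))).adjoint := by
  open Feshbach Feshbach.Setting in
  have hroot := root_data hΓ hbound hpair hX
  have hK (l : ℤˣ) := (hΓ l).resolventKernel (hbound l)
  have hd (l : ℤˣ) := (hK l).pos
  have hXd (l : ℤˣ) : ‖X l‖ < S.dist (Γ l) := by linarith [(hroot l).1, hd l]
  have hYd (l : ℤˣ) : ‖star (X (-l))‖ < S.dist (Γ l) := by linarith [(hroot l).2.1, hd l]
  have hunit (l : ℤˣ) : IsUnit (1 - S.Omega Γ X l) := by
    rw [Omega_eq]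
    exact (hK l).isUnit_one_sub_omega (hroot l).1 (hroot l).2.1
  -- Any point of the contour is a common regular point of both operators; one of them suffices to
  -- pass from intertwined resolvents to the operators themselves.
  obtain ⟨t, ht⟩ := S.nonempty_Δ₀
  have hR (l : ℤˣ) := (hK l).isBoundedInverse (hXd l) ht
  have hQ (l : ℤˣ) := (hK l).isBoundedInverse (hYd l) ht
  have hint (l : ℤˣ) := (hK l).resolvent_mul_one_sub_omega (hXd l) (hYd l) (hroot l).2.2.1
    (hroot l).2.2.2 (hR l) (hQ l)
  simp only [← Omega_eq] at hint
  simp only [← adjoint_Z] at hQ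
  have hsim (l : ℤˣ) := boundedMul_inverse_eq (hR l) (hQ l) (hunit l)
    (by simpa only [adjoint_Z] using hint l)
  have hnorm (l : ℤˣ) := (hK l).norm_omega_le (hroot l).1 (hroot l).2.1
  have hone (l : ℤˣ) := (hK l).variation_div_lt_one
  simp only [← Omega_eq, ← variation_eq] at hnorm hone
  refine ⟨fun l => ⟨?_, (hnorm l).1, fun hB => (hnorm l).2 (variation_pos (hΓ l) hB), hone l,
    star_Omega hΓ hbound hpair hX l, hunit l, hsim l, fun htop γ hγ => ?_⟩,
    similar_of_intertwining (hR 1) (hQ 1) (hunit 1) (by simpa only [adjoint_Z] using hint 1)⟩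
  · exact ((hK l).integrableOn_omega (hXd l) (hYd l)).congr_fun
      (fun t _ => (S.omegaIntegrand_eq _ _ _ t).symm) S.isOpen_Δ₀.measurableSet
  · obtain ⟨a, ha⟩ := exists_eq_everywhere S.selfAdjoint₁ htop
    have hKl := hK l
    have hre : ∀ s ∈ spec S.A₁, s.im = 0 := S.im_eq_zero_of_mem_σ₁
    obtain ⟨hX1, hY1, hXr, hYl⟩ := hroot l
    have hM : ∀ z, S.M₁ (Γ l) z = _ := S.M₁_eq (Γ l)
    rw [ha] at hKl hXr hYl hre
    have hZ : S.Z (X l) = everywhere (a + X l) := by rw [Z, ha, addBounded_everywhere]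
    rw [σ₁, Z, ha] at hγ
    simp only [ha] at hM
    obtain ⟨h1, h2, h3, h4⟩ := hKl.contour_transfer hX1 hY1 hXr hYl hre hγ hM
    rw [← ha, ← Omega_eq] at h3 h4
    refine ⟨h1, h2, h3, ?_, ?_⟩
    · rw [h4, hsim l, ← Z, hZ, mulBounded_everywhere]
    · rw [h4, hZ, mulBounded_everywhere]
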